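/- Let $H$ be a complex Hilbert space and $A$ a (possibly unbounded) self-adjoint operator in $H$. For $s\ge 0$ let $H_s=H_s(A)$ be the domain of $|A|^s$ with its graph norm, let $H_{-s}$ be the space of bounded antilinear functionals on $H_s$, with $H\subset H_{-s}$ via $x\mapsto \langle\,\cdot\,,x\rangle_H$, and let $H_\infty=\bigcap_{s\ge0}H_s$. Let $\mathbb R_+=[0,\infty)$ and let $C_0^\infty(\mathbb R_+,H_\infty)$ be the space of compactly supported functions $[0,\infty)\to H_\infty$ that are smooth up to $0$ as functions into every $H_s$. For $n\in\mathbb Z_+$ let $$\mathcal H_n=\bigcap_{k=0}^n H_k(\mathbb R_+,H_{n-k}),\qquad H_i(\mathbb R_+,H_j)=\{f\in L^2(\mathbb R_+,H) : (d/dx)^l f\in L^2(\mathbb R_+,H_j),\ 0\le l\le i\}$$ (distributional derivatives on $(0,\infty)$, natural Hilbert norms), and for non-integral $s>0$, $n=\lfloor s\rfloor$, let $\mathcal H_s=[\mathcal H_n,\mathcal H_{n+1}]_{s-n}$ be the (Hilbert space) interpolation space, given by the quadratic $K$-method. (1) For every real $s>1/2$, $C_0^\infty(\mathbb R_+,H_\infty)$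 is contained and dense in $\mathcal H_s$, and there is exactly one bounded linear map $r_s:\mathcal H_s\to H_{s-1/2}$ with $r_s f=f(0)$ for all $f\in C_0^\infty(\mathbb R_+,H_\infty)$. (2) Let $\gamma$ be a bounded operator on $H$ with $\gamma^*=-\gamma$, $\gamma^2=-I$, $\gamma(\mathcal D(A))=\mathcal D(A)$ and $\gamma A+A\gamma=0$ on $\mathcal D(A)$, and let $D_{\max}$ be the adjoint, in $L^2(\mathbb R_+,H)$, of the operator $\gamma(\frac{d}{dx}+A)$ with domain $C_0^\infty((0,\infty),H_1)$, where $H_1=\mathcal D(A)$ with the graph norm. Equip $\mathcal D(D_{\max})$ with the graph norm of $D_{\max}$. Then $C_0^\infty(\mathbb R_+,H_\infty)$ is contained and dense in $\mathcal D(D_{\max})$, and there is exactly one bounded linear map $r^*:\mathcal D(D_{\max})\to H_{-1/2}$ with $r^*f=f(0)$ for all $f\in C_0^\infty(\mathbb R_+,H_\infty)$. -/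

import Mathlib

open MeasureTheory Set
open scoped ENNReal NNReal ContDiff InnerProductSpace

noncomputable section

namespace TraceThm

/-! ### The graph norm of an unbounded operator -/

section GraphSpace

variable {E F : Type*} [NormedAddCommGroup E] [InnerProductSpace ℂ E]
  [NormedAddCommGroup F] [InnerProductSpace ℂ F]

/-- The domain of an unbounded operator `T`, equipped with its graph norm
`(‖x‖² + ‖T x‖²)^(1/2)`: it is realised as the graph `{(x, T x)}`, with the inner product
inherited from the Hilbert sum of `E` and `F`. -/
abbrev GraphSpace (T : E →ₗ.[ℂ] F) : Type _ :=
  ↥(T.graph.map (WithLp.linearEquiv 2 ℂ (E × F)).symm.toLinearMap)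

/-- The element `x` of the domain that underlies `(x, T x)`. -/
def GraphSpace.val (T : E →ₗ.[ℂ] F) : GraphSpace T →L[ℂ] E :=
  (WithLp.fstL 2 ℂ E F).comp (Submodule.subtypeL _)

/-- The value `T x`, as a function of `(x, T x)`. -/
def GraphSpace.app (T : E →ₗ.[ℂ] F) : GraphSpace T →L[ℂ] F :=
  (WithLp.sndL 2 ℂ E F).comp (Submodule.subtypeL _)

end GraphSpace

section Scale

variable {H : Type*} [NormedAddCommGroup H] [InnerProductSpace ℂ H] [CompleteSpace H]

/-! ### Powers of `|A|` and the scale `H_s(A)` -/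

/-- The closure of the graph of `A` in the Hilbert sum of two copies of `H`. -/
abbrev closedGraph (A : H →ₗ.[ℂ] H) : Submodule ℂ (WithLp 2 (H × H)) :=
  (A.graph.map (WithLp.linearEquiv 2 ℂ (H × H)).symm.toLinearMap).topologicalClosure

/-- For self-adjoint `A` this is the bounded operator `(1 + A²)⁻¹`
(see `invOneAddSq_spec`): `x ↦` the first component of the orthogonal projection
of `(x, 0)` onto the graph of `A`. -/
def invOneAddSq (A : H →ₗ.[ℂ] H) : H →L[ℂ] H :=
  (WithLp.fstL 2 ℂ H H) ∘L (closedGraph A).starProjection ∘L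
    (WithLp.prodContinuousLinearEquiv 2 ℂ H H).symm.toContinuousLinearMap ∘L
      ContinuousLinearMap.inl ℂ H H

/-- For self-adjoint `A`, every `R x`, with `R = invOneAddSq A`, lies in the domain of `A²`
and `(1 + A²) R x = x`. -/
theorem invOneAddSq_spec (A : H →ₗ.[ℂ] H) (hA : IsSelfAdjoint A) (x : H) :
    ∃ h₁ : invOneAddSq A x ∈ A.domain, ∃ h₂ : A ⟨invOneAddSq A x, h₁⟩ ∈ A.domain,
      invOneAddSq A x + A ⟨A ⟨invOneAddSq A x, h₁⟩, h₂⟩ = x := by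
  set e := WithLp.prodContinuousLinearEquiv 2 ℂ H H
  set G := A.graph.map (WithLp.linearEquiv 2 ℂ (H × H)).symm.toLinearMap with hG
  have hdense := hA.dense_domain
  have hadj : A.adjoint = A := hA
  have hcl : IsClosed (G : Set (WithLp 2 (H × H))) := by
    have h1 : (G : Set (WithLp 2 (H × H))) = e ⁻¹' (A.graph : Set (H × H)) := by
      ext z
      constructor
      · rintro ⟨y, hy, rfl⟩
        exact hy
      · intro hz
        exact ⟨e z, hz, rfl⟩
    rw [h1]
    exact hA.isClosed.preimage e.continuous
  have hGc : closedGraph A = G := hcl.submodule_topologicalClosure_eq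
  set X : WithLp 2 (H × H) := WithLp.toLp 2 (x, 0) with hX
  set p := (closedGraph A).starProjection X with hp
  have hu : invOneAddSq A x = p.fst := rfl
  have hpG : p ∈ G := hGc ▸ (closedGraph A).starProjection_apply_mem X
  obtain ⟨y, hy, hyp⟩ := hpG
  have hy' : (p.fst, p.snd) ∈ A.graph := by
    rw [← hyp]
    exact hy
  obtain ⟨v, hv1 : (v : H) = p.fst, hv2 : A v = p.snd⟩ := (LinearPMap.mem_graph_iff A).1 hy'
  have horth : ∀ w : A.domain, ⟪x - p.fst, (w : H)⟫_ℂ = ⟪p.snd, A w⟫_ℂ := by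
    intro w
    have hw : WithLp.toLp 2 ((w : H), A w) ∈ closedGraph A := by
      rw [hGc]
      exact ⟨((w : H), A w), A.mem_graph w, rfl⟩
    have h := (closedGraph A).starProjection_inner_eq_zero X _ hw
    rw [WithLp.prod_inner_apply] at h
    have h' : ⟪x - p.fst, (w : H)⟫_ℂ + ⟪0 - p.snd, A w⟫_ℂ = 0 := h
    rw [zero_sub, inner_neg_left] at h'
    exact add_neg_eq_zero.1 h'
  have h1 : invOneAddSq A x ∈ A.domain := by
    rw [hu, ← hv1]
    exact v.2
  have hval : A ⟨invOneAddSq A x, h1⟩ = p.snd := by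
    rw [← hv2]
    congr 1
    exact Subtype.ext (hu.trans hv1.symm)
  have h2' : p.snd ∈ A.adjoint.domain :=
    LinearPMap.mem_adjoint_domain_of_exists _ ⟨x - p.fst, horth⟩
  have h3 : A.adjoint ⟨p.snd, h2'⟩ = x - p.fst :=
    LinearPMap.adjoint_apply_eq hdense _ horth
  have key : ∀ B : H →ₗ.[ℂ] H, B = A → ∀ h : p.snd ∈ B.domain, B ⟨p.snd, h⟩ = x - p.fst →
      ∃ h₂ : A ⟨invOneAddSq A x, h1⟩ ∈ A.domain,
        invOneAddSq A x + A ⟨A ⟨invOneAddSq A x, h1⟩, h₂⟩ = x := by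
    rintro B rfl h hB
    refine ⟨hval ▸ h, ?_⟩
    have hB' : B ⟨B ⟨invOneAddSq B x, h1⟩, hval ▸ h⟩ = x - p.fst := by
      rw [← hB]
      congr 1
      exact Subtype.ext hval
    rw [hB', hu]
    abel
  exact ⟨h1, key _ hadj h2' h3⟩

/-- The power `|A|^s`, `s ≥ 0`, of a self-adjoint operator `A`. With `R = (1 + A²)⁻¹` one has
`|A|^s = (1 - R)^(s/2) R^(-s/2)`, so the graph of `|A|^s` consists of the pairs
`(R^(s/2) y, (1 - R)^(s/2) y)`, `y ∈ H`; the two powers are taken in the continuous functional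
calculus of the bounded self-adjoint operator `0 ≤ R ≤ 1`. -/
def absPow (A : H →ₗ.[ℂ] H) (s : ℝ) : H →ₗ.[ℂ] H :=
  (LinearMap.range
    ((cfc (fun t : ℝ => t ^ (s / 2)) (invOneAddSq A) : H →L[ℂ] H).toLinearMap.prod
      (cfc (fun t : ℝ => (1 - t) ^ (s / 2)) (invOneAddSq A) : H →L[ℂ] H).toLinearMap)).toLinearPMap

/-- `H_s(A)` for `s ≥ 0`: the domain of `|A|^s` with its graph norm. -/
abbrev Hs (A : H →ₗ.[ℂ] H) (s : ℝ) : Type _ := GraphSpace (absPow A s)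

/-- The inclusion of `H_s(A)` into `H`, `s ≥ 0`. -/
abbrev Hs.val (A : H →ₗ.[ℂ] H) (s : ℝ) : Hs A s →L[ℂ] H := GraphSpace.val (absPow A s)

/-- `H_{-s}(A)` for `s ≥ 0`: the space of bounded antilinear functionals on `H_s(A)`,
with the dual norm. -/
abbrev HsDual (A : H →ₗ.[ℂ] H) (s : ℝ) : Type _ := Hs A s →L⋆[ℂ] ℂ

/-- The inclusion `H ⊆ H_{-s}(A)`, `s ≥ 0`, given by the inner product of `H`:
`x ↦ (v ↦ ⟪v, x⟫)`. -/
def HsDual.ofH (A : H →ₗ.[ℂ] H) (s : ℝ) (x : H) : HsDual A s :=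
  ((innerSL ℂ).flip x).comp (Hs.val A s)

/-- The functions in `C₀^∞(ℝ₊, H_∞)`, `ℝ₊ = [0, ∞)`, `H_∞ = ⋂ H_s(A)`: functions with compact
support in `[0, ∞)` that are smooth up to `0` as functions into every `H_s(A)`.
Only the values on `[0, ∞)` matter. -/
structure IsSmoothCompact (A : H →ₗ.[ℂ] H) (φ : ℝ → H) : Prop where
  smooth : ∀ s : ℝ, 0 ≤ s → ∃ Φ : ℝ → Hs A s,
    ContDiffOn ℝ ∞ Φ (Ici 0) ∧ ∀ x, 0 ≤ x → Hs.val A s (Φ x) = φ x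
  compact : ∃ b : ℝ, ∀ x, b ≤ x → φ x = 0

/-! ### The scale `ℋ_s(ℝ₊, A)` -/

/-- Lebesgue measure on the half line. -/
abbrev halfLine : Measure ℝ := volume.restrict (Ioi 0)

variable (H) in
/-- `ℋ_0 = L²(ℝ₊, H)`. -/
abbrev L2 : Type _ := Lp H 2 halfLine

/-- `g` is the `l`-th derivative of `f` on `(0, ∞)` in the sense of distributions. -/
def IsWeakDeriv (l : ℕ) (f g : L2 H) : Prop :=
  ∀ η : ℝ → ℝ, ContDiff ℝ ∞ η → HasCompactSupport η → tsupport η ⊆ Ioi 0 →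
    ∫ x in Ioi 0, iteratedDeriv l η x • f x = (-1 : ℝ) ^ l • ∫ x in Ioi 0, η x • g x

/-- The inclusion `L²(ℝ₊, H_s(A)) ⊆ L²(ℝ₊, H)`, `s ≥ 0`. -/
def inclL2 (A : H →ₗ.[ℂ] H) (s : ℝ) : L2 (Hs A s) →L[ℂ] L2 H :=
  (Hs.val A s).compLpL 2 halfLine

/-- The square of the norm of `(d/dx)^l f` in `L²(ℝ₊, H_j(A))`; it is `∞` if
`(d/dx)^l f` does not belong to `L²(ℝ₊, H_j(A))`. -/
def derivNormSq (A : H →ₗ.[ℂ] H) (l j : ℕ) (f : L2 H) : ℝ≥0∞ :=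
  ⨅ (g : L2 (Hs A (j : ℝ))) (_ : IsWeakDeriv l f (inclL2 A j g)), ‖g‖ₑ ^ 2

/-- The square of the norm of `f` in
`ℋ_n = ⋂_{k ≤ n} H_k(ℝ₊, H_{n-k}(A))`, where
`H_i(ℝ₊, H_j(A)) = {f ∈ ℋ_0 | (d/dx)^l f ∈ L²(ℝ₊, H_j(A)) for 0 ≤ l ≤ i}`;
it is `∞` if `f` does not belong to `ℋ_n`. -/
def intNormSq (A : H →ₗ.[ℂ] H) (n : ℕ) (f : L2 H) : ℝ≥0∞ :=
  ∑ k ∈ Finset.range (n + 1), ∑ l ∈ Finset.range (k + 1), derivNormSq A l (n - k) f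

/-- Interpolation of Hilbert spaces by the quadratic `K`-method. If `N₀`, `N₁` are the squares of
the norms of two Hilbert spaces `X₀`, `X₁` of elements of `E` (with the value `∞` off the space),
this is the square of a Hilbert norm of the interpolation space `[X₀, X₁]_θ`, `0 < θ < 1`:
`∫₀^∞ (t^(-θ) K(t, f))² dt/t` with `K(t, f)² = inf {‖f₀‖₀² + t² ‖f₁‖₁² | f = f₀ + f₁}`. -/
def interpNormSq {E : Type*} [AddCommGroup E] (N₀ N₁ : E → ℝ≥0∞) (θ : ℝ) (f : E) : ℝ≥0∞ :=
  ∫⁻ t in Ioi (0 : ℝ), ENNReal.ofReal (t ^ (-2 * θ - 1)) *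
    ⨅ f₁ : E, (N₀ (f - f₁) + ENNReal.ofReal (t ^ 2) * N₁ f₁)

/-- The square of the norm of `f` in `ℋ_s`, `s ≥ 0`: for integral `s` as above, otherwise by
interpolation between the neighbouring integers. It is `∞` if `f` does not belong to `ℋ_s`. -/
def scaleNormSq (A : H →ₗ.[ℂ] H) (s : ℝ) (f : L2 H) : ℝ≥0∞ :=
  open scoped Classical in
  if s = ⌊s⌋₊ then intNormSq A ⌊s⌋₊ f
  else interpNormSq (intNormSq A ⌊s⌋₊) (intNormSq A (⌊s⌋₊ + 1)) (s - ⌊s⌋₊) f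

/-! The finiteness of `scaleNormSq` defines a linear subspace. -/

theorem integrable_test_smul (l : ℕ) (f : L2 H) (η : ℝ → ℝ) (hη : ContDiff ℝ ∞ η)
    (hc : HasCompactSupport η) :
    Integrable (fun x => iteratedDeriv l η x • f x) halfLine := by
  have hcont : Continuous (iteratedDeriv l η) :=
    hη.continuous_iteratedDeriv l (by exact_mod_cast le_top)
  have hsupp : HasCompactSupport (iteratedDeriv l η) := by
    induction l with
    | zero => simpa using hc
    | succ k ih =>
      rw [iteratedDeriv_succ]
      exact (ih (hη.continuous_iteratedDeriv k (by exact_mod_cast le_top))).deriv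
  exact ((Lp.memLp f).locallyIntegrable one_le_two).integrable_smul_left_of_hasCompactSupport
    hcont hsupp

theorem IsWeakDeriv.add {l : ℕ} {f g f' g' : L2 H} (h : IsWeakDeriv l f g)
    (h' : IsWeakDeriv l f' g') : IsWeakDeriv l (f + f') (g + g') := by
  intro η h1 h2 h3
  have e : ∀ (m : ℕ) (a b : L2 H), ∫ x in Ioi 0, iteratedDeriv m η x • (a + b : L2 H) x =
      (∫ x in Ioi 0, iteratedDeriv m η x • a x) + ∫ x in Ioi 0, iteratedDeriv m η x • b x := by
    intro m a b
    rw [← integral_add (integrable_test_smul m a η h1 h2) (integrable_test_smul m b η h1 h2)]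
    refine integral_congr_ae ?_
    filter_upwards [Lp.coeFn_add a b] with x hx
    rw [hx, Pi.add_apply, smul_add]
  have e0 := e 0 g g'
  rw [iteratedDeriv_zero] at e0
  rw [e, e0, h η h1 h2 h3, h' η h1 h2 h3, smul_add]

theorem IsWeakDeriv.smul {l : ℕ} {f g : L2 H} (c : ℂ) (h : IsWeakDeriv l f g) :
    IsWeakDeriv l (c • f) (c • g) := by
  intro η h1 h2 h3
  have e : ∀ (m : ℕ) (a : L2 H), ∫ x in Ioi 0, iteratedDeriv m η x • (c • a : L2 H) x =
      c • ∫ x in Ioi 0, iteratedDeriv m η x • a x := by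
    intro m a
    rw [← integral_smul]
    refine integral_congr_ae ?_
    filter_upwards [Lp.coeFn_smul c a] with x hx
    rw [hx, Pi.smul_apply, smul_comm]
  have e0 := e 0 g
  rw [iteratedDeriv_zero] at e0
  rw [e, e0, h η h1 h2 h3, smul_comm]

/-- `N` behaves like the square of a norm, up to constants. -/
structure IsQuasiSq {E : Type*} [AddCommGroup E] [Module ℂ E] (N : E → ℝ≥0∞) : Prop where
  add_le : ∀ f g, N (f + g) ≤ 2 * (N f + N g)
  smul_le : ∀ (c : ℂ) f, c ≠ 0 → N (c • f) ≤ ‖c‖ₑ ^ 2 * N f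
  zero : N 0 = 0

theorem isQuasiSq_enorm {E : Type*} [NormedAddCommGroup E] [NormedSpace ℂ E] :
    IsQuasiSq (fun x : E => ‖x‖ₑ ^ 2) where
  add_le f g := by
    have h1 : ‖f + g‖ ^ 2 ≤ 2 * (‖f‖ ^ 2 + ‖g‖ ^ 2) := by
      nlinarith [norm_add_le f g, sq_nonneg (‖f‖ - ‖g‖), norm_nonneg (f + g)]
    have h2 : ‖f + g‖₊ ^ 2 ≤ 2 * (‖f‖₊ ^ 2 + ‖g‖₊ ^ 2) := by exact_mod_cast h1
    simp only [enorm_eq_nnnorm]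
    exact_mod_cast h2
  smul_le c f _ := by
    rw [enorm_smul, mul_pow]
  zero := by simp

theorem isQuasiSq_iInf {E V : Type*} [AddCommGroup E] [Module ℂ E] [NormedAddCommGroup V]
    [NormedSpace ℂ V] (P : E → V → Prop) (h0 : P 0 0)
    (hadd : ∀ f f' g g', P f g → P f' g' → P (f + f') (g + g'))
    (hsmul : ∀ (c : ℂ) f g, P f g → P (c • f) (c • g)) :
    IsQuasiSq fun f => ⨅ (g : V) (_ : P f g), ‖g‖ₑ ^ 2 where
  add_le f f' := by
    simp only [iInf_subtype']
    rw [mul_add, ENNReal.mul_iInf_of_ne (by simp) (by simp),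
      ENNReal.mul_iInf_of_ne (by simp) (by simp)]
    refine ENNReal.le_iInf_add_iInf fun g g' => ?_
    rw [← mul_add]
    exact (iInf_le _ ⟨g.1 + g'.1, hadd _ _ _ _ g.2 g'.2⟩).trans
      (isQuasiSq_enorm.add_le g.1 g'.1)
  smul_le c f hc := by
    simp only [iInf_subtype']
    rw [ENNReal.mul_iInf_of_ne (by simpa using hc) (by simp)]
    refine le_iInf fun g => ?_
    exact (iInf_le _ ⟨c • g.1, hsmul c _ _ g.2⟩).trans (isQuasiSq_enorm.smul_le c g.1 hc)
  zero := le_antisymm (iInf₂_le_of_le 0 h0 (by simp)) bot_le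

theorem IsWeakDeriv.zero (l : ℕ) : IsWeakDeriv l (0 : L2 H) 0 := by
  intro η _ _ _
  have e : ∀ ξ : ℝ → ℝ, ∫ x in Ioi 0, ξ x • (0 : L2 H) x = 0 := by
    intro ξ
    rw [← integral_zero ℝ H (μ := halfLine)]
    refine integral_congr_ae ?_
    filter_upwards [Lp.coeFn_zero H 2 halfLine] with x hx
    rw [hx, Pi.zero_apply, smul_zero]
  rw [e, e, smul_zero]

theorem isQuasiSq_deriv (A : H →ₗ.[ℂ] H) (l j : ℕ) : IsQuasiSq (derivNormSq A l j) :=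
  isQuasiSq_iInf (fun f g => IsWeakDeriv l f (inclL2 A j g))
    (by rw [map_zero]; exact IsWeakDeriv.zero l)
    (fun _ _ _ _ h h' => by rw [map_add]; exact h.add h')
    (fun c _ _ h => by rw [map_smul]; exact h.smul c)

theorem isQuasiSq_int (A : H →ₗ.[ℂ] H) (n : ℕ) : IsQuasiSq (intNormSq A n) where
  add_le f g := by
    unfold intNormSq
    rw [← Finset.sum_add_distrib, Finset.mul_sum]
    refine Finset.sum_le_sum fun k _ => ?_
    rw [← Finset.sum_add_distrib, Finset.mul_sum]
    exact Finset.sum_le_sum fun l _ => (isQuasiSq_deriv A l (n - k)).add_le f g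
  smul_le c f hc := by
    unfold intNormSq
    rw [Finset.mul_sum]
    refine Finset.sum_le_sum fun k _ => ?_
    rw [Finset.mul_sum]
    exact Finset.sum_le_sum fun l _ => (isQuasiSq_deriv A l (n - k)).smul_le c f hc
  zero := Finset.sum_eq_zero fun k _ => Finset.sum_eq_zero fun l _ =>
    (isQuasiSq_deriv A l (n - k)).zero

theorem isQuasiSq_interp {E : Type*} [AddCommGroup E] [Module ℂ E] {N₀ N₁ : E → ℝ≥0∞}
    (h₀ : IsQuasiSq N₀) (h₁ : IsQuasiSq N₁) (θ : ℝ) : IsQuasiSq (interpNormSq N₀ N₁ θ) where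
  add_le f g := by
    have hm : ∀ f : E, AEMeasurable (fun t : ℝ => ENNReal.ofReal (t ^ (-2 * θ - 1)) *
        ⨅ f₁ : E, (N₀ (f - f₁) + ENNReal.ofReal (t ^ 2) * N₁ f₁))
        (volume.restrict (Ioi (0 : ℝ))) := by
      intro f
      refine AEMeasurable.mul (by fun_prop) ?_
      refine aemeasurable_restrict_of_monotoneOn measurableSet_Ioi ?_
      intro a ha b _ hab
      have ha' : (0 : ℝ) ≤ a := le_of_lt ha
      refine iInf_mono fun f₁ => ?_
      gcongr
    unfold interpNormSq
    rw [← lintegral_add_left' (hm f), ← lintegral_const_mul' _ _ (by simp)]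
    refine lintegral_mono fun t => ?_
    simp only
    rw [← mul_add, mul_left_comm]
    gcongr
    rw [mul_add, ENNReal.mul_iInf_of_ne (by simp) (by simp),
      ENNReal.mul_iInf_of_ne (by simp) (by simp)]
    refine ENNReal.le_iInf_add_iInf fun f₁ g₁ => ?_
    refine (iInf_le _ (f₁ + g₁)).trans ?_
    rw [add_sub_add_comm]
    refine (add_le_add (h₀.add_le _ _) (mul_le_mul_right (h₁.add_le f₁ g₁) _)).trans
      (le_of_eq ?_)
    ring
  smul_le c f hc := by
    unfold interpNormSq
    rw [← lintegral_const_mul' _ _ (by simp)]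
    refine lintegral_mono fun t => ?_
    simp only
    rw [mul_left_comm]
    gcongr
    rw [ENNReal.mul_iInf_of_ne (by simpa using hc) (by simp)]
    refine le_iInf fun f₁ => (iInf_le _ (c • f₁)).trans ?_
    rw [← smul_sub]
    refine (add_le_add (h₀.smul_le c _ hc) (mul_le_mul_right (h₁.smul_le c f₁ hc) _)).trans
      (le_of_eq ?_)
    ring
  zero := by
    unfold interpNormSq
    have h : ∀ t : ℝ, ⨅ f₁ : E, (N₀ (0 - f₁) + ENNReal.ofReal (t ^ 2) * N₁ f₁) = 0 := fun t =>
      le_antisymm ((iInf_le _ 0).trans (by simp [h₀.zero, h₁.zero])) bot_le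
    simp only [h, mul_zero, lintegral_zero]

theorem isQuasiSq_scale (A : H →ₗ.[ℂ] H) (s : ℝ) : IsQuasiSq (scaleNormSq A s) := by
  unfold scaleNormSq
  split_ifs
  · exact isQuasiSq_int A _
  · exact isQuasiSq_interp (isQuasiSq_int A _) (isQuasiSq_int A _) _

/-- The space `ℋ_s(ℝ₊, A)`, `s ≥ 0`, normed by the square root of `scaleNormSq A s`. -/
def scaleSpace (A : H →ₗ.[ℂ] H) (s : ℝ) : Submodule ℂ (L2 H) where
  carrier := {f | scaleNormSq A s f < ⊤}
  zero_mem' := (isQuasiSq_scale A s).zero.trans_lt ENNReal.zero_lt_top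
  add_mem' := fun {f g} hf hg =>
    lt_of_le_of_lt ((isQuasiSq_scale A s).add_le f g)
      (ENNReal.mul_lt_top (by simp) (ENNReal.add_lt_top.2 ⟨hf, hg⟩))
  smul_mem' := fun c f hf => by
    rcases eq_or_ne c 0 with rfl | hc
    · rw [zero_smul]
      exact (isQuasiSq_scale A s).zero.trans_lt ENNReal.zero_lt_top
    · exact lt_of_le_of_lt ((isQuasiSq_scale A s).smul_le c f hc) (ENNReal.mul_lt_top (by simp) hf)

/-! ### The model operator -/

theorem differentiable_val_comp (A : H →ₗ.[ℂ] H) {φ : ℝ → GraphSpace A} (h : ContDiff ℝ ∞ φ) :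
    Differentiable ℝ fun y => GraphSpace.val A (φ y) :=
  ((GraphSpace.val A).restrictScalars ℝ).differentiable.comp (h.differentiable (by simp))

/-- The graph of `γ (d/dx + A)` with domain `C₀^∞((0, ∞), H_1)`, where `H_1` is the domain of `A`
with the graph norm. -/
def minGraph (γ : H →L[ℂ] H) (A : H →ₗ.[ℂ] H) : Submodule ℂ (L2 H × L2 H) where
  carrier := {p | ∃ φ : ℝ → GraphSpace A, ContDiff ℝ ∞ φ ∧ HasCompactSupport φ ∧
    tsupport φ ⊆ Ioi 0 ∧ p.1 =ᵐ[halfLine] (fun x => GraphSpace.val A (φ x)) ∧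
    p.2 =ᵐ[halfLine] fun x =>
      γ (deriv (fun y => GraphSpace.val A (φ y)) x + GraphSpace.app A (φ x))}
  zero_mem' := by
    refine ⟨0, contDiff_const, HasCompactSupport.zero, by simp [tsupport], ?_, ?_⟩
    · filter_upwards [Lp.coeFn_zero H 2 halfLine] with x hx
      simpa using hx
    · filter_upwards [Lp.coeFn_zero H 2 halfLine] with x hx
      simpa using hx
  add_mem' := by
    rintro ⟨u, w⟩ ⟨u', w'⟩ ⟨φ, h1, h2, h3, h4, h5⟩ ⟨φ', h1', h2', h3', h4', h5'⟩
    refine ⟨φ + φ', h1.add h1', h2.add h2',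
      (tsupport_add φ φ').trans (union_subset h3 h3'), ?_, ?_⟩
    · filter_upwards [h4, h4', Lp.coeFn_add u u'] with x hx hx' hs
      exact hs.trans (by simp_all)
    · filter_upwards [h5, h5', Lp.coeFn_add w w'] with x hx hx' hs
      have e := deriv_fun_add (differentiable_val_comp A h1 x) (differentiable_val_comp A h1' x)
      refine hs.trans ?_
      simp only [Pi.add_apply, map_add] at e ⊢
      rw [e, hx, hx']
      simp only [map_add]
      abel
  smul_mem' := by
    rintro c ⟨u, w⟩ ⟨φ, h1, h2, h3, h4, h5⟩
    refine ⟨c • φ, h1.const_smul c, h2.smul_left (f := fun _ => c),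
      (tsupport_smul_subset_right (fun _ => c) φ).trans h3, ?_, ?_⟩
    · filter_upwards [h4, Lp.coeFn_smul c u] with x hx hs
      exact hs.trans (by simp_all)
    · filter_upwards [h5, Lp.coeFn_smul c w] with x hx hs
      have e := deriv_fun_const_smul c (differentiable_val_comp A h1 x)
      refine hs.trans ?_
      simp only [Pi.smul_apply, map_smul] at e ⊢
      rw [e, hx, ← map_smul, smul_add]

/-- The operator `D = γ (d/dx + A)` in `L²(ℝ₊, H)` with domain `C₀^∞((0, ∞), H_1)`. -/
def Dmin (γ : H →L[ℂ] H) (A : H →ₗ.[ℂ] H) : L2 H →ₗ.[ℂ] L2 H :=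
  (minGraph γ A).toLinearPMap

/-- `D_max`, the adjoint of `γ (d/dx + A)` on `C₀^∞((0, ∞), H_1)`. -/
def Dmax (γ : H →L[ℂ] H) (A : H →ₗ.[ℂ] H) : L2 H →ₗ.[ℂ] L2 H :=
  (Dmin γ A).adjoint

/-- The structure relations `γ* = -γ`, `γ² = -1`, `γ(𝒟(A)) = 𝒟(A)`, `γ A + A γ = 0`. -/
structure IsCompatible (γ : H →L[ℂ] H) (A : H →ₗ.[ℂ] H) : Prop where
  adjoint_eq : ContinuousLinearMap.adjoint γ = -γ
  sq_eq : γ ∘L γ = -ContinuousLinearMap.id ℂ H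
  map_domain : A.domain.map γ.toLinearMap = A.domain
  anticomm : ∀ (x : A.domain) (h : γ x ∈ A.domain), γ (A x) + A ⟨γ x, h⟩ = 0

end Scale

end TraceThm

end

/-!
Everything is expressed through the bounded operator `R = (1 + A²)⁻¹`, `0 ≤ R ≤ 1`, and its
continuous functional calculus. The space `H_s` is the image of `R^(s/2)` (`hsEquiv`), so a function
in `C₀^∞(ℝ₊, H_∞)` is of the form `R^(s/2) ψ`, with `ψ` smooth and `H`-valued, for every `s`
(`IsSmoothCompact.exists_lift`), and the norms of `ℋ_n` are `L²` norms of derivatives of such lifts.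

Density in `ℋ_s`: a function is approximated by `approx`, a mollification in `ℝ₊` whose kernel lives
on the negative axis (so that it commutes with weak derivatives up to the boundary), combined with a
spectral cut-off of `A`. These operators are bounded on all `ℋ_n`, hence they converge in the
interpolation spaces as well (`tendsto_interpNormSq`). A cut-off at infinity, applied after
the smoothing, converges in every `ℋ_n` (`exists_smooth_near_int`, `exists_smooth_near`).

Trace on `ℋ_s`: by density it suffices to bound `φ 0` in `H_(s - 1/2)` for smooth `φ`
(`existsUnique_extension`). For integral `s` this is an integration by parts,
`‖R^(1/4) χ(0)‖² = -2 Re ∫ ⟪R^(1/2) χ, χ'⟫` (`IsResolvent.norm_boundary_sq`). For non-integral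
`s = n + θ` every decomposition of `φ` admitted in the `K`-functional at scale `τ` yields a
decomposition of the trace at the two neighbouring integral orders. These are put together by a
square function estimate over the dyadic scales `τ = a 2^i` (`IsResolvent.norm_sq_le_of_dyadic`),
and the dyadic sum of the `K`-functional is dominated by the interpolation norm
(`sum_le_interpNormSq`). For `1/2 < s < 1` the lower space `ℋ_0 = L²` has no trace; there the
value at `0` is replaced by the mean value over `(0, τ)`, which converges to it as `τ → 0`
(`enorm_trace_sq_le_zero`).

The operator `D_max`: since `γ` anticommutes with `A`, it commutes with `R`, and `D_max` commutes
with the spectral cut-offs (`specCut_mem_Dmax_graph`). A cut-off of an element of the domain lies in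
`ℋ_1`, because there `A` is bounded and the equation determines the derivative
(`isWeakDeriv_specCut`). Density thus follows from density in `ℋ_1`, on which `D_max` is
bounded (`exists_closureValue`). For the trace, the derivative in the boundary term
`-2 Re ∫ ⟪R^(1/2) φ, φ'⟫ = ‖R^(1/4) φ(0)‖²` is replaced by `-γ D_max φ - A φ`; as `R^(1/2) A` is
bounded, the right-hand side is bounded by the graph norm (`norm_trace_sq_le_Dmax`), and
the left-hand side is equivalent to the square of the norm of `φ(0)` in `H_(-1/2)`.
-/

noncomputable section

set_option linter.unusedSectionVars false

namespace TraceThm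

/-! ### Functional calculus of the resolvent -/

section Calculus

variable {H : Type*} [NormedAddCommGroup H] [InnerProductSpace ℂ H] [CompleteSpace H]

/-- The properties of `(1 + A²)⁻¹`, `A` self-adjoint, on which the functional calculus is built. -/
structure IsResolvent (R : H →L[ℂ] H) : Prop where
  nonneg : 0 ≤ R
  le_one : R ≤ 1
  inj : ∀ x, R x = 0 → x = 0

namespace IsResolvent

variable {R : H →L[ℂ] H} (hR : IsResolvent R)
include hR

theorem isSelfAdjoint : IsSelfAdjoint R := hR.nonneg.isSelfAdjoint

theorem spectrum_subset : spectrum ℝ R ⊆ Icc 0 1 := by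
  intro t ht
  refine ⟨spectrum_nonneg_of_nonneg hR.nonneg ht, ?_⟩
  have := (le_algebraMap_iff_spectrum_le (R := ℝ) (r := 1) (a := R) hR.isSelfAdjoint).1
    (by simpa using hR.le_one)
  exact this t ht

end IsResolvent

theorem cfc_inner_comm (R : H →L[ℂ] H) (g : ℝ → ℝ) (x y : H) :
    ⟪cfc g R x, y⟫_ℂ = ⟪x, cfc g R y⟫_ℂ := by
  have h : IsSelfAdjoint (cfc g R) := cfc_predicate g R
  rw [← ContinuousLinearMap.adjoint_inner_right, ← ContinuousLinearMap.star_eq_adjoint, h.star_eq]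

namespace IsResolvent

variable {R : H →L[ℂ] H} (hR : IsResolvent R)
include hR

theorem cfc_mul_apply {f g : ℝ → ℝ} (hf : ContinuousOn f (Icc 0 1)) (hg : ContinuousOn g (Icc 0 1))
    (x : H) : cfc (fun t => f t * g t) R x = cfc f R (cfc g R x) := by
  rw [cfc_mul f g R (hf.mono hR.spectrum_subset) (hg.mono hR.spectrum_subset)]
  rfl

theorem cfc_congr' {f g : ℝ → ℝ} (h : ∀ t ∈ Icc (0 : ℝ) 1, f t = g t) : cfc f R = cfc g R :=
  cfc_congr fun t ht => h t (hR.spectrum_subset ht)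

theorem inner_cfc_mono {f g : ℝ → ℝ} (hf : ContinuousOn f (Icc 0 1))
    (hg : ContinuousOn g (Icc 0 1)) (h : ∀ t ∈ Icc (0 : ℝ) 1, f t ≤ g t) (x : H) :
    (⟪x, cfc f R x⟫_ℂ).re ≤ (⟪x, cfc g R x⟫_ℂ).re := by
  have h1 : cfc f R ≤ cfc g R := cfc_mono (fun t ht => h t (hR.spectrum_subset ht))
    (hf.mono hR.spectrum_subset) (hg.mono hR.spectrum_subset)
  have h2 := ((ContinuousLinearMap.le_def _ _).1 h1).re_inner_nonneg_right x
  simpa [inner_sub_right] using h2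

theorem norm_cfc_sq {f : ℝ → ℝ} (hf : ContinuousOn f (Icc 0 1)) (x : H) :
    ‖cfc f R x‖ ^ 2 = (⟪x, cfc (fun t => f t ^ 2) R x⟫_ℂ).re := by
  simp only [pow_two (f _)]
  rw [hR.cfc_mul_apply hf hf, ← cfc_inner_comm, inner_self_eq_norm_sq_to_K]
  norm_cast

/-- Pointwise domination of symbols gives domination of the operators. -/
theorem norm_cfc_le_norm_cfc {f g : ℝ → ℝ} (hf : ContinuousOn f (Icc 0 1))
    (hg : ContinuousOn g (Icc 0 1)) (h : ∀ t ∈ Icc (0 : ℝ) 1, |f t| ≤ |g t|) (x : H) :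
    ‖cfc f R x‖ ≤ ‖cfc g R x‖ := by
  rw [← sq_le_sq₀ (norm_nonneg _) (norm_nonneg _), hR.norm_cfc_sq hf, hR.norm_cfc_sq hg]
  exact hR.inner_cfc_mono (hf.pow 2) (hg.pow 2) (fun t ht => sq_le_sq.2 (h t ht)) x

theorem cfc_const_apply (c : ℝ) (x : H) : cfc (fun _ : ℝ => c) R x = (c : ℂ) • x := by
  rw [cfc_const c R hR.isSelfAdjoint]
  simp [Algebra.algebraMap_eq_smul_one]

theorem norm_cfc_le {f : ℝ → ℝ} (hf : ContinuousOn f (Icc 0 1)) {c : ℝ}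
    (h : ∀ t ∈ Icc (0 : ℝ) 1, |f t| ≤ c) (x : H) : ‖cfc f R x‖ ≤ c * ‖x‖ := by
  have hc : 0 ≤ c := (abs_nonneg _).trans (h 0 (by simp))
  refine (hR.norm_cfc_le_norm_cfc hf (continuousOn_const (c := c)) (fun t ht => ?_) x).trans ?_
  · rw [abs_of_nonneg hc]; exact h t ht
  · rw [hR.cfc_const_apply, norm_smul]
    simp [abs_of_nonneg hc]

end IsResolvent

/-- The power `R^(s/2)`; it maps `H` isomorphically onto the space `H_s`. -/
def halfPow (R : H →L[ℂ] H) (s : ℝ) : H →L[ℂ] H := cfc (fun t : ℝ => t ^ (s / 2)) R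

theorem continuousOn_rpow_half {s : ℝ} (hs : 0 ≤ s) :
    ContinuousOn (fun t : ℝ => t ^ (s / 2)) (Icc 0 1) :=
  (Real.continuous_rpow_const (by positivity)).continuousOn

theorem halfPow_inner_comm (R : H →L[ℂ] H) (s : ℝ) (x y : H) :
    ⟪halfPow R s x, y⟫_ℂ = ⟪x, halfPow R s y⟫_ℂ := cfc_inner_comm R _ x y

namespace IsResolvent

variable {R : H →L[ℂ] H} (hR : IsResolvent R)
include hR

theorem halfPow_cfc {s : ℝ} (hs : 0 ≤ s) {g : ℝ → ℝ} (hg : ContinuousOn g (Icc 0 1)) (x : H) :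
    halfPow R s (cfc g R x) = cfc (fun t => t ^ (s / 2) * g t) R x :=
  (hR.cfc_mul_apply (continuousOn_rpow_half hs) hg x).symm

theorem cfc_halfPow {s : ℝ} (hs : 0 ≤ s) {g : ℝ → ℝ} (hg : ContinuousOn g (Icc 0 1)) (x : H) :
    cfc g R (halfPow R s x) = cfc (fun t => g t * t ^ (s / 2)) R x :=
  (hR.cfc_mul_apply hg (continuousOn_rpow_half hs) x).symm

theorem halfPow_add {a b : ℝ} (ha : 0 ≤ a) (hb : 0 ≤ b) (x : H) :
    halfPow R (a + b) x = halfPow R a (halfPow R b x) := by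
  rw [halfPow, halfPow, halfPow, ← hR.cfc_mul_apply (continuousOn_rpow_half ha)
    (continuousOn_rpow_half hb)]
  congr 1
  refine hR.cfc_congr' fun t ht => ?_
  rw [add_div, Real.rpow_add_of_nonneg ht.1 (by positivity) (by positivity)]

theorem halfPow_zero : halfPow R 0 = 1 := by
  simp only [halfPow, zero_div, Real.rpow_zero]
  exact cfc_const_one ℝ R hR.isSelfAdjoint

theorem halfPow_two : halfPow R 2 = R := by
  simp only [halfPow, div_self (two_ne_zero' ℝ), Real.rpow_one]
  exact cfc_id' ℝ R hR.isSelfAdjoint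

theorem norm_halfPow_le {s : ℝ} (hs : 0 ≤ s) (x : H) : ‖halfPow R s x‖ ≤ ‖x‖ := by
  refine (hR.norm_cfc_le (continuousOn_rpow_half hs) (c := 1) (fun t ht => ?_) x).trans
    (one_mul _).le
  · rw [abs_of_nonneg (Real.rpow_nonneg ht.1 _)]
    exact Real.rpow_le_one ht.1 ht.2 (by positivity)

theorem halfPow_injective {s : ℝ} (hs : 0 ≤ s) : Function.Injective (halfPow R s) := by
  -- a power `R ^ n` with `2 n ≥ s` is injective, and it factors through `R ^ (s / 2)`
  have h1 : ∀ n : ℕ, ∀ x, halfPow R (2 * n) x = 0 → x = 0 := by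
    intro n
    induction n with
    | zero => intro x hx; simpa [hR.halfPow_zero] using hx
    | succ n ih =>
      intro x hx
      refine ih x (hR.inj _ ?_)
      have e : (2 * (n + 1 : ℕ) : ℝ) = 2 + 2 * n := by push_cast; ring
      rwa [e, hR.halfPow_add (by norm_num) (by positivity), hR.halfPow_two] at hx
  rw [injective_iff_map_eq_zero]
  intro x hx
  obtain ⟨n, hn⟩ := exists_nat_ge s
  refine h1 n x ?_
  have : (2 * n : ℝ) = (2 * n - s) + s := by ring
  rw [this, hR.halfPow_add (by linarith [n.cast_nonneg (α := ℝ)]) hs, hx, map_zero]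

end IsResolvent

/-! ### Spectral cut-offs -/

/-- The symbol of the spectral cut-off: a continuous function that vanishes on `[0, 1/(k+1)]` and
equals `1` on `[2/(k+1), 1]`. -/
def cut (k : ℕ) (t : ℝ) : ℝ := max 0 (min 1 ((k + 1) * t - 1))

/-- The symbol `cut k t * t ^ (-s/2)`, written in a form that is continuous at `0`. -/
def cutDiv (k : ℕ) (s t : ℝ) : ℝ := cut k t * (max t (1 / (k + 1))) ^ (-(s / 2))

theorem continuous_cut (k : ℕ) : Continuous (cut k) := by unfold cut; fun_prop

theorem continuous_cutDiv (k : ℕ) (s : ℝ) : Continuous (cutDiv k s) := by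
  unfold cutDiv
  refine (continuous_cut k).mul ?_
  refine Continuous.rpow_const (by fun_prop) fun t => Or.inl ?_
  exact (lt_of_lt_of_le (by positivity) (le_max_right t _)).ne'

theorem cut_nonneg (k : ℕ) (t : ℝ) : 0 ≤ cut k t := le_max_left _ _

theorem cut_le_one (k : ℕ) (t : ℝ) : cut k t ≤ 1 := max_le zero_le_one (min_le_left _ _)

theorem rpow_mul_cutDiv (k : ℕ) (s : ℝ) (t : ℝ) :
    t ^ (s / 2) * cutDiv k s t = cut k t := by
  unfold cutDiv
  rcases le_or_gt t (1 / (k + 1)) with h | h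
  · have h0 : cut k t = 0 := by
      refine max_eq_left ((min_le_right _ _).trans ?_)
      rw [le_div_iff₀ (by positivity)] at h
      linarith
    simp [h0]
  · have ht' : 0 < t := lt_trans (by positivity) h
    rw [max_eq_left h.le, mul_left_comm, ← Real.rpow_add ht']
    simp

theorem one_sub_cut_mul_le (k : ℕ) {t : ℝ} (ht : 0 ≤ t) : |t * (1 - cut k t)| ≤ 2 / (k + 1) := by
  rw [abs_of_nonneg (mul_nonneg ht (sub_nonneg.2 (cut_le_one k t)))]
  rcases le_or_gt t (2 / (k + 1)) with h | h
  · nlinarith [cut_nonneg k t]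
  · have h0 : cut k t = 1 := by
      rw [div_lt_iff₀ (by positivity)] at h
      rw [cut, min_eq_left (by linarith), max_eq_right zero_le_one]
    rw [h0]
    simp
    positivity

/-- The spectral cut-off `cut k R`. It maps `H` into every `H_s`. -/
def specCut (R : H →L[ℂ] H) (k : ℕ) : H →L[ℂ] H := cfc (cut k) R

/-- The bounded operator `cut k R * R ^ (-s/2)`. -/
def specCutDiv (R : H →L[ℂ] H) (k : ℕ) (s : ℝ) : H →L[ℂ] H := cfc (cutDiv k s) R

namespace IsResolvent

variable {R : H →L[ℂ] H} (hR : IsResolvent R)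
include hR

theorem norm_specCut_le (k : ℕ) (x : H) : ‖specCut R k x‖ ≤ ‖x‖ :=
  (hR.norm_cfc_le (continuous_cut k).continuousOn (c := 1) (fun t _ => by
    rw [abs_of_nonneg (cut_nonneg k t)]; exact cut_le_one k t) x).trans (one_mul _).le

theorem halfPow_specCutDiv (k : ℕ) {s : ℝ} (hs : 0 ≤ s) (x : H) :
    halfPow R s (specCutDiv R k s x) = specCut R k x := by
  rw [specCutDiv, hR.halfPow_cfc hs (continuous_cutDiv k s).continuousOn, specCut]
  congr 1
  exact hR.cfc_congr' fun t _ => rpow_mul_cutDiv k s t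

theorem specCut_halfPow (k : ℕ) {s : ℝ} (hs : 0 ≤ s) (x : H) :
    specCut R k (halfPow R s x) = halfPow R s (specCut R k x) := by
  rw [specCut, hR.halfPow_cfc hs (continuous_cut k).continuousOn,
    hR.cfc_halfPow hs (continuous_cut k).continuousOn]
  simp only [mul_comm]

theorem denseRange : DenseRange R := by
  have h : (LinearMap.range R.toLinearMap)ᗮ = ⊥ := by
    rw [Submodule.eq_bot_iff]
    intro x hx
    refine hR.inj x ?_
    rw [Submodule.mem_orthogonal'] at hx
    have := hx (R (R x)) ⟨R x, rfl⟩
    have h2 := halfPow_inner_comm R 2 x (R x)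
    rw [hR.halfPow_two] at h2
    rwa [← h2, inner_self_eq_zero] at this
  have := (Submodule.topologicalClosure_eq_top_iff (K := LinearMap.range R.toLinearMap)).2 h
  rw [DenseRange, ← Submodule.dense_iff_topologicalClosure_eq_top] at *
  exact this

theorem tendsto_specCut (x : H) :
    Filter.Tendsto (fun k => specCut R k x) Filter.atTop (nhds x) := by
  have hS : ∀ k y, ‖specCut R k (R y) - R y‖ ≤ 2 / (k + 1) * ‖y‖ := by
    intro k y
    have e : R y - specCut R k (R y) = cfc (fun t => t * (1 - cut k t)) R y := by
      have h1 : cfc (fun t => t * cut k t) R y = specCut R k (R y) := by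
        have := hR.specCut_halfPow k (s := 2) (by norm_num) y
        rw [hR.halfPow_two] at this
        rw [this, hR.cfc_mul_apply (f := fun t => t) continuousOn_id
          (continuous_cut k).continuousOn, cfc_id' ℝ R hR.isSelfAdjoint]
        rfl
      have h2 : cfc (fun t : ℝ => t) R = R := cfc_id' ℝ R hR.isSelfAdjoint
      simp only [mul_sub, mul_one]
      rw [cfc_sub (fun t : ℝ => t) (fun t => t * cut k t) R continuousOn_id
        (continuous_id.mul (continuous_cut k)).continuousOn, h2, ← h1]
      rfl
    rw [norm_sub_rev, e]
    exact hR.norm_cfc_le (continuous_id.mul (continuous_const.sub (continuous_cut k))).continuousOn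
      (fun t ht => one_sub_cut_mul_le k ht.1) y
  rw [Metric.tendsto_atTop]
  intro ε hε
  obtain ⟨y, hy⟩ := hR.denseRange.exists_dist_lt x (show 0 < ε / 3 by positivity)
  obtain ⟨n, hn⟩ := exists_nat_gt (2 * ‖y‖ / (ε / 3))
  refine ⟨n, fun k hk => ?_⟩
  have h1 : ‖specCut R k (R y) - R y‖ < ε / 3 := by
    refine (hS k y).trans_lt ?_
    rw [div_mul_eq_mul_div, div_lt_comm₀ (by positivity) (by positivity)]
    refine hn.trans ?_
    have : (n : ℝ) ≤ k := by exact_mod_cast hk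
    linarith
  have h2 : ‖specCut R k (x - R y)‖ < ε / 3 :=
    (hR.norm_specCut_le k _).trans_lt (by rwa [← dist_eq_norm])
  rw [dist_eq_norm] at hy ⊢
  have e : specCut R k x - x =
      specCut R k (x - R y) + (specCut R k (R y) - R y) - (x - R y) := by
    rw [map_sub]; abel
  rw [e]
  refine (norm_sub_le _ _).trans_lt ?_
  linarith [norm_add_le (specCut R k (x - R y)) (specCut R k (R y) - R y)]

end IsResolvent

/-! ### The spaces `H_s` in terms of the resolvent -/

theorem inner_apply_comm {A : H →ₗ.[ℂ] H} (hA : IsSelfAdjoint A) (x y : A.domain) :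
    ⟪A x, (y : H)⟫_ℂ = ⟪(x : H), A y⟫_ℂ := by
  have h := LinearPMap.adjoint_isFormalAdjoint hA.dense_domain
  rw [LinearPMap.isSelfAdjoint_def.1 hA] at h
  exact h x y

/-- With `v = A R x` and `w = A v`, so that `R x + w = x`, symmetry of `A` gives
`⟪R x, x⟫ = ‖R x‖² + ‖v‖²` and `⟪x - R x, x⟫ = ‖v‖² + ‖w‖²`. -/
theorem isResolvent_invOneAddSq {A : H →ₗ.[ℂ] H} (hA : IsSelfAdjoint A) :
    IsResolvent (invOneAddSq A) := by
  have key : ∀ x, ∃ v w : H, invOneAddSq A x + w = x ∧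
      ⟪invOneAddSq A x, w⟫_ℂ = ⟪v, v⟫_ℂ := by
    intro x
    obtain ⟨h1, h2, h3⟩ := invOneAddSq_spec A hA x
    exact ⟨_, _, h3, (inner_apply_comm hA ⟨_, h1⟩ ⟨_, h2⟩).symm⟩
  have hpos : (invOneAddSq A).IsPositive := by
    rw [ContinuousLinearMap.isPositive_iff_complex]
    intro x
    obtain ⟨v, w, h1, h2⟩ := key x
    have e : ⟪invOneAddSq A x, x⟫_ℂ =
        ((‖invOneAddSq A x‖ ^ 2 + ‖v‖ ^ 2 : ℝ) : ℂ) := by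
      nth_rw 2 [← h1]
      rw [inner_add_right, h2, inner_self_eq_norm_sq_to_K, inner_self_eq_norm_sq_to_K]
      push_cast
      rfl
    rw [e]
    refine ⟨?_, ?_⟩
    · norm_cast
    · rw [RCLike.re_eq_complex_re, Complex.ofReal_re]
      positivity
  refine ⟨(ContinuousLinearMap.nonneg_iff_isPositive _).2 hpos, ?_, ?_⟩
  · rw [ContinuousLinearMap.le_def, ContinuousLinearMap.isPositive_iff_complex]
    intro x
    obtain ⟨v, w, h1, h2⟩ := key x
    have e : ⟪(1 - invOneAddSq A : H →L[ℂ] H) x, x⟫_ℂ = ((‖v‖ ^ 2 + ‖w‖ ^ 2 : ℝ) : ℂ) := by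
      have e1 : (1 - invOneAddSq A : H →L[ℂ] H) x = w := by
        exact sub_eq_of_eq_add' h1.symm
      have h2' : ⟪w, invOneAddSq A x⟫_ℂ = ⟪v, v⟫_ℂ := by
        rw [← inner_conj_symm, h2, inner_conj_symm]
      rw [e1]
      nth_rw 1 [← h1]
      rw [inner_add_right, h2', inner_self_eq_norm_sq_to_K, inner_self_eq_norm_sq_to_K]
      push_cast
      rfl
    rw [e]
    refine ⟨?_, ?_⟩
    · norm_cast
    · rw [RCLike.re_eq_complex_re, Complex.ofReal_re]
      positivity
  · intro x hx
    obtain ⟨v, w, h1, h2⟩ := key x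
    rw [hx, inner_zero_left, eq_comm, inner_self_eq_zero] at h2
    obtain ⟨d1, d2, d3⟩ := invOneAddSq_spec A hA x
    have e0 : (⟨invOneAddSq A x, d1⟩ : A.domain) = 0 := Subtype.ext hx
    have e1 : A ⟨invOneAddSq A x, d1⟩ = 0 := by rw [e0]; exact A.map_zero
    have e2 : (⟨A ⟨invOneAddSq A x, d1⟩, d2⟩ : A.domain) = 0 := Subtype.ext e1
    rw [e2, LinearPMap.map_zero, hx, add_zero] at d3
    exact d3.symm

/-- The complementary power `(1 - R)^(s/2)`. -/
def coPow (R : H →L[ℂ] H) (s : ℝ) : H →L[ℂ] H := cfc (fun t : ℝ => (1 - t) ^ (s / 2)) R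

theorem continuousOn_coPow {s : ℝ} (hs : 0 ≤ s) :
    ContinuousOn (fun t : ℝ => (1 - t) ^ (s / 2)) (Icc 0 1) :=
  ((continuous_const.sub continuous_id).rpow_const fun _ => Or.inr (by positivity)).continuousOn

/-- One of `t` and `1 - t` is at least `1/2`; hence the graph norm bounds the parameter `y`. -/
theorem half_rpow_le {s t : ℝ} (hs : 0 ≤ s) (ht : t ∈ Icc (0 : ℝ) 1) :
    (1 / 2 : ℝ) ^ s ≤ (t ^ (s / 2)) ^ 2 + ((1 - t) ^ (s / 2)) ^ 2 := by
  have e : ∀ u : ℝ, 0 ≤ u → (u ^ (s / 2)) ^ 2 = u ^ s := by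
    intro u hu
    rw [← Real.rpow_natCast, ← Real.rpow_mul hu]
    congr 1
    push_cast
    ring
  have h1 : 0 ≤ 1 - t := by linarith [ht.2]
  rw [e t ht.1, e _ h1]
  rcases le_total (1 / 2) t with h | h
  · linarith [Real.rpow_le_rpow (by norm_num) h hs, Real.rpow_nonneg h1 s]
  · linarith [Real.rpow_le_rpow (by norm_num) (show 1 / 2 ≤ 1 - t by linarith) hs,
      Real.rpow_nonneg ht.1 s]

theorem IsResolvent.norm_sq_le {R : H →L[ℂ] H} (hR : IsResolvent R) {s : ℝ} (hs : 0 ≤ s) (y : H) :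
    (1 / 2 : ℝ) ^ s * ‖y‖ ^ 2 ≤ ‖halfPow R s y‖ ^ 2 + ‖coPow R s y‖ ^ 2 := by
  have hf := continuousOn_rpow_half hs
  have hg := continuousOn_coPow hs
  have hf2 : ContinuousOn (fun t : ℝ => (t ^ (s / 2)) ^ 2) (Icc 0 1) := hf.pow 2
  have hg2 : ContinuousOn (fun t : ℝ => ((1 - t) ^ (s / 2)) ^ 2) (Icc 0 1) := hg.pow 2
  rw [halfPow, coPow, hR.norm_cfc_sq hf, hR.norm_cfc_sq hg, ← Complex.add_re, ← inner_add_right,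
    ← add_apply, ← cfc_add (a := R) _ _ (hf2.mono hR.spectrum_subset)
      (hg2.mono hR.spectrum_subset)]
  refine le_trans (le_of_eq ?_) (hR.inner_cfc_mono (continuousOn_const (c := (1 / 2 : ℝ) ^ s))
    (hf2.add hg2) (fun t ht => half_rpow_le hs ht) y)
  rw [hR.cfc_const_apply, inner_smul_right, inner_self_eq_norm_sq_to_K, Complex.re_ofReal_mul]
  norm_cast

/-- The relation by which `|A|^s` is defined is the graph of an operator, because `R^(s/2)` is
injective. -/
theorem graph_absPow {A : H →ₗ.[ℂ] H} (hA : IsSelfAdjoint A) {s : ℝ} (hs : 0 ≤ s) :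
    (absPow A s).graph = LinearMap.range ((halfPow (invOneAddSq A) s).toLinearMap.prod
      (coPow (invOneAddSq A) s).toLinearMap) := by
  refine Submodule.toLinearPMap_graph_eq _ ?_
  rintro _ ⟨y, rfl⟩ h
  have : y = 0 := (isResolvent_invOneAddSq hA).halfPow_injective hs (h.trans (map_zero _).symm)
  simp [this]

variable {A : H →ₗ.[ℂ] H}

/-- The linear bijection `y ↦ (R^(s/2) y, (1 - R)^(s/2) y)` of `H` onto the graph of `|A|^s`. -/
def hsLinearEquiv (hA : IsSelfAdjoint A) {s : ℝ} (hs : 0 ≤ s) : H ≃ₗ[ℂ] Hs A s :=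
  LinearEquiv.ofBijective
    (LinearMap.codRestrict
      ((absPow A s).graph.map (WithLp.linearEquiv 2 ℂ (H × H)).symm.toLinearMap)
      ((WithLp.linearEquiv 2 ℂ (H × H)).symm.toLinearMap ∘ₗ
      ((halfPow (invOneAddSq A) s).toLinearMap.prod (coPow (invOneAddSq A) s).toLinearMap))
      (fun y => ⟨_, by rw [graph_absPow hA hs]; exact ⟨y, rfl⟩, rfl⟩))
    ⟨by
      intro x y h
      have h1 := congrArg (fun z : Hs A s => (z : WithLp 2 (H × H)).fst) h
      exact (isResolvent_invOneAddSq hA).halfPow_injective hs h1, by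
      rintro ⟨_, z, hz, rfl⟩
      rw [SetLike.mem_coe, graph_absPow hA hs] at hz
      obtain ⟨y, rfl⟩ := hz
      exact ⟨y, rfl⟩⟩

theorem norm_hsLinearEquiv_sq (hA : IsSelfAdjoint A) {s : ℝ} (hs : 0 ≤ s) (y : H) :
    ‖hsLinearEquiv hA hs y‖ ^ 2 =
      ‖halfPow (invOneAddSq A) s y‖ ^ 2 + ‖coPow (invOneAddSq A) s y‖ ^ 2 :=
  WithLp.prod_norm_sq_eq_of_L2 _

theorem norm_hsLinearEquiv_sq_le (hA : IsSelfAdjoint A) {s : ℝ} (hs : 0 ≤ s) (y : H) :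
    ‖hsLinearEquiv hA hs y‖ ^ 2 ≤ 2 * ‖y‖ ^ 2 := by
  have hR := isResolvent_invOneAddSq hA
  have h1 := hR.norm_halfPow_le hs y
  have h2 : ‖coPow (invOneAddSq A) s y‖ ≤ ‖y‖ :=
    (hR.norm_cfc_le (continuousOn_coPow hs) (c := 1) (fun t ht => by
      have h1 : 0 ≤ 1 - t := by linarith [ht.2]
      rw [abs_of_nonneg (Real.rpow_nonneg h1 _)]
      exact Real.rpow_le_one h1 (by linarith [ht.1]) (by positivity)) y).trans (one_mul _).le
  rw [norm_hsLinearEquiv_sq]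
  nlinarith [norm_nonneg (halfPow (invOneAddSq A) s y), norm_nonneg (coPow (invOneAddSq A) s y)]

theorem norm_sq_le_hsLinearEquiv (hA : IsSelfAdjoint A) {s : ℝ} (hs : 0 ≤ s) (y : H) :
    ‖y‖ ^ 2 ≤ 2 ^ s * ‖hsLinearEquiv hA hs y‖ ^ 2 := by
  have h := (isResolvent_invOneAddSq hA).norm_sq_le hs y
  rw [← norm_hsLinearEquiv_sq hA hs, one_div, Real.inv_rpow (by norm_num),
    inv_mul_le_iff₀ (by positivity)] at h
  exact h

/-- The isomorphism `y ↦ (R^(s/2) y, (1 - R)^(s/2) y)` of `H` onto `H_s(A)`. -/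
def hsEquiv (hA : IsSelfAdjoint A) {s : ℝ} (hs : 0 ≤ s) : H ≃L[ℂ] Hs A s :=
  (hsLinearEquiv hA hs).toContinuousLinearEquivOfBounds (Real.sqrt 2) (Real.sqrt (2 ^ s))
    (fun y => by
      rw [← Real.sqrt_sq (norm_nonneg y), ← Real.sqrt_mul (by positivity)]
      exact Real.le_sqrt_of_sq_le (norm_hsLinearEquiv_sq_le hA hs y))
    (fun y => by
      rw [← Real.sqrt_sq (norm_nonneg y), ← Real.sqrt_mul (by positivity)]
      refine Real.le_sqrt_of_sq_le ?_
      have := norm_sq_le_hsLinearEquiv hA hs ((hsLinearEquiv hA hs).symm y)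
      rwa [LinearEquiv.apply_symm_apply] at this)

theorem val_hsEquiv (hA : IsSelfAdjoint A) {s : ℝ} (hs : 0 ≤ s) (y : H) :
    Hs.val A s (hsEquiv hA hs y) = halfPow (invOneAddSq A) s y := rfl

theorem norm_hsEquiv_sq_le (hA : IsSelfAdjoint A) {s : ℝ} (hs : 0 ≤ s) (y : H) :
    ‖hsEquiv hA hs y‖ ^ 2 ≤ 2 * ‖y‖ ^ 2 := norm_hsLinearEquiv_sq_le hA hs y

theorem norm_sq_le_hsEquiv (hA : IsSelfAdjoint A) {s : ℝ} (hs : 0 ≤ s) (y : H) :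
    ‖y‖ ^ 2 ≤ 2 ^ s * ‖hsEquiv hA hs y‖ ^ 2 := norm_sq_le_hsLinearEquiv hA hs y

theorem hsVal_injective (hA : IsSelfAdjoint A) {s : ℝ} (hs : 0 ≤ s) :
    Function.Injective (Hs.val A s) := by
  intro x y h
  obtain ⟨x, rfl⟩ := (hsEquiv hA hs).surjective x
  obtain ⟨y, rfl⟩ := (hsEquiv hA hs).surjective y
  rw [val_hsEquiv, val_hsEquiv] at h
  rw [(isResolvent_invOneAddSq hA).halfPow_injective hs h]

theorem completeSpace_hs (hA : IsSelfAdjoint A) {s : ℝ} (hs : 0 ≤ s) : CompleteSpace (Hs A s) :=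
  ((hsEquiv hA hs).isUniformEmbedding.isUniformInducing.completeSpace_congr
    (hsEquiv hA hs).surjective).1 inferInstance

end Calculus

/-! ### Weak derivatives -/

section Weak

variable {V : Type*} [NormedAddCommGroup V] [InnerProductSpace ℂ V]
variable {W : Type*} [NormedAddCommGroup W] [InnerProductSpace ℂ W]
variable {H : Type*} [NormedAddCommGroup H] [InnerProductSpace ℂ H] [CompleteSpace H]

theorem enorm_sq_eq_lintegral (f : L2 V) : ‖f‖ₑ ^ 2 = ∫⁻ x in Ioi 0, ‖f x‖ₑ ^ 2 := by
  rw [Lp.enorm_def]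
  have h := eLpNorm_nnreal_pow_eq_lintegral (p := 2) (f := f) (μ := halfLine) (by norm_num)
  have e : ((2 : ℝ≥0) : ℝ) = (2 : ℕ) := by norm_num
  simp only [e, ENNReal.rpow_natCast] at h
  exact h

theorem enorm_sq_le_of_ae {f : L2 V} {g : L2 W} {c : ℝ≥0∞} (hc : c ≠ ⊤)
    (h : ∀ᵐ x ∂halfLine, ‖f x‖ₑ ^ 2 ≤ c * ‖g x‖ₑ ^ 2) : ‖f‖ₑ ^ 2 ≤ c * ‖g‖ₑ ^ 2 := by
  rw [enorm_sq_eq_lintegral, enorm_sq_eq_lintegral, ← lintegral_const_mul' _ _ hc]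
  exact lintegral_mono_ae h

theorem enorm_sq_le_of_norm_sq_le {V W : Type*} [NormedAddCommGroup V] [NormedAddCommGroup W]
    {x : V} {y : W} {c : ℝ≥0} (h : ‖x‖ ^ 2 ≤ c * ‖y‖ ^ 2) :
    ‖x‖ₑ ^ 2 ≤ c * ‖y‖ₑ ^ 2 := by
  have h2 : ‖x‖₊ ^ 2 ≤ c * ‖y‖₊ ^ 2 := by exact_mod_cast h
  simp only [enorm_eq_nnnorm]
  exact_mod_cast h2

theorem enorm_sq_le_of_norm_le {V W : Type*} [NormedAddCommGroup V] [NormedAddCommGroup W]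
    {x : V} {y : W} (h : ‖x‖ ≤ ‖y‖) : ‖x‖ₑ ^ 2 ≤ ‖y‖ₑ ^ 2 := by
  gcongr
  exact enorm_le_iff_norm_le.2 h

theorem integrable_test {V : Type*} [NormedAddCommGroup V] [NormedSpace ℝ V] (f : Lp V 2 halfLine)
    {η : ℝ → ℝ} (hη : Continuous η)
    (hc : HasCompactSupport η) : Integrable (fun x => η x • f x) halfLine :=
  ((Lp.memLp f).locallyIntegrable one_le_two).integrable_smul_left_of_hasCompactSupport hη hc

theorem L2.ext_of_integral_eq {f g : L2 H}
    (h : ∀ η : ℝ → ℝ, ContDiff ℝ ∞ η → HasCompactSupport η → tsupport η ⊆ Ioi 0 →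
      ∫ x in Ioi 0, η x • f x = ∫ x in Ioi 0, η x • g x) : f = g := by
  have key := isOpen_Ioi.ae_eq_zero_of_integral_contDiff_smul_eq_zero
    (U := Ioi (0 : ℝ)) (μ := halfLine) (f := fun x => f x - g x)
    ((((Lp.memLp f).sub (Lp.memLp g)).locallyIntegrable one_le_two).locallyIntegrableOn _) ?_
  · refine Lp.ext ?_
    filter_upwards [key, ae_restrict_mem measurableSet_Ioi] with x hx hx0
    exact sub_eq_zero.1 (hx hx0)
  · intro η h1 h2 h3
    simp only [smul_sub]
    rw [integral_sub (integrable_test f h1.continuous h2) (integrable_test g h1.continuous h2),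
      h η h1 h2 h3, sub_self]

theorem IsWeakDeriv.unique {l : ℕ} {f g g' : L2 H} (h : IsWeakDeriv l f g)
    (h' : IsWeakDeriv l f g') : g = g' := by
  refine L2.ext_of_integral_eq fun η h1 h2 h3 => ?_
  have := (h η h1 h2 h3).symm.trans (h' η h1 h2 h3)
  exact smul_right_injective H (pow_ne_zero l (by norm_num : (-1 : ℝ) ≠ 0)) this

theorem IsWeakDeriv.sub {l : ℕ} {f g f' g' : L2 H} (h : IsWeakDeriv l f g)
    (h' : IsWeakDeriv l f' g') : IsWeakDeriv l (f - f') (g - g') := by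
  have := h.add (h'.smul (-1))
  simpa [sub_eq_add_neg] using this

/-- The operator on `L²` spaces that applies `T` pointwise. -/
abbrev pointwise (T : V →L[ℂ] W) : L2 V →L[ℂ] L2 W := T.compLpL 2 halfLine

theorem coeFn_pointwise (T : V →L[ℂ] W) (f : L2 V) :
    pointwise T f =ᵐ[halfLine] fun x => T (f x) := T.coeFn_compLpL f

variable [CompleteSpace V]

theorem integral_pointwise [CompleteSpace W] (T : V →L[ℂ] W) (f : L2 V) {η : ℝ → ℝ}
    (hη : Continuous η)
    (hc : HasCompactSupport η) :
    ∫ x in Ioi 0, η x • pointwise T f x = T (∫ x in Ioi 0, η x • f x) := by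
  rw [← T.integral_comp_comm (integrable_test f hη hc)]
  refine integral_congr_ae ?_
  filter_upwards [coeFn_pointwise T f] with x hx
  simp only [hx]
  exact ((T.restrictScalars ℝ).map_smul _ _).symm

theorem hasCompactSupport_iteratedDeriv {η : ℝ → ℝ} (hc : HasCompactSupport η) (l : ℕ) :
    HasCompactSupport (iteratedDeriv l η) := by
  induction l with
  | zero => simpa using hc
  | succ k ih => rw [iteratedDeriv_succ]; exact ih.deriv

theorem tsupport_iteratedDeriv_subset (η : ℝ → ℝ) (l : ℕ) :
    tsupport (iteratedDeriv l η) ⊆ tsupport η := by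
  induction l with
  | zero => simp
  | succ k ih =>
    rw [iteratedDeriv_succ]
    exact (tsupport_deriv_subset (f := iteratedDeriv k η)).trans ih

theorem contDiff_iteratedDeriv {η : ℝ → ℝ} (h : ContDiff ℝ ∞ η) (l : ℕ) :
    ContDiff ℝ ∞ (iteratedDeriv l η) := by
  induction l with
  | zero => simpa using h
  | succ k ih => rw [iteratedDeriv_succ]; exact (contDiff_infty_iff_deriv.1 ih).2

theorem IsWeakDeriv.pointwise {l : ℕ} {f g : L2 V} (h : IsWeakDeriv l f g) [CompleteSpace W]
    (T : V →L[ℂ] W) : IsWeakDeriv l (pointwise T f) (pointwise T g) := by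
  intro η h1 h2 h3
  rw [integral_pointwise T f (h1.continuous_iteratedDeriv l (by exact_mod_cast le_top))
    (hasCompactSupport_iteratedDeriv h2 l), integral_pointwise T g h1.continuous h2,
    h η h1 h2 h3]
  exact (T.restrictScalars ℝ).map_smul _ _

theorem isWeakDeriv_zero_self (f : L2 H) : IsWeakDeriv 0 f f := by
  intro η _ _ _
  simp

theorem eq_of_isWeakDeriv_zero {f g : L2 H} (h : IsWeakDeriv 0 f g) : g = f :=
  h.unique (isWeakDeriv_zero_self f)

theorem norm_pointwise_le (T : V →L[ℂ] W) (hT : ∀ x, ‖T x‖ ≤ ‖x‖) (f : L2 V) :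
    ‖pointwise T f‖ ≤ ‖f‖ := by
  refine Lp.norm_le_norm_of_ae_le ?_
  filter_upwards [coeFn_pointwise T f] with x hx
  rw [hx]
  exact hT _

theorem pointwise_injective {T : V →L[ℂ] W} (hT : Function.Injective T) :
    Function.Injective (pointwise T) := by
  intro f g h
  refine Lp.ext ?_
  filter_upwards [coeFn_pointwise T f, coeFn_pointwise T g, Lp.ext_iff.1 h] with x h1 h2 h3
  exact hT (h1.symm.trans (h3.trans h2))

theorem pointwise_comp {U : Type*} [NormedAddCommGroup U] [InnerProductSpace ℂ U]
    (S : W →L[ℂ] U) (T : V →L[ℂ] W) (Q : V →L[ℂ] U) (h : ∀ x, Q x = S (T x)) (f : L2 V) :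
    pointwise Q f = pointwise S (pointwise T f) := by
  refine Lp.ext ?_
  filter_upwards [coeFn_pointwise Q f, coeFn_pointwise S (pointwise T f),
    coeFn_pointwise T f] with x h1 h2 h3
  rw [h1, h2, h3, h]

/-! ### The norms of `ℋ_n` in terms of powers of the resolvent -/

variable {A : H →ₗ.[ℂ] H}

/-- The powers `R^(s/2)`, `R = (1 + A²)⁻¹`, acting pointwise on `L²(ℝ₊, H)`. -/
abbrev powL2 (A : H →ₗ.[ℂ] H) (s : ℝ) : L2 H →L[ℂ] L2 H := pointwise (halfPow (invOneAddSq A) s)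

theorem inclL2_hsEquiv (hA : IsSelfAdjoint A) {s : ℝ} (hs : 0 ≤ s) (y : L2 H) :
    inclL2 A s (pointwise (hsEquiv hA hs : H →L[ℂ] Hs A s) y) = powL2 A s y :=
  (pointwise_comp (Hs.val A s) (hsEquiv hA hs : H →L[ℂ] Hs A s) _
    (fun _ => (val_hsEquiv hA hs _).symm) y).symm

theorem powL2_injective (hA : IsSelfAdjoint A) {s : ℝ} (hs : 0 ≤ s) :
    Function.Injective (powL2 A s) :=
  pointwise_injective ((isResolvent_invOneAddSq hA).halfPow_injective hs)

theorem powL2_add (hA : IsSelfAdjoint A) {a b : ℝ} (ha : 0 ≤ a) (hb : 0 ≤ b) (y : L2 H) :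
    powL2 A (a + b) y = powL2 A a (powL2 A b y) :=
  pointwise_comp _ _ _ (fun x => (isResolvent_invOneAddSq hA).halfPow_add ha hb x) y

theorem norm_powL2_le (hA : IsSelfAdjoint A) {s : ℝ} (hs : 0 ≤ s) (y : L2 H) :
    ‖powL2 A s y‖ ≤ ‖y‖ :=
  norm_pointwise_le _ ((isResolvent_invOneAddSq hA).norm_halfPow_le hs) y

theorem powL2_zero (hA : IsSelfAdjoint A) (y : L2 H) : powL2 A 0 y = y := by
  refine Lp.ext ?_
  filter_upwards [coeFn_pointwise (halfPow (invOneAddSq A) 0) y] with x hx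
  rw [hx, (isResolvent_invOneAddSq hA).halfPow_zero]
  rfl

theorem derivNormSq_le (hA : IsSelfAdjoint A) {l j : ℕ} {f y : L2 H}
    (h : IsWeakDeriv l f (powL2 A j y)) : derivNormSq A l j f ≤ 2 * ‖y‖ₑ ^ 2 := by
  have hj : (0 : ℝ) ≤ j := j.cast_nonneg
  refine (iInf₂_le (pointwise (hsEquiv hA hj : H →L[ℂ] Hs A j) y)
    (by rwa [inclL2_hsEquiv])).trans ?_
  refine enorm_sq_le_of_ae (by simp) ?_
  filter_upwards [coeFn_pointwise (hsEquiv hA hj : H →L[ℂ] Hs A j) y] with x hx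
  rw [hx]
  exact enorm_sq_le_of_norm_sq_le (c := 2) (norm_hsEquiv_sq_le hA hj (y x))

theorem le_derivNormSq (hA : IsSelfAdjoint A) {l j : ℕ} {f : L2 H} {X c : ℝ≥0∞} (hc0 : c ≠ 0)
    (hc : c ≠ ⊤)
    (h : ∀ y, IsWeakDeriv l f (powL2 A j y) → X ≤ c * ‖y‖ₑ ^ 2) :
    X ≤ c * 2 ^ j * derivNormSq A l j f := by
  have hj : (0 : ℝ) ≤ j := j.cast_nonneg
  have := completeSpace_hs hA hj
  unfold derivNormSq
  simp only [iInf_subtype']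
  have h2 : (2 : ℝ≥0∞) ^ j ≠ ⊤ := by simp
  rw [ENNReal.mul_iInf_of_ne (mul_ne_zero hc0 (by simp)) (ENNReal.mul_ne_top hc h2)]
  refine le_iInf fun g => ?_
  set y := pointwise ((hsEquiv hA hj).symm : Hs A j →L[ℂ] H) g.1 with hy
  have e : pointwise (hsEquiv hA hj : H →L[ℂ] Hs A j) y = g.1 := by
    rw [hy, ← pointwise_comp _ _ (ContinuousLinearMap.id ℂ _) (fun x => by simp)]
    refine Lp.ext ?_
    filter_upwards [coeFn_pointwise (ContinuousLinearMap.id ℂ (Hs A j)) g.1] with x hx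
    rw [hx]; rfl
  have h3 := h y (by rw [← inclL2_hsEquiv hA hj, e]; exact g.2)
  refine h3.trans ?_
  rw [mul_assoc]
  gcongr
  refine enorm_sq_le_of_ae h2 ?_
  filter_upwards [coeFn_pointwise ((hsEquiv hA hj).symm : Hs A j →L[ℂ] H) g.1] with x hx
  rw [hx]
  have h4 := norm_sq_le_hsEquiv hA hj ((hsEquiv hA hj).symm (g.1 x))
  rw [ContinuousLinearEquiv.apply_symm_apply, Real.rpow_natCast] at h4
  exact_mod_cast enorm_sq_le_of_norm_sq_le (c := 2 ^ j) (by exact_mod_cast h4)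

theorem exists_of_derivNormSq_lt_top (hA : IsSelfAdjoint A) {l j : ℕ} {f : L2 H}
    (h : derivNormSq A l j f < ⊤) : ∃ y, IsWeakDeriv l f (powL2 A j y) := by
  by_contra! hn
  have := le_derivNormSq hA (X := ⊤) (c := 1) (l := l) (j := j) (f := f) (by simp) (by simp)
    (fun y hy => absurd hy (hn y))
  rw [one_mul, top_le_iff] at this
  exact (ENNReal.mul_lt_top (by simp) h).ne this

theorem derivNormSq_le_succ (hA : IsSelfAdjoint A) (l j : ℕ) (f : L2 H) :
    derivNormSq A l j f ≤ 2 * 2 ^ (j + 1) * derivNormSq A l (j + 1) f := by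
  refine le_derivNormSq hA (by simp) (by simp) fun y hy => ?_
  refine (derivNormSq_le hA (y := powL2 A 1 y) ?_).trans ?_
  · rwa [← powL2_add hA j.cast_nonneg zero_le_one, ← Nat.cast_add_one]
  · gcongr 2 * ?_
    exact enorm_sq_le_of_norm_le (norm_powL2_le hA zero_le_one y)

theorem intNormSq_le_succ (hA : IsSelfAdjoint A) (n : ℕ) (f : L2 H) :
    intNormSq A n f ≤ 2 * 2 ^ (n + 1) * intNormSq A (n + 1) f := by
  unfold intNormSq
  rw [Finset.mul_sum]
  refine le_trans ?_ (Finset.sum_le_sum_of_subset (Finset.range_mono (Nat.le_succ (n + 1))))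
  refine Finset.sum_le_sum fun k hk => ?_
  rw [Finset.mul_sum]
  refine Finset.sum_le_sum fun l _ => ?_
  have hk' : k ≤ n := by simpa [Nat.lt_succ_iff] using hk
  have e : n + 1 - k = n - k + 1 := by omega
  rw [e]
  refine (derivNormSq_le_succ hA l (n - k) f).trans ?_
  gcongr
  · norm_num
  · omega

theorem derivNormSq_le_intNormSq {n l j : ℕ} (h : l + j ≤ n) (f : L2 H) :
    derivNormSq A l j f ≤ intNormSq A n f := by
  have hk : n - j ∈ Finset.range (n + 1) := Finset.mem_range.2 (by omega)
  have hl : l ∈ Finset.range (n - j + 1) := Finset.mem_range.2 (by omega)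
  have e : n - (n - j) = j := by omega
  have h1 := Finset.single_le_sum (f := fun l => derivNormSq A l (n - (n - j)) f)
    (fun _ _ => bot_le) hl
  have h2 := Finset.single_le_sum
    (f := fun k => ∑ l ∈ Finset.range (k + 1), derivNormSq A l (n - k) f)
    (fun _ _ => bot_le) hk
  simp only [e] at h1
  refine h1.trans (le_trans (le_of_eq ?_) h2)
  simp only [e]

theorem intNormSq_lt_top {n : ℕ} {f : L2 H} (h : ∀ l j, l + j ≤ n → derivNormSq A l j f < ⊤) :
    intNormSq A n f < ⊤ := by
  refine ENNReal.sum_lt_top.2 fun k hk => ENNReal.sum_lt_top.2 fun l hl => h l _ ?_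
  simp only [Finset.mem_range] at hk hl
  omega

end Weak

/-! ### Functions that are smooth up to the boundary -/

section Smooth

variable {V : Type*} [NormedAddCommGroup V] [InnerProductSpace ℂ V]
variable {W : Type*} [NormedAddCommGroup W] [InnerProductSpace ℂ W]
variable {H : Type*} [NormedAddCommGroup H] [InnerProductSpace ℂ H] [CompleteSpace H]

/-- The `l`-th derivative on `[0, ∞)`, one-sided at `0`. -/
abbrev hderiv (l : ℕ) (ψ : ℝ → V) : ℝ → V := iteratedDerivWithin l ψ (Ici 0)

theorem contDiffOn_derivWithin {ψ : ℝ → V} (h : ContDiffOn ℝ ∞ ψ (Ici 0)) :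
    ContDiffOn ℝ ∞ (derivWithin ψ (Ici 0)) (Ici 0) :=
  ((contDiffOn_infty_iff_derivWithin (uniqueDiffOn_Ici 0)).1 h).2

theorem hderiv_succ (l : ℕ) (ψ : ℝ → V) :
    hderiv (l + 1) ψ = hderiv l (derivWithin ψ (Ici 0)) := iteratedDerivWithin_succ'

theorem contDiffOn_hderiv {ψ : ℝ → V} (h : ContDiffOn ℝ ∞ ψ (Ici 0)) (l : ℕ) :
    ContDiffOn ℝ ∞ (hderiv l ψ) (Ici 0) := by
  induction l generalizing ψ with
  | zero => simpa using h
  | succ l ih =>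
    rw [hderiv_succ]
    exact ih (contDiffOn_derivWithin h)

theorem hasDerivWithinAt_derivWithin {ψ : ℝ → V} (h : ContDiffOn ℝ ∞ ψ (Ici 0)) {x : ℝ}
    (hx : 0 ≤ x) : HasDerivWithinAt ψ (derivWithin ψ (Ici 0) x) (Ici 0) x :=
  ((h.differentiableOn (by simp)) x hx).hasDerivWithinAt

theorem hasDerivAt_derivWithin {ψ : ℝ → V} (h : ContDiffOn ℝ ∞ ψ (Ici 0)) {x : ℝ}
    (hx : 0 < x) : HasDerivAt ψ (derivWithin ψ (Ici 0) x) x :=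
  (hasDerivWithinAt_derivWithin h hx.le).hasDerivAt (Ici_mem_nhds hx)

theorem derivWithin_clm_comp {ψ : ℝ → V} (h : ContDiffOn ℝ ∞ ψ (Ici 0)) (T : V →L[ℂ] W) {x : ℝ}
    (hx : 0 ≤ x) :
    derivWithin (fun y => T (ψ y)) (Ici 0) x = T (derivWithin ψ (Ici 0) x) :=
  ((T.restrictScalars ℝ).hasFDerivAt.comp_hasDerivWithinAt x
    (hasDerivWithinAt_derivWithin h hx)).derivWithin (uniqueDiffOn_Ici 0 x hx)

theorem contDiffOn_clm_comp {ψ : ℝ → V} (h : ContDiffOn ℝ ∞ ψ (Ici 0)) (T : V →L[ℂ] W) :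
    ContDiffOn ℝ ∞ (fun y => T (ψ y)) (Ici 0) :=
  (T.restrictScalars ℝ).contDiff.comp_contDiffOn h

theorem hderiv_clm_comp {ψ : ℝ → V} (h : ContDiffOn ℝ ∞ ψ (Ici 0)) (T : V →L[ℂ] W) (l : ℕ) {x : ℝ}
    (hx : 0 ≤ x) : hderiv l (fun y => T (ψ y)) x = T (hderiv l ψ x) := by
  induction l generalizing ψ with
  | zero => simp
  | succ l ih =>
    rw [hderiv_succ, hderiv_succ, ← ih (contDiffOn_derivWithin h)]
    exact iteratedDerivWithin_congr (fun y hy => derivWithin_clm_comp h T hy) hx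

theorem aestronglyMeasurable_of_continuousOn {ψ : ℝ → V} (h : ContinuousOn ψ (Ici 0)) :
    AEStronglyMeasurable ψ halfLine :=
  (h.mono Ioi_subset_Ici_self).aestronglyMeasurable measurableSet_Ioi

theorem memLp_of_continuousOn {ψ : ℝ → V} (h : ContinuousOn ψ (Ici 0)) {b : ℝ}
    (hb : ∀ x, b ≤ x → ψ x = 0) (p : ℝ≥0∞) : MemLp ψ p halfLine := by
  have hm := aestronglyMeasurable_of_continuousOn h
  obtain ⟨C, hC⟩ := (isCompact_Icc (a := (0 : ℝ)) (b := b)).exists_bound_of_continuousOn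
    (h.mono fun x hx => hx.1)
  have h1 : MemLp ψ p (volume.restrict (Icc 0 b)) := by
    refine MemLp.of_bound
      (ContinuousOn.aestronglyMeasurable (h.mono fun x hx => hx.1) measurableSet_Icc) C ?_
    filter_upwards [ae_restrict_mem measurableSet_Icc] with x hx
    exact hC x hx
  rw [← memLp_indicator_iff_restrict measurableSet_Icc] at h1
  refine (h1.restrict (Ioi 0)).ae_eq ?_
  filter_upwards [ae_restrict_mem measurableSet_Ioi] with x hx
  by_cases hxb : x ≤ b
  · exact indicator_of_mem (s := Icc 0 b) ⟨le_of_lt hx, hxb⟩ _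
  · rw [indicator_of_notMem (fun h => hxb h.2), hb x (le_of_not_ge hxb)]

/-- The functions on `[0, ∞)` with compact support that are smooth up to `0`. -/
structure IsHalfSmooth (ψ : ℝ → V) : Prop where
  smooth : ContDiffOn ℝ ∞ ψ (Ici 0)
  compact : ∃ b : ℝ, ∀ x, b ≤ x → ψ x = 0

namespace IsHalfSmooth

variable {ψ χ : ℝ → V}

theorem continuousOn (h : IsHalfSmooth ψ) : ContinuousOn ψ (Ici 0) := h.smooth.continuousOn

theorem memLp (h : IsHalfSmooth ψ) (p : ℝ≥0∞) : MemLp ψ p halfLine :=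
  let ⟨_, hb⟩ := h.compact
  memLp_of_continuousOn h.continuousOn hb p

theorem sub (h : IsHalfSmooth ψ) (h' : IsHalfSmooth χ) : IsHalfSmooth (fun x => ψ x - χ x) :=
  ⟨h.smooth.sub h'.smooth, by
    obtain ⟨b, hb⟩ := h.compact
    obtain ⟨b', hb'⟩ := h'.compact
    refine ⟨max b b', fun x hx => ?_⟩
    rw [hb x ((le_max_left _ _).trans hx), hb' x ((le_max_right _ _).trans hx), sub_zero]⟩

theorem clm_comp (h : IsHalfSmooth ψ) (T : V →L[ℂ] W) : IsHalfSmooth (fun x => T (ψ x)) :=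
  ⟨contDiffOn_clm_comp h.smooth T, by
    obtain ⟨b, hb⟩ := h.compact
    exact ⟨b, fun x hx => by rw [hb x hx, map_zero]⟩⟩

theorem derivWithin (h : IsHalfSmooth ψ) : IsHalfSmooth (derivWithin ψ (Ici 0)) :=
  ⟨contDiffOn_derivWithin h.smooth, by
    obtain ⟨b, hb⟩ := h.compact
    refine ⟨max b 0 + 1, fun x hx => ?_⟩
    have hx0 : 0 < x := by linarith [le_max_right b 0]
    have hxb : b < x := by linarith [le_max_left b 0]
    have h0 : ψ =ᶠ[nhds x] fun _ => 0 := by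
      filter_upwards [Ioi_mem_nhds hxb] with y hy
      exact hb y (le_of_lt hy)
    rw [derivWithin_of_mem_nhds (Ici_mem_nhds hx0), h0.deriv_eq, deriv_const]⟩

theorem hderiv (h : IsHalfSmooth ψ) (l : ℕ) : IsHalfSmooth (hderiv l ψ) := by
  induction l generalizing ψ with
  | zero => simpa [TraceThm.hderiv] using h
  | succ l ih =>
    rw [hderiv_succ]
    exact ih h.derivWithin

theorem tendsto_zero (h : IsHalfSmooth ψ) : Filter.Tendsto ψ Filter.atTop (nhds 0) := by
  obtain ⟨b, hb⟩ := h.compact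
  refine tendsto_const_nhds.congr' ?_
  filter_upwards [Filter.eventually_ge_atTop b] with x hx
  exact (hb x hx).symm

theorem integrableOn (h : IsHalfSmooth ψ) : IntegrableOn ψ (Ioi 0) :=
  memLp_one_iff_integrable.1 (h.memLp 1)

theorem exists_bound (h : IsHalfSmooth ψ) : ∃ C, ∀ x, 0 ≤ x → ‖ψ x‖ ≤ C := by
  obtain ⟨b, hb⟩ := h.compact
  obtain ⟨C, hC⟩ := (isCompact_Icc (a := (0 : ℝ)) (b := b)).exists_bound_of_continuousOn
    (h.continuousOn.mono fun x hx => hx.1)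
  refine ⟨max C 0, fun x hx => ?_⟩
  by_cases hxb : x ≤ b
  · exact (hC x ⟨hx, hxb⟩).trans (le_max_left _ _)
  · rw [hb x (le_of_not_ge hxb), norm_zero]
    exact le_max_right _ _

/-- The class in `L²(ℝ₊, V)`. -/
def toL2 (h : IsHalfSmooth ψ) : L2 V := (h.memLp 2).toLp ψ

theorem coeFn_toL2 (h : IsHalfSmooth ψ) : h.toL2 =ᵐ[halfLine] ψ := MemLp.coeFn_toLp _

end IsHalfSmooth

/-- A continuous representative on `[0, ∞)` is unique. -/
theorem eqOn_of_ae_eq {ψ χ : ℝ → V} (hψ : ContinuousOn ψ (Ici 0)) (hχ : ContinuousOn χ (Ici 0))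
    (h : ψ =ᵐ[halfLine] χ) {x : ℝ} (hx : 0 ≤ x) : ψ x = χ x := by
  have h1 : EqOn ψ χ (Ioi 0) := Measure.eqOn_open_of_ae_eq h isOpen_Ioi
    (hψ.mono Ioi_subset_Ici_self) (hχ.mono Ioi_subset_Ici_self)
  exact h1.of_subset_closure hψ hχ Ioi_subset_Ici_self (by rw [closure_Ioi]) hx

theorem isHalfSmooth_test_smul {η : ℝ → ℝ} (hη : ContDiff ℝ ∞ η) (hc : HasCompactSupport η)
    {ψ : ℝ → V} (h : ContDiffOn ℝ ∞ ψ (Ici 0)) : IsHalfSmooth (fun x => η x • ψ x) := by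
  refine ⟨hη.contDiffOn.smul h, ?_⟩
  obtain ⟨r, hr⟩ := hc.isCompact.isBounded.subset_closedBall 0
  refine ⟨r + 1, fun x hx => ?_⟩
  suffices h0 : x ∉ tsupport η by
    simp only [image_eq_zero_of_notMem_tsupport h0, zero_smul]
  intro hx'
  have := hr hx'
  rw [mem_closedBall_zero_iff, Real.norm_eq_abs] at this
  linarith [le_abs_self x]

theorem integral_deriv_smul {η : ℝ → ℝ} (hη : ContDiff ℝ ∞ η) (hc : HasCompactSupport η)
    (hs : tsupport η ⊆ Ioi 0) [CompleteSpace V] {ψ : ℝ → V} (h : ContDiffOn ℝ ∞ ψ (Ici 0)) :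
    ∫ x in Ioi 0, deriv η x • ψ x = -∫ x in Ioi 0, η x • derivWithin ψ (Ici 0) x := by
  have h1 := (isHalfSmooth_test_smul hη hc h)
  have h2 := (isHalfSmooth_test_smul hη hc (contDiffOn_derivWithin h)).integrableOn
  have h3 := (isHalfSmooth_test_smul ((contDiff_infty_iff_deriv.1 hη).2) hc.deriv h).integrableOn
  have key := integral_Ioi_of_hasDerivAt_of_tendsto
    (h1.continuousOn 0 self_mem_Ici)
    (fun x hx => ((hη.differentiable (by simp)) x).hasDerivAt.smul (hasDerivAt_derivWithin h hx))
    (h2.add h3) h1.tendsto_zero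
  have h0 : η 0 = 0 := image_eq_zero_of_notMem_tsupport fun h => lt_irrefl (0 : ℝ) (hs h)
  rw [h0, zero_smul, sub_zero, integral_add h2 h3] at key
  exact eq_neg_of_add_eq_zero_right key

theorem isWeakDeriv_of_contDiffOn {ψ : ℝ → H} (h : ContDiffOn ℝ ∞ ψ (Ici 0)) {l : ℕ} {f g : L2 H}
    (hf : f =ᵐ[halfLine] ψ) (hg : g =ᵐ[halfLine] hderiv l ψ) : IsWeakDeriv l f g := by
  intro η h1 h2 h3
  have e1 : ∫ x in Ioi 0, iteratedDeriv l η x • f x =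
      ∫ x in Ioi 0, iteratedDeriv l η x • ψ x := integral_congr_ae (by
    filter_upwards [hf] with x hx using by rw [hx])
  have e2 : ∫ x in Ioi 0, η x • g x =
      ∫ x in Ioi 0, η x • hderiv l ψ x := integral_congr_ae (by
    filter_upwards [hg] with x hx using by rw [hx])
  rw [e1, e2]
  clear e1 e2 hf hg
  induction l generalizing ψ with
  | zero => simp
  | succ l ih =>
    rw [hderiv_succ, iteratedDeriv_succ, integral_deriv_smul (contDiff_iteratedDeriv h1 l)
      (hasCompactSupport_iteratedDeriv h2 l) ((tsupport_iteratedDeriv_subset η l).trans h3) h,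
      ih (contDiffOn_derivWithin h), pow_succ, mul_smul, neg_one_smul, smul_neg]

/-! ### The space `C₀^∞(ℝ₊, H_∞)` -/

variable {A : H →ₗ.[ℂ] H}

/-- A function in `C₀^∞(ℝ₊, H_∞)` is, for every `s`, the image under `R^(s/2)` of a smooth function
with values in `H`. In this form estimates in `H_s` become estimates in `H`. -/
theorem IsSmoothCompact.exists_lift (hA : IsSelfAdjoint A) {φ : ℝ → H} (hφ : IsSmoothCompact A φ)
    {s : ℝ} (hs : 0 ≤ s) :
    ∃ ψ : ℝ → H, IsHalfSmooth ψ ∧ ∀ x, 0 ≤ x → halfPow (invOneAddSq A) s (ψ x) = φ x := by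
  obtain ⟨Φ, h1, h2⟩ := hφ.smooth s hs
  obtain ⟨b, hb⟩ := hφ.compact
  set E := (hsEquiv hA hs)
  have e : ∀ x, 0 ≤ x → halfPow (invOneAddSq A) s (E.symm (Φ x)) = φ x := by
    intro x hx
    rw [← h2 x hx, ← val_hsEquiv hA hs, ContinuousLinearEquiv.apply_symm_apply]
  refine ⟨fun x => E.symm (Φ x), ⟨contDiffOn_clm_comp h1 (E.symm : Hs A s →L[ℂ] H), max b 0,
    fun x hx => ?_⟩, e⟩
  refine (isResolvent_invOneAddSq hA).halfPow_injective hs ?_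
  rw [e x ((le_max_right _ _).trans hx), hb x ((le_max_left _ _).trans hx), map_zero]

theorem isSmoothCompact_of_lift (hA : IsSelfAdjoint A) {φ : ℝ → H} (hc : ∃ b, ∀ x, b ≤ x → φ x = 0)
    (h : ∀ s : ℝ, 0 ≤ s → ∃ ψ : ℝ → H, ContDiffOn ℝ ∞ ψ (Ici 0) ∧
      ∀ x, 0 ≤ x → halfPow (invOneAddSq A) s (ψ x) = φ x) : IsSmoothCompact A φ := by
  refine ⟨fun s hs => ?_, hc⟩
  obtain ⟨ψ, h1, h2⟩ := h s hs
  exact ⟨fun x => hsEquiv hA hs (ψ x), contDiffOn_clm_comp h1 (hsEquiv hA hs : H →L[ℂ] Hs A s),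
    fun x hx => (val_hsEquiv hA hs _).trans (h2 x hx)⟩

theorem isSmoothCompact_specCut (hA : IsSelfAdjoint A) {ψ : ℝ → H} (h : IsHalfSmooth ψ) (k : ℕ) :
    IsSmoothCompact A (fun x => specCut (invOneAddSq A) k (ψ x)) :=
  isSmoothCompact_of_lift hA (h.clm_comp _).compact fun s hs =>
    ⟨fun x => specCutDiv (invOneAddSq A) k s (ψ x), (h.clm_comp _).smooth, fun x _ =>
      (isResolvent_invOneAddSq hA).halfPow_specCutDiv k hs (ψ x)⟩

theorem IsSmoothCompact.isHalfSmooth (hA : IsSelfAdjoint A) {φ : ℝ → H}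
    (hφ : IsSmoothCompact A φ) : IsHalfSmooth φ := by
  obtain ⟨ψ, h1, h2⟩ := hφ.exists_lift hA le_rfl
  exact ⟨(h1.clm_comp _).smooth.congr fun x hx => (h2 x hx).symm, hφ.compact⟩

/-- On lifts, `derivNormSq` is the `L²` norm of the classical derivative, up to constants. -/
theorem derivNormSq_le_of_lift (hA : IsSelfAdjoint A) {l j : ℕ} {f : L2 H} {ψ : ℝ → H}
    (h : IsHalfSmooth ψ) (hf : f =ᵐ[halfLine] fun x => halfPow (invOneAddSq A) j (ψ x)) :
    derivNormSq A l j f ≤ 2 * ‖(h.hderiv l).toL2‖ₑ ^ 2 := by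
  refine derivNormSq_le hA (isWeakDeriv_of_contDiffOn (h.clm_comp _).smooth hf ?_)
  filter_upwards [coeFn_pointwise (halfPow (invOneAddSq A) j) (h.hderiv l).toL2,
    (h.hderiv l).coeFn_toL2, ae_restrict_mem measurableSet_Ioi] with x h1 h2 h3
  rw [h1, h2, hderiv_clm_comp h.smooth _ l (le_of_lt h3)]

theorem le_derivNormSq_of_lift (hA : IsSelfAdjoint A) {l j : ℕ} {f : L2 H} {ψ : ℝ → H}
    (h : IsHalfSmooth ψ) (hf : f =ᵐ[halfLine] fun x => halfPow (invOneAddSq A) j (ψ x)) :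
    ‖(h.hderiv l).toL2‖ₑ ^ 2 ≤ 2 ^ j * derivNormSq A l j f := by
  have key : ∀ y, IsWeakDeriv l f (powL2 A j y) → y = (h.hderiv l).toL2 := by
    intro y hy
    refine powL2_injective hA j.cast_nonneg (hy.unique ?_)
    refine isWeakDeriv_of_contDiffOn (h.clm_comp _).smooth hf ?_
    filter_upwards [coeFn_pointwise (halfPow (invOneAddSq A) j) (h.hderiv l).toL2,
      (h.hderiv l).coeFn_toL2, ae_restrict_mem measurableSet_Ioi] with x h1 h2 h3
    rw [h1, h2, hderiv_clm_comp h.smooth _ l (le_of_lt h3)]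
  have := le_derivNormSq hA (X := ‖(h.hderiv l).toL2‖ₑ ^ 2) (c := 1) (l := l) (j := j) (f := f)
    one_ne_zero (by simp) (fun y hy => by rw [key y hy, one_mul])
  rwa [one_mul] at this

theorem IsSmoothCompact.intNormSq_lt_top (hA : IsSelfAdjoint A) {φ : ℝ → H}
    (hφ : IsSmoothCompact A φ) {f : L2 H} (hf : f =ᵐ[halfLine] φ) (n : ℕ) :
    intNormSq A n f < ⊤ := by
  refine TraceThm.intNormSq_lt_top fun l j _ => ?_
  obtain ⟨ψ, h1, h2⟩ := hφ.exists_lift hA j.cast_nonneg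
  refine (derivNormSq_le_of_lift hA h1 ?_).trans_lt
    (ENNReal.mul_lt_top (by simp) (ENNReal.pow_lt_top (by simp)))
  filter_upwards [hf, ae_restrict_mem measurableSet_Ioi] with x hx hx0
  rw [hx, h2 x (le_of_lt hx0)]

end Smooth

/-! ### Mollification on the half line -/

section Mollify

open Filter Topology

variable {V : Type*} [NormedAddCommGroup V] [InnerProductSpace ℂ V] [CompleteSpace V]
variable {W : Type*} [NormedAddCommGroup W] [InnerProductSpace ℂ W] [CompleteSpace W]

theorem sq_lintegral_mul_le {α : Type*} [MeasurableSpace α] {μ : Measure α} {w g : α → ℝ≥0∞}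
    (hw : AEMeasurable w μ) (hg : AEMeasurable g μ) :
    (∫⁻ a, w a * g a ∂μ) ^ 2 ≤ (∫⁻ a, w a ∂μ) * ∫⁻ a, w a * g a ^ 2 ∂μ := by
  have h2 : ∀ x : ℝ≥0∞, (x ^ (1 / 2 : ℝ)) ^ (2 : ℝ) = x := fun x => by
    rw [← ENNReal.rpow_mul]; norm_num
  have h := ENNReal.lintegral_mul_le_Lp_mul_Lq μ Real.HolderConjugate.two_two
    (f := fun a => w a ^ (1 / 2 : ℝ)) (g := fun a => w a ^ (1 / 2 : ℝ) * g a)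
    (hw.pow_const _) ((hw.pow_const _).mul hg)
  have e1 : ∀ a, w a ^ (1 / 2 : ℝ) * (w a ^ (1 / 2 : ℝ) * g a) = w a * g a := fun a => by
    rw [← mul_assoc, ← pow_two, ← ENNReal.rpow_natCast]
    norm_num [h2]
  have e2 : ∀ a, (w a ^ (1 / 2 : ℝ) * g a) ^ (2 : ℝ) = w a * g a ^ 2 := fun a => by
    rw [ENNReal.mul_rpow_of_nonneg _ _ (by norm_num), h2]
    norm_num
  simp only [Pi.mul_apply, e1, e2, h2] at h
  calc (∫⁻ a, w a * g a ∂μ) ^ 2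
      ≤ ((∫⁻ a, w a ∂μ) ^ (1 / 2 : ℝ) * (∫⁻ a, w a * g a ^ 2 ∂μ) ^ (1 / 2 : ℝ)) ^ 2 := by gcongr
    _ = _ := by
      rw [mul_pow, ← ENNReal.rpow_natCast, ← ENNReal.rpow_natCast]
      norm_num [h2]

theorem lintegral_sq_lintegral_le {k : ℝ → ℝ} (hk : Continuous k) {G : ℝ → ℝ → ℝ≥0∞}
    (hG : Measurable (Function.uncurry G)) :
    ∫⁻ x, (∫⁻ t, ‖k t‖ₑ * G x t) ^ 2 ≤
      (∫⁻ t, ‖k t‖ₑ) * ∫⁻ t, ‖k t‖ₑ * ∫⁻ x, G x t ^ 2 := by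
  have hk' : Measurable fun t => ‖k t‖ₑ := hk.measurable.enorm
  calc ∫⁻ x, (∫⁻ t, ‖k t‖ₑ * G x t) ^ 2
      ≤ ∫⁻ x, (∫⁻ t, ‖k t‖ₑ) * ∫⁻ t, ‖k t‖ₑ * G x t ^ 2 :=
        lintegral_mono fun x => sq_lintegral_mul_le hk'.aemeasurable
          (hG.comp measurable_prodMk_left).aemeasurable
    _ = (∫⁻ t, ‖k t‖ₑ) * ∫⁻ x, ∫⁻ t, ‖k t‖ₑ * G x t ^ 2 := by
        rw [lintegral_const_mul]
        exact Measurable.lintegral_prod_right'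
          (f := fun p : ℝ × ℝ => ‖k p.2‖ₑ * G p.1 p.2 ^ 2)
          ((hk'.comp measurable_snd).mul (hG.pow_const 2))
    _ = _ := by
        rw [lintegral_lintegral_swap]
        · congr 2
          ext t
          rw [lintegral_const_mul]
          exact (hG.comp measurable_prodMk_right).pow_const 2
        · exact ((hk'.comp measurable_snd).mul (hG.pow_const 2)).aemeasurable

/-- The extension of `f` by zero to the whole line. -/
def extend (f : L2 V) : ℝ → V := (Ioi 0).indicator f

theorem stronglyMeasurable_extend (f : L2 V) : StronglyMeasurable (extend f) :=
  (Lp.stronglyMeasurable f).indicator measurableSet_Ioi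

theorem memLp_extend (f : L2 V) : MemLp (extend f) 2 volume :=
  (memLp_indicator_iff_restrict measurableSet_Ioi).2 (Lp.memLp f)

theorem lintegral_extend (f : L2 V) : ∫⁻ x, ‖extend f x‖ₑ ^ 2 = ‖f‖ₑ ^ 2 := by
  rw [enorm_sq_eq_lintegral, ← lintegral_indicator measurableSet_Ioi]
  congr 1
  ext x
  by_cases hx : x ∈ Ioi (0 : ℝ) <;> simp [extend, hx]

/-- The convolution of `k` with the extension of `f` by zero. -/
def mollFun (k : ℝ → ℝ) (f : L2 V) (x : ℝ) : V := ∫ t in Ioi 0, k (x - t) • f t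

theorem mollFun_eq (k : ℝ → ℝ) (f : L2 V) (x : ℝ) :
    mollFun k f x = ∫ t, k t • extend f (x - t) := by
  rw [← integral_sub_left_eq_self (fun t => k t • extend f (x - t)) volume x, mollFun,
    ← integral_indicator measurableSet_Ioi]
  congr 1
  ext t
  by_cases ht : t ∈ Ioi (0 : ℝ)
  · simp [extend, indicator_of_mem ht]
  · simp [extend, indicator_of_notMem ht]

theorem mollFun_eq_convolution (k : ℝ → ℝ) (f : L2 V) :
    mollFun k f = convolution k (extend f) (ContinuousLinearMap.lsmul ℝ ℝ) volume := by
  ext x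
  rw [mollFun_eq]
  rfl

theorem locallyIntegrable_extend (f : L2 V) : LocallyIntegrable (extend f) volume :=
  (memLp_extend f).locallyIntegrable one_le_two

theorem contDiff_mollFun {k : ℝ → ℝ} (hk : ContDiff ℝ ∞ k) (hc : HasCompactSupport k) (f : L2 V) :
    ContDiff ℝ ∞ (mollFun k f) := by
  rw [mollFun_eq_convolution]
  exact hc.contDiff_convolution_left _ hk (locallyIntegrable_extend f)

theorem hasDerivAt_mollFun {k : ℝ → ℝ} (hk : ContDiff ℝ ∞ k) (hc : HasCompactSupport k) (f : L2 V)
    (x : ℝ) : HasDerivAt (mollFun k f) (mollFun (deriv k) f x) x := by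
  rw [mollFun_eq_convolution, mollFun_eq_convolution]
  exact hc.hasDerivAt_convolution_left _ (hk.of_le (by simp)) (locallyIntegrable_extend f) x

theorem hderiv_mollFun {k : ℝ → ℝ} (hk : ContDiff ℝ ∞ k) (hc : HasCompactSupport k) (f : L2 V)
    (l : ℕ) {x : ℝ} (hx : 0 ≤ x) : hderiv l (mollFun k f) x = mollFun (iteratedDeriv l k) f x := by
  induction l generalizing k with
  | zero => simp
  | succ l ih =>
    rw [hderiv_succ, iteratedDeriv_succ', ← ih (contDiff_infty_iff_deriv.1 hk).2 hc.deriv]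
    exact iteratedDerivWithin_congr (fun y hy =>
      (hasDerivAt_mollFun hk hc f y).hasDerivWithinAt.derivWithin (uniqueDiffOn_Ici 0 y hy)) hx

theorem enorm_mollFun_le (k : ℝ → ℝ) (f : L2 V) (x : ℝ) :
    ‖mollFun k f x‖ₑ ≤ ∫⁻ t, ‖k t‖ₑ * ‖extend f (x - t)‖ₑ := by
  rw [mollFun_eq]
  refine (enorm_integral_le_lintegral_enorm _).trans_eq ?_
  simp only [enorm_smul]

theorem measurable_extend_sub (f : L2 V) :
    StronglyMeasurable (fun p : ℝ × ℝ => extend f (p.1 - p.2)) :=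
  (stronglyMeasurable_extend f).comp_measurable (measurable_fst.sub measurable_snd)

/-- Young's inequality for the mollification. -/
theorem lintegral_mollFun_le {k : ℝ → ℝ} (hk : Continuous k) (f : L2 V) :
    ∫⁻ x, ‖mollFun k f x‖ₑ ^ 2 ≤ (∫⁻ t, ‖k t‖ₑ) ^ 2 * ‖f‖ₑ ^ 2 := by
  calc ∫⁻ x, ‖mollFun k f x‖ₑ ^ 2
      ≤ ∫⁻ x, (∫⁻ t, ‖k t‖ₑ * ‖extend f (x - t)‖ₑ) ^ 2 :=
        lintegral_mono fun x => by gcongr; exact enorm_mollFun_le k f x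
    _ ≤ (∫⁻ t, ‖k t‖ₑ) * ∫⁻ t, ‖k t‖ₑ * ∫⁻ x, ‖extend f (x - t)‖ₑ ^ 2 :=
        lintegral_sq_lintegral_le hk (measurable_extend_sub f).enorm
    _ = _ := by
        have : ∀ t : ℝ, ∫⁻ x, ‖extend f (x - t)‖ₑ ^ 2 = ‖f‖ₑ ^ 2 := fun t => by
          rw [lintegral_sub_right_eq_self (fun x => ‖extend f x‖ₑ ^ 2), lintegral_extend]
        simp only [this]
        rw [lintegral_mul_const _ hk.measurable.enorm, ← mul_assoc, pow_two (∫⁻ t, ‖k t‖ₑ)]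

theorem lintegral_enorm_lt_top {k : ℝ → ℝ} (hk : Continuous k) (hc : HasCompactSupport k) :
    ∫⁻ t, ‖k t‖ₑ < ⊤ := (hk.integrable_of_hasCompactSupport hc).2

theorem memLp_mollFun {k : ℝ → ℝ} (hk : ContDiff ℝ ∞ k) (hc : HasCompactSupport k) (f : L2 V) :
    MemLp (mollFun k f) 2 halfLine := by
  have hm : AEStronglyMeasurable (mollFun k f) volume :=
    (contDiff_mollFun hk hc f).continuous.aestronglyMeasurable
  have : MemLp (mollFun k f) 2 volume := by
    refine ⟨hm, ?_⟩
    rw [eLpNorm_lt_top_iff_lintegral_rpow_enorm_lt_top (by simp) (by simp)]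
    have e : (2 : ℝ≥0∞).toReal = (2 : ℕ) := by simp
    simp only [e, ENNReal.rpow_natCast]
    refine (lintegral_mollFun_le hk.continuous f).trans_lt (ENNReal.mul_lt_top ?_ ?_)
    · exact ENNReal.pow_lt_top (lintegral_enorm_lt_top hk.continuous hc)
    · exact ENNReal.pow_lt_top (by simp)
  exact this.restrict _

open scoped Classical in
/-- The mollification as an element of `L²(ℝ₊, V)`; the value `0` is used for kernels for which
the convolution is not square integrable. -/
def moll (k : ℝ → ℝ) (f : L2 V) : L2 V :=
  if h : MemLp (mollFun k f) 2 halfLine then h.toLp else 0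

theorem coeFn_moll {k : ℝ → ℝ} (hk : ContDiff ℝ ∞ k) (hc : HasCompactSupport k) (f : L2 V) :
    moll k f =ᵐ[halfLine] mollFun k f := by
  rw [moll, dif_pos (memLp_mollFun hk hc f)]
  exact MemLp.coeFn_toLp _

theorem hasCompactSupport_comp_sub {k : ℝ → ℝ} (hc : HasCompactSupport k) (x : ℝ) :
    HasCompactSupport fun t => k (x - t) :=
  hc.comp_homeomorph (Homeomorph.subLeft x)

theorem contDiff_comp_sub {k : ℝ → ℝ} (hk : ContDiff ℝ ∞ k) (x : ℝ) :
    ContDiff ℝ ∞ fun t => k (x - t) := hk.comp (contDiff_const.sub contDiff_id)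

theorem mollFun_sub {k : ℝ → ℝ} (hk : ContDiff ℝ ∞ k) (hc : HasCompactSupport k) (f g : L2 V)
    (x : ℝ) : mollFun k (f - g) x = mollFun k f x - mollFun k g x := by
  unfold mollFun
  have hk' := (contDiff_comp_sub hk x).continuous
  have hc' := hasCompactSupport_comp_sub hc x
  rw [← integral_sub (integrable_test f hk' hc') (integrable_test g hk' hc')]
  refine integral_congr_ae ?_
  filter_upwards [Lp.coeFn_sub f g] with t ht
  rw [ht, Pi.sub_apply, smul_sub]

theorem moll_sub {k : ℝ → ℝ} (hk : ContDiff ℝ ∞ k) (hc : HasCompactSupport k) (f g : L2 V) :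
    moll k (f - g) = moll k f - moll k g := by
  refine Lp.ext ?_
  filter_upwards [coeFn_moll hk hc (f - g), coeFn_moll hk hc f, coeFn_moll hk hc g,
    Lp.coeFn_sub (moll k f) (moll k g)] with x h1 h2 h3 h4
  rw [h1, h4, Pi.sub_apply, h2, h3, mollFun_sub hk hc]

theorem mollFun_pointwise {k : ℝ → ℝ} (hk : ContDiff ℝ ∞ k) (hc : HasCompactSupport k)
    (T : V →L[ℂ] W) (f : L2 V) (x : ℝ) : mollFun k (pointwise T f) x = T (mollFun k f x) :=
  integral_pointwise T f (contDiff_comp_sub hk x).continuous (hasCompactSupport_comp_sub hc x)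

theorem moll_pointwise {k : ℝ → ℝ} (hk : ContDiff ℝ ∞ k) (hc : HasCompactSupport k)
    (T : V →L[ℂ] W) (f : L2 V) : moll k (pointwise T f) = pointwise T (moll k f) := by
  refine Lp.ext ?_
  filter_upwards [coeFn_moll hk hc (pointwise T f), coeFn_moll hk hc f,
    coeFn_pointwise T (moll k f)] with x h1 h2 h3
  rw [h1, h3, h2, mollFun_pointwise hk hc]

theorem enorm_moll_sq_le {k : ℝ → ℝ} (hk : ContDiff ℝ ∞ k) (hc : HasCompactSupport k) (f : L2 V) :
    ‖moll k f‖ₑ ^ 2 ≤ (∫⁻ t, ‖k t‖ₑ) ^ 2 * ‖f‖ₑ ^ 2 := by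
  rw [enorm_sq_eq_lintegral]
  refine le_trans (le_trans (lintegral_mono_ae ?_) (setLIntegral_le_lintegral (Ioi 0) _))
    (lintegral_mollFun_le hk.continuous f)
  filter_upwards [coeFn_moll hk hc f] with x hx
  rw [hx]

/-- Differentiation commutes with a mollification that only uses values to the right. -/
theorem mollFun_iteratedDeriv {k : ℝ → ℝ} (hk : ContDiff ℝ ∞ k) (hc : HasCompactSupport k)
    (hs : tsupport k ⊆ Iio 0) {l : ℕ} {f g : L2 V} (h : IsWeakDeriv l f g) {x : ℝ} (hx : 0 ≤ x) :
    mollFun (iteratedDeriv l k) f x = mollFun k g x := by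
  have hη : tsupport (fun t => k (x - t)) ⊆ Ioi 0 := by
    have h1 : tsupport (fun t => k (x - t)) ⊆ (fun t => x - t) ⁻¹' tsupport k :=
      tsupport_comp_subset_preimage k (by fun_prop)
    intro t ht
    have : x - t < 0 := hs (h1 ht)
    rw [mem_Ioi]
    linarith
  have h2 := h _ (contDiff_comp_sub hk x) (hasCompactSupport_comp_sub hc x) hη
  have h3 : iteratedDeriv l (fun t => k (x - t)) =
      fun t => (-1 : ℝ) ^ l * iteratedDeriv l k (x - t) := by
    ext t
    rw [iteratedDeriv_comp_const_sub]
    rfl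
  rw [h3] at h2
  simp only [mul_smul] at h2
  rw [integral_smul] at h2
  exact smul_right_injective V (pow_ne_zero l (by norm_num : (-1 : ℝ) ≠ 0)) h2

theorem isWeakDeriv_moll_iteratedDeriv {k : ℝ → ℝ} (hk : ContDiff ℝ ∞ k) (hc : HasCompactSupport k)
    (l : ℕ) (f : L2 V) : IsWeakDeriv l (moll k f) (moll (iteratedDeriv l k) f) := by
  refine isWeakDeriv_of_contDiffOn (contDiff_mollFun hk hc f).contDiffOn (coeFn_moll hk hc f) ?_
  filter_upwards [coeFn_moll (contDiff_iteratedDeriv hk l) (hasCompactSupport_iteratedDeriv hc l) f,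
    ae_restrict_mem measurableSet_Ioi] with x h1 h2
  rw [h1, hderiv_mollFun hk hc f l (le_of_lt h2)]

/-- On the half line, mollification to the right commutes with weak derivatives. -/
theorem isWeakDeriv_moll {k : ℝ → ℝ} (hk : ContDiff ℝ ∞ k) (hc : HasCompactSupport k)
    (hs : tsupport k ⊆ Iio 0) {l : ℕ} {f g : L2 V} (h : IsWeakDeriv l f g) :
    IsWeakDeriv l (moll k f) (moll k g) := by
  have e : moll (iteratedDeriv l k) f = moll k g := by
    refine Lp.ext ?_
    filter_upwards [coeFn_moll (contDiff_iteratedDeriv hk l)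
      (hasCompactSupport_iteratedDeriv hc l) f, coeFn_moll hk hc g,
      ae_restrict_mem measurableSet_Ioi] with x h1 h2 h3
    rw [h1, h2, mollFun_iteratedDeriv hk hc hs h (le_of_lt h3)]
  rw [← e]
  exact isWeakDeriv_moll_iteratedDeriv hk hc l f

/-- Continuity of translations in `L²(ℝ, V)`. -/
theorem tendsto_translation (f : L2 V) :
    Tendsto (fun t : ℝ => ∫⁻ x, ‖extend f x - extend f (x - t)‖ₑ ^ 2) (𝓝 0) (𝓝 0) := by
  set F : Lp V 2 (volume : Measure ℝ) := (memLp_extend f).toLp _ with hF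
  let g : C(ℝ, C(ℝ, ℝ)) := ContinuousMap.curry ⟨fun p : ℝ × ℝ => p.2 - p.1, by fun_prop⟩
  have hg : ∀ t, MeasurePreserving (g t) (volume : Measure ℝ) volume := fun t =>
    measurePreserving_sub_right volume t
  have h1 : Continuous fun t => Lp.compMeasurePreserving (g t) (hg t) F :=
    Continuous.compMeasurePreservingLp continuous_const g.continuous hg (by simp)
  have h2 : ∀ t, ∫⁻ x, ‖extend f x - extend f (x - t)‖ₑ ^ 2 =
      ‖F - Lp.compMeasurePreserving (g t) (hg t) F‖ₑ ^ 2 := by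
    intro t
    have e : F - Lp.compMeasurePreserving (g t) (hg t) F =
        ((memLp_extend f).sub ((memLp_extend f).comp_measurePreserving (hg t))).toLp _ := rfl
    rw [e, Lp.enorm_toLp]
    have h := eLpNorm_nnreal_pow_eq_lintegral (p := 2)
      (f := extend f - extend f ∘ g t) (μ := (volume : Measure ℝ)) (by norm_num)
    have e : ((2 : ℝ≥0) : ℝ) = (2 : ℕ) := by norm_num
    simp only [e, ENNReal.rpow_natCast] at h
    exact h.symm
  have h3 : Lp.compMeasurePreserving (g 0) (hg 0) F = F := by
    have e : (extend f) ∘ (g 0) = extend f := by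
      ext x
      simp [g]
    refine Lp.ext ?_
    filter_upwards [Lp.coeFn_compMeasurePreserving F (hg 0)] with x hx
    rw [hx]
    simp [g]
  simp only [h2]
  have h4 : Continuous fun t => ‖F - Lp.compMeasurePreserving (g t) (hg t) F‖ₑ ^ 2 := by
    fun_prop
  have h5 := h4.tendsto 0
  rw [h3] at h5
  simpa using h5

/-- A bump function supported in `(-2/(k+1), 0)`. Mollification at `x` then only uses values to the
right of `x`, and so stays on the half line. -/
def bump (k : ℕ) : ContDiffBump (-(1 / (k + 1)) : ℝ) where
  rIn := 1 / (4 * (k + 1))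
  rOut := 1 / (2 * (k + 1))
  rIn_pos := by positivity
  rIn_lt_rOut := by
    gcongr
    norm_num

/-- The mollifying kernels, of integral `1`. -/
def kern (k : ℕ) : ℝ → ℝ := (bump k).normed volume

theorem contDiff_kern (k : ℕ) : ContDiff ℝ ∞ (kern k) := (bump k).contDiff_normed

theorem hasCompactSupport_kern (k : ℕ) : HasCompactSupport (kern k) :=
  (bump k).hasCompactSupport_normed

theorem tsupport_kern (k : ℕ) : tsupport (kern k) ⊆ Ioo (-(2 / (k + 1))) 0 := by
  rw [kern, ContDiffBump.tsupport_normed_eq]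
  intro x hx
  rw [Metric.mem_closedBall, Real.dist_eq, abs_le] at hx
  have h1 : (bump k).rOut = 1 / (k + 1) / 2 := by
    simp only [bump]
    field_simp
  have h2 : (2 / (k + 1) : ℝ) = 2 * (1 / (k + 1)) := by ring
  have h3 : (0 : ℝ) < 1 / (k + 1) := by positivity
  rw [h1] at hx
  rw [mem_Ioo, h2]
  constructor <;> linarith [hx.1, hx.2]

theorem tsupport_kern_subset (k : ℕ) : tsupport (kern k) ⊆ Iio 0 :=
  (tsupport_kern k).trans fun _ h => h.2

theorem lintegral_kern (k : ℕ) : ∫⁻ t, ‖kern k t‖ₑ = 1 := by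
  have h := (bump k).integral_normed (μ := volume)
  have h0 : ∀ t, 0 ≤ kern k t := (bump k).nonneg_normed
  rw [← ofReal_integral_norm_eq_lintegral_enorm
    ((contDiff_kern k).continuous.integrable_of_hasCompactSupport (hasCompactSupport_kern k))]
  simp only [Real.norm_of_nonneg (h0 _)]
  rw [kern, h, ENNReal.ofReal_one]

theorem enorm_moll_kern_sq_le (k : ℕ) (f : L2 V) : ‖moll (kern k) f‖ₑ ^ 2 ≤ ‖f‖ₑ ^ 2 := by
  have := enorm_moll_sq_le (contDiff_kern k) (hasCompactSupport_kern k) f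
  rwa [lintegral_kern, one_pow, one_mul] at this

theorem extend_sub_mollFun (k : ℕ) (f : L2 V) (x : ℝ) :
    extend f x - mollFun (kern k) f x = ∫ t, kern k t • (extend f x - extend f (x - t)) := by
  have hc := hasCompactSupport_kern k
  have h1 : Integrable (fun t => kern k t • extend f x) volume :=
    ((contDiff_kern k).continuous.integrable_of_hasCompactSupport hc).smul_const _
  have h2 : Integrable (fun t => kern k t • extend f (x - t)) volume :=
    hc.convolutionExists_left (ContinuousLinearMap.lsmul ℝ ℝ) (contDiff_kern k).continuous
      (locallyIntegrable_extend f) x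
  simp only [smul_sub]
  rw [integral_sub h1 h2, mollFun_eq, kern, ContDiffBump.integral_normed_smul]

theorem tendsto_moll_kern (f : L2 V) :
    Tendsto (fun k => ‖f - moll (kern k) f‖ₑ ^ 2) atTop (𝓝 0) := by
  rw [ENNReal.tendsto_nhds_zero]
  intro ε hε
  obtain ⟨δ, hδ, h⟩ := Metric.eventually_nhds_iff.1
    ((ENNReal.tendsto_nhds_zero.1 (tendsto_translation f)) ε hε)
  obtain ⟨n, hn⟩ := exists_nat_gt (2 / δ)
  filter_upwards [eventually_ge_atTop n] with k hk
  have hkδ : 2 / ((k : ℝ) + 1) < δ := by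
    have : (n : ℝ) ≤ k := by exact_mod_cast hk
    rw [div_lt_comm₀ (by positivity) hδ]
    linarith
  have hG : Measurable (Function.uncurry fun x t => ‖extend f x - extend f (x - t)‖ₑ) :=
    (((stronglyMeasurable_extend f).comp_measurable measurable_fst).sub
      (measurable_extend_sub f)).enorm
  calc ‖f - moll (kern k) f‖ₑ ^ 2
      ≤ ∫⁻ x in Ioi 0, ‖extend f x - mollFun (kern k) f x‖ₑ ^ 2 := by
        rw [enorm_sq_eq_lintegral]
        refine lintegral_mono_ae ?_
        filter_upwards [coeFn_moll (contDiff_kern k) (hasCompactSupport_kern k) f,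
          Lp.coeFn_sub f (moll (kern k) f), ae_restrict_mem measurableSet_Ioi] with x h1 h2 h3
        rw [h2, Pi.sub_apply, h1, extend, indicator_of_mem h3]
    _ ≤ ∫⁻ x, ‖extend f x - mollFun (kern k) f x‖ₑ ^ 2 := setLIntegral_le_lintegral _ _
    _ ≤ ∫⁻ x, (∫⁻ t, ‖kern k t‖ₑ * ‖extend f x - extend f (x - t)‖ₑ) ^ 2 := by
        refine lintegral_mono fun x => ?_
        gcongr
        rw [extend_sub_mollFun]
        refine (enorm_integral_le_lintegral_enorm _).trans_eq ?_
        simp only [enorm_smul]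
    _ ≤ (∫⁻ t, ‖kern k t‖ₑ) * ∫⁻ t, ‖kern k t‖ₑ * ∫⁻ x, ‖extend f x - extend f (x - t)‖ₑ ^ 2 :=
        lintegral_sq_lintegral_le (contDiff_kern k).continuous hG
    _ ≤ (∫⁻ t, ‖kern k t‖ₑ) * ∫⁻ t, ‖kern k t‖ₑ * ε := by
        gcongr (∫⁻ t, ‖kern k t‖ₑ) * ?_
        refine lintegral_mono fun t => ?_
        by_cases ht : t ∈ tsupport (kern k)
        · refine mul_le_mul_right (h ?_) _
          have := tsupport_kern k ht
          rw [Real.dist_eq, sub_zero, abs_lt]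
          constructor <;> linarith [this.1, this.2]
        · rw [image_eq_zero_of_notMem_tsupport ht]
          simp
    _ = ε := by
        rw [lintegral_mul_const _ (contDiff_kern k).continuous.measurable.enorm, lintegral_kern]
        simp

end Mollify

/-! ### Smooth approximation in `ℋ_n` -/

section Approx

open Filter Topology

variable {H : Type*} [NormedAddCommGroup H] [InnerProductSpace ℂ H] [CompleteSpace H]

theorem norm_sq_sub_tendsto_pointwise {V : Type*} [NormedAddCommGroup V] [InnerProductSpace ℂ V]
    {T : ℕ → V →L[ℂ] V} (hT : ∀ k x, ‖T k x‖ ≤ ‖x‖)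
    (hlim : ∀ x, Tendsto (fun k => T k x) atTop (𝓝 x)) (y : L2 V) :
    Tendsto (fun k => ‖y - pointwise (T k) y‖ₑ ^ 2) atTop (𝓝 0) := by
  have e : ∀ k, ‖y - pointwise (T k) y‖ₑ ^ 2 = ∫⁻ x in Ioi 0, ‖y x - T k (y x)‖ₑ ^ 2 := by
    intro k
    rw [enorm_sq_eq_lintegral]
    refine lintegral_congr_ae ?_
    filter_upwards [Lp.coeFn_sub y (pointwise (T k) y), coeFn_pointwise (T k) y] with x h1 h2
    rw [h1, Pi.sub_apply, h2]
  simp only [e]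
  have h0 : (0 : ℝ≥0∞) = ∫⁻ x in Ioi (0 : ℝ), 0 := by simp
  rw [h0]
  have hy := (Lp.stronglyMeasurable y)
  refine tendsto_lintegral_of_dominated_convergence (fun x => 4 * ‖y x‖ₑ ^ 2) (fun k => ?_)
    (fun k => Eventually.of_forall fun x => ?_) ?_ (Eventually.of_forall fun x => ?_)
  · exact ((hy.sub ((T k).continuous.comp_stronglyMeasurable hy)).enorm).pow_const 2
  · refine enorm_sq_le_of_norm_sq_le (c := 4) ?_
    have := norm_sub_le (y x) (T k (y x))
    have h2 := hT k (y x)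
    push_cast
    nlinarith [norm_nonneg (y x - T k (y x)), norm_nonneg (y x)]
  · rw [lintegral_const_mul' _ _ (by simp), ← enorm_sq_eq_lintegral]
    exact (ENNReal.mul_lt_top (by simp) (ENNReal.pow_lt_top (by simp))).ne
  · have h1 : Tendsto (fun k => y x - T k (y x)) atTop (𝓝 0) := by
      simpa using (tendsto_const_nhds (x := y x)).sub (hlim (y x))
    have h2 := ((ENNReal.continuous_pow 2).tendsto _).comp h1.enorm
    simpa [Function.comp_def] using h2

/-- The approximation of `f` that is smooth in both variables: a mollification in `ℝ₊` and a
spectral cut-off of `A`. -/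
def approx (A : H →ₗ.[ℂ] H) (k : ℕ) (f : L2 H) : L2 H :=
  pointwise (specCut (invOneAddSq A) k) (moll (kern k) f)

variable {A : H →ₗ.[ℂ] H}

theorem approx_sub (A : H →ₗ.[ℂ] H) (k : ℕ) (f g : L2 H) :
    approx A k (f - g) = approx A k f - approx A k g := by
  rw [approx, moll_sub (contDiff_kern k) (hasCompactSupport_kern k), map_sub]
  rfl

theorem specCut_powL2 (hA : IsSelfAdjoint A) (k : ℕ) {s : ℝ} (hs : 0 ≤ s) (y : L2 H) :
    pointwise (specCut (invOneAddSq A) k) (powL2 A s y) =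
      powL2 A s (pointwise (specCut (invOneAddSq A) k) y) := by
  rw [← pointwise_comp _ _ (halfPow (invOneAddSq A) s ∘L specCut (invOneAddSq A) k)
    (fun x => ((isResolvent_invOneAddSq hA).specCut_halfPow k hs x).symm),
    ← pointwise_comp _ _ (halfPow (invOneAddSq A) s ∘L specCut (invOneAddSq A) k) (fun x => rfl)]

theorem approx_powL2 (hA : IsSelfAdjoint A) (k : ℕ) {s : ℝ} (hs : 0 ≤ s) (y : L2 H) :
    approx A k (powL2 A s y) = powL2 A s (approx A k y) := by
  rw [approx, moll_pointwise (contDiff_kern k) (hasCompactSupport_kern k), specCut_powL2 hA k hs]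
  rfl

theorem isWeakDeriv_approx {l k : ℕ} {f g : L2 H} (h : IsWeakDeriv l f g) :
    IsWeakDeriv l (approx A k f) (approx A k g) :=
  (isWeakDeriv_moll (contDiff_kern k) (hasCompactSupport_kern k) (tsupport_kern_subset k)
    h).pointwise _

theorem enorm_approx_sq_le (hA : IsSelfAdjoint A) (k : ℕ) (y : L2 H) :
    ‖approx A k y‖ₑ ^ 2 ≤ ‖y‖ₑ ^ 2 :=
  (enorm_sq_le_of_norm_le (norm_pointwise_le _
    ((isResolvent_invOneAddSq hA).norm_specCut_le k) _)).trans (enorm_moll_kern_sq_le k y)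

theorem tendsto_approx (hA : IsSelfAdjoint A) (y : L2 H) :
    Tendsto (fun k => ‖y - approx A k y‖ₑ ^ 2) atTop (𝓝 0) := by
  have hR := isResolvent_invOneAddSq hA
  have h1 := norm_sq_sub_tendsto_pointwise (T := specCut (invOneAddSq A)) hR.norm_specCut_le
    hR.tendsto_specCut y
  have h2 := tendsto_moll_kern y
  have h3 := ENNReal.Tendsto.const_mul (a := 2) (h1.add h2) (Or.inr (by simp))
  rw [add_zero, mul_zero] at h3
  refine tendsto_of_tendsto_of_tendsto_of_le_of_le tendsto_const_nhds h3 (fun _ => bot_le)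
    fun k => ?_
  have e : y - approx A k y = (y - pointwise (specCut (invOneAddSq A) k) y) +
      pointwise (specCut (invOneAddSq A) k) (y - moll (kern k) y) := by
    rw [map_sub, approx]
    abel
  simp only [e]
  refine (isQuasiSq_enorm.add_le _ _).trans ?_
  gcongr 2 * (_ + ?_)
  exact enorm_sq_le_of_norm_le (norm_pointwise_le _ (hR.norm_specCut_le k) _)

theorem derivNormSq_approx_le (hA : IsSelfAdjoint A) (k l j : ℕ) (f : L2 H) :
    derivNormSq A l j (approx A k f) ≤ 2 * 2 ^ j * derivNormSq A l j f := by
  refine le_derivNormSq hA (by simp) (by simp) fun y hy => ?_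
  have h := isWeakDeriv_approx (A := A) (k := k) hy
  rw [approx_powL2 hA k j.cast_nonneg] at h
  refine (derivNormSq_le hA h).trans ?_
  gcongr 2 * ?_
  exact enorm_approx_sq_le hA k y

theorem tendsto_derivNormSq_approx (hA : IsSelfAdjoint A) {l j : ℕ} {f : L2 H}
    (hf : derivNormSq A l j f < ⊤) :
    Tendsto (fun k => derivNormSq A l j (f - approx A k f)) atTop (𝓝 0) := by
  obtain ⟨y, hy⟩ := exists_of_derivNormSq_lt_top hA hf
  have h3 := ENNReal.Tendsto.const_mul (a := 2) (tendsto_approx hA y) (Or.inr (by simp))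
  rw [mul_zero] at h3
  refine tendsto_of_tendsto_of_tendsto_of_le_of_le tendsto_const_nhds h3 (fun _ => bot_le)
    fun k => derivNormSq_le hA ?_
  rw [map_sub, ← approx_powL2 hA k j.cast_nonneg]
  exact hy.sub (isWeakDeriv_approx hy)

theorem intNormSq_approx_le (hA : IsSelfAdjoint A) (k n : ℕ) (f : L2 H) :
    intNormSq A n (approx A k f) ≤ 2 * 2 ^ n * intNormSq A n f := by
  unfold intNormSq
  simp only [Finset.mul_sum]
  refine Finset.sum_le_sum fun i _ => Finset.sum_le_sum fun l _ => ?_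
  refine (derivNormSq_approx_le hA k l (n - i) f).trans ?_
  gcongr
  · norm_num
  · omega

theorem tendsto_intNormSq {n : ℕ} {f : ℕ → L2 H}
    (h : ∀ l j, l + j ≤ n → Tendsto (fun k => derivNormSq A l j (f k)) atTop (𝓝 0)) :
    Tendsto (fun k => intNormSq A n (f k)) atTop (𝓝 0) := by
  unfold intNormSq
  have := tendsto_finsetSum (Finset.range (n + 1)) fun i hi =>
    tendsto_finsetSum (Finset.range (i + 1)) fun l hl => h l (n - i) (by
      simp only [Finset.mem_range] at hi hl
      omega)
  simpa using this

theorem tendsto_intNormSq_approx (hA : IsSelfAdjoint A) {n : ℕ} {f : L2 H}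
    (hf : intNormSq A n f < ⊤) :
    Tendsto (fun k => intNormSq A n (f - approx A k f)) atTop (𝓝 0) :=
  tendsto_intNormSq fun _ _ h =>
    tendsto_derivNormSq_approx hA ((derivNormSq_le_intNormSq h f).trans_lt hf)

theorem specCut_eq_powL2 (hA : IsSelfAdjoint A) (k : ℕ) {s : ℝ} (hs : 0 ≤ s) (y : L2 H) :
    pointwise (specCut (invOneAddSq A) k) y =
      powL2 A s (pointwise (specCutDiv (invOneAddSq A) k s) y) :=
  pointwise_comp _ _ _ (fun x => ((isResolvent_invOneAddSq hA).halfPow_specCutDiv k hs x).symm) y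

/-! ### Cutting off at infinity -/

theorem exists_bound_iteratedDeriv_smoothTransition (i : ℕ) :
    ∃ C : ℝ≥0, ∀ x, ‖iteratedDeriv i Real.smoothTransition x‖ₑ ≤ C := by
  have hs : ContDiff ℝ ∞ Real.smoothTransition := Real.smoothTransition.contDiff
  have hcont : Continuous (iteratedDeriv i Real.smoothTransition) :=
    hs.continuous_iteratedDeriv i (by exact_mod_cast le_top)
  obtain ⟨C, hC⟩ := (isCompact_Icc (a := (0 : ℝ)) (b := 1)).exists_bound_of_continuousOn
    hcont.continuousOn
  have hle : ∀ (c x : ℝ), |c| ≤ 1 → Real.smoothTransition =ᶠ[𝓝 x] (fun _ => c) →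
      ‖iteratedDeriv i Real.smoothTransition x‖ ≤ 1 := by
    intro c x hc h
    rw [h.iteratedDeriv_eq, iteratedDeriv_const]
    split_ifs
    · exact hc
    · simp
  refine ⟨Real.toNNReal (max C 1), fun x => ?_⟩
  have hx : ‖iteratedDeriv i Real.smoothTransition x‖ ≤ max C 1 := by
    rcases lt_or_ge x 0 with h0 | h0
    · refine (hle 0 x (by simp) ?_).trans (le_max_right _ _)
      filter_upwards [Iio_mem_nhds h0] with y hy
      exact Real.smoothTransition.zero_of_nonpos (le_of_lt hy)
    rcases lt_or_ge 1 x with h1 | h1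
    · refine (hle 1 x (by simp) ?_).trans (le_max_right _ _)
      filter_upwards [Ioi_mem_nhds h1] with y hy
      exact Real.smoothTransition.one_of_one_le (le_of_lt hy)
    · exact (hC x ⟨h0, h1⟩).trans (le_max_left _ _)
  rw [← ofReal_norm]
  exact ENNReal.ofReal_le_ofReal hx

/-- The cut-off at infinity: it equals `0` on `[0, N]` and `1` on `[N + 1, ∞)`. -/
def tailCut (N : ℕ) (x : ℝ) : ℝ := Real.smoothTransition (x - N)

theorem contDiff_tailCut (N : ℕ) : ContDiff ℝ ∞ (tailCut N) :=
  Real.smoothTransition.contDiff.comp (contDiff_id.sub contDiff_const)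

theorem isHalfSmooth_tailCut (N : ℕ) {ψ : ℝ → H} (h : ContDiffOn ℝ ∞ ψ (Ici 0)) :
    IsHalfSmooth (fun x => ψ x - tailCut N x • ψ x) := by
  refine ⟨h.sub ((contDiff_tailCut N).contDiffOn.smul h), N + 1, fun x hx => ?_⟩
  rw [tailCut, Real.smoothTransition.one_of_one_le (by linarith), one_smul, sub_self]

theorem hderiv_tailCut_smul (N l : ℕ) {ψ : ℝ → H} (h : ContDiffOn ℝ ∞ ψ (Ici 0)) {x : ℝ}
    (hx : 0 ≤ x) : hderiv l (fun x => tailCut N x • ψ x) x = ∑ i ∈ Finset.range (l + 1),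
      l.choose i • iteratedDeriv i Real.smoothTransition (x - N) • hderiv (l - i) ψ x := by
  have h1 := iteratedDerivWithin_smul (n := l) (s := Ici 0) hx (uniqueDiffOn_Ici 0)
    (((contDiff_tailCut N).contDiffOn.of_le (by exact_mod_cast le_top)) x hx)
    ((h.of_le (by exact_mod_cast le_top)) x hx)
  refine Eq.trans h1 (Finset.sum_congr rfl fun i _ => ?_)
  congr 2
  rw [iteratedDerivWithin_eq_iteratedDeriv (uniqueDiffOn_Ici 0)
    ((contDiff_tailCut N).of_le (by exact_mod_cast le_top)).contDiffAt hx]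
  unfold tailCut
  rw [iteratedDeriv_comp_sub_const]

theorem hderiv_tailCut_smul_eq_zero {N l : ℕ} {ψ : ℝ → H} {x : ℝ} (hN : x < N) :
    hderiv l (fun x => tailCut N x • ψ x) x = 0 := by
  have h : (fun x => tailCut N x • ψ x) =ᶠ[𝓝 x] fun _ => 0 := by
    filter_upwards [Iio_mem_nhds hN] with y hy
    rw [tailCut, Real.smoothTransition.zero_of_nonpos (by linarith [mem_Iio.1 hy]), zero_smul]
  have h2 := (h.filter_mono (nhdsWithin_le_nhds (s := Ici 0))).iteratedDerivWithin_eq (n := l)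
    h.self_of_nhds
  refine h2.trans ?_
  simp

theorem lintegral_lt_top_of_memLp {V : Type*} [NormedAddCommGroup V] {g : ℝ → V}
    (h : MemLp g 2 halfLine) : ∫⁻ x in Ioi 0, ‖g x‖ₑ ^ 2 < ⊤ := by
  have h1 := eLpNorm_nnreal_pow_eq_lintegral (p := 2) (f := g) (μ := halfLine) (by norm_num)
  have e : ((2 : ℝ≥0) : ℝ) = (2 : ℕ) := by norm_num
  simp only [e, ENNReal.rpow_natCast] at h1
  rw [← h1]
  exact ENNReal.pow_lt_top h.2

/-- If all derivatives of `ψ` are square integrable, cutting off at infinity converges in every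
derivative. -/
theorem tendsto_lintegral_hderiv_tailCut {ψ : ℝ → H} (h : ContDiffOn ℝ ∞ ψ (Ici 0))
    (hL : ∀ i, MemLp (hderiv i ψ) 2 halfLine) (l : ℕ) :
    Tendsto (fun N : ℕ => ∫⁻ x in Ioi 0, ‖hderiv l (fun x => tailCut N x • ψ x) x‖ₑ ^ 2)
      atTop (𝓝 0) := by
  choose C hC using exists_bound_iteratedDeriv_smoothTransition
  have h0 : (0 : ℝ≥0∞) = ∫⁻ x in Ioi (0 : ℝ), 0 := by simp
  rw [h0]
  set B : ℝ → ℝ := fun x => ∑ i ∈ Finset.range (l + 1), (l.choose i * C i) * ‖hderiv (l - i) ψ x‖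
  have hB : MemLp B 2 halfLine := memLp_finsetSum _ fun i _ => (hL (l - i)).norm.const_mul _
  refine tendsto_lintegral_of_dominated_convergence' (fun x => ‖B x‖ₑ ^ 2) (fun N => ?_)
    (fun N => ?_) (lintegral_lt_top_of_memLp hB).ne ?_
  · refine (AEStronglyMeasurable.enorm ?_).pow_const 2
    exact aestronglyMeasurable_of_continuousOn
      (contDiffOn_hderiv ((contDiff_tailCut N).contDiffOn.smul h) l).continuousOn
  · filter_upwards [ae_restrict_mem measurableSet_Ioi] with x hx
    refine enorm_sq_le_of_norm_le ?_
    rw [hderiv_tailCut_smul N l h (le_of_lt hx)]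
    refine le_trans ?_ (le_abs_self _)
    refine norm_sum_le_of_le _ fun i _ => ?_
    rw [← Nat.cast_smul_eq_nsmul ℝ, norm_smul, norm_smul, ← mul_assoc, Real.norm_natCast]
    gcongr
    have := hC i (x - N)
    rw [enorm_eq_nnnorm] at this
    exact_mod_cast this
  · refine Eventually.of_forall fun x => ?_
    refine tendsto_const_nhds.congr' ?_
    obtain ⟨n, hn⟩ := exists_nat_gt x
    filter_upwards [eventually_ge_atTop n] with N hN
    rw [hderiv_tailCut_smul_eq_zero (hn.trans_le (by exact_mod_cast hN))]
    simp

theorem exists_smooth_near_approx (hA : IsSelfAdjoint A) (k n : ℕ) (f : L2 H) {ε : ℝ≥0∞}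
    (hε : 0 < ε) : ∃ u : L2 H, (∃ φ : ℝ → H, IsSmoothCompact A φ ∧ u =ᵐ[halfLine] φ) ∧
      intNormSq A n (approx A k f - u) < ε := by
  have hk := contDiff_kern k
  have hc := hasCompactSupport_kern k
  set ψ : ℝ → H := mollFun (kern k) f
  have hψ : ContDiffOn ℝ ∞ ψ (Ici 0) := (contDiff_mollFun hk hc f).contDiffOn
  have hd : ∀ i, hderiv i ψ =ᵐ[halfLine] mollFun (iteratedDeriv i (kern k)) f := by
    intro i
    filter_upwards [ae_restrict_mem measurableSet_Ioi] with x hx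
    exact hderiv_mollFun hk hc f i (le_of_lt hx)
  have hL : ∀ i, MemLp (hderiv i ψ) 2 halfLine := fun i =>
    (memLp_mollFun (contDiff_iteratedDeriv hk i) (hasCompactSupport_iteratedDeriv hc i) f).ae_eq
      (hd i).symm
  have hs := fun N => isHalfSmooth_tailCut N hψ
  set S := specCut (invOneAddSq A) k
  set u : ℕ → L2 H := fun N => pointwise S (hs N).toL2 with hu
  have hlim : Tendsto (fun N => intNormSq A n (approx A k f - u N)) atTop (𝓝 0) := by
    refine tendsto_intNormSq fun l j _ => ?_
    set G : ℕ → L2 H := fun N => moll (iteratedDeriv l (kern k)) f - ((hs N).hderiv l).toL2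
    have hG : Tendsto (fun N => ‖G N‖ₑ ^ 2) atTop (𝓝 0) := by
      refine (tendsto_lintegral_hderiv_tailCut hψ hL l).congr fun N => ?_
      rw [enorm_sq_eq_lintegral]
      refine lintegral_congr_ae ?_
      filter_upwards [Lp.coeFn_sub (moll (iteratedDeriv l (kern k)) f) ((hs N).hderiv l).toL2,
        coeFn_moll (contDiff_iteratedDeriv hk l) (hasCompactSupport_iteratedDeriv hc l) f,
        ((hs N).hderiv l).coeFn_toL2, hd l, ae_restrict_mem measurableSet_Ioi] with x h1 h2 h3 h4 h5
      have hx : x ∈ Ici (0 : ℝ) := mem_Ici.2 (le_of_lt h5)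
      have e : hderiv l (fun x => ψ x - tailCut N x • ψ x) x =
          hderiv l ψ x - hderiv l (fun x => tailCut N x • ψ x) x :=
        iteratedDerivWithin_sub (n := l) hx (uniqueDiffOn_Ici 0)
        ((hψ.of_le (by exact_mod_cast le_top)) x hx)
        ((((contDiff_tailCut N).contDiffOn.smul hψ).of_le (by exact_mod_cast le_top)) x hx)
      rw [h1, Pi.sub_apply, h2, h3, ← h4, e, sub_sub_cancel]
    have hw : ∀ N, IsWeakDeriv l (approx A k f - u N)
        (powL2 A j (pointwise (specCutDiv (invOneAddSq A) k j) (G N))) := by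
      intro N
      rw [← specCut_eq_powL2 hA k j.cast_nonneg, hu, approx, ← map_sub]
      refine IsWeakDeriv.pointwise ?_ S
      exact (isWeakDeriv_moll_iteratedDeriv hk hc l f).sub
        (isWeakDeriv_of_contDiffOn (hs N).smooth (hs N).coeFn_toL2 ((hs N).hderiv l).coeFn_toL2)
    set T := (pointwise (specCutDiv (invOneAddSq A) k j) : L2 H →L[ℂ] L2 H)
    have h2 := ENNReal.Tendsto.const_mul (a := 2 * ‖T‖ₑ ^ 2) hG
      (Or.inr (ENNReal.mul_ne_top (by simp) (ENNReal.pow_lt_top (by simp)).ne))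
    rw [mul_zero] at h2
    refine tendsto_of_tendsto_of_tendsto_of_le_of_le tendsto_const_nhds h2 (fun _ => bot_le)
      fun N => (derivNormSq_le hA (hw N)).trans ?_
    rw [mul_assoc, ← mul_pow]
    gcongr
    exact T.le_opENorm _
  obtain ⟨N, hN⟩ := ((tendsto_order.1 hlim).2 ε hε).exists
  refine ⟨u N, ⟨_, isSmoothCompact_specCut hA (hs N) k, ?_⟩, hN⟩
  filter_upwards [coeFn_pointwise S (hs N).toL2, (hs N).coeFn_toL2] with x h1 h2
  rw [h1, h2]

/-- `C₀^∞(ℝ₊, H_∞)` is dense in `ℋ_n`. -/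
theorem exists_smooth_near_int (hA : IsSelfAdjoint A) {n : ℕ} {f : L2 H}
    (hf : intNormSq A n f < ⊤) {ε : ℝ≥0∞} (hε : 0 < ε) :
    ∃ u : L2 H, (∃ φ : ℝ → H, IsSmoothCompact A φ ∧ u =ᵐ[halfLine] φ) ∧
      intNormSq A n (f - u) < ε := by
  have h4 : 0 < ε / 4 := ENNReal.div_pos hε.ne' (by simp)
  rcases eq_or_ne ε ⊤ with rfl | hε'
  · obtain ⟨k, hk⟩ := ((tendsto_order.1 (tendsto_intNormSq_approx hA hf)).2 1 one_pos).exists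
    obtain ⟨u, hu, hu'⟩ := exists_smooth_near_approx hA k n f one_pos
    refine ⟨u, hu, ?_⟩
    rw [← sub_add_sub_cancel f (approx A k f) u]
    exact ((isQuasiSq_int A n).add_le _ _).trans_lt
      (ENNReal.mul_lt_top (by simp)
        (ENNReal.add_lt_top.2 ⟨hk.trans (by simp), hu'.trans (by simp)⟩))
  obtain ⟨k, hk⟩ := ((tendsto_order.1 (tendsto_intNormSq_approx hA hf)).2 _ h4).exists
  obtain ⟨u, hu, hu'⟩ := exists_smooth_near_approx hA k n f h4
  refine ⟨u, hu, ?_⟩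
  rw [← sub_add_sub_cancel f (approx A k f) u]
  refine ((isQuasiSq_int A n).add_le _ _).trans_lt ?_
  calc 2 * (intNormSq A n (f - approx A k f) + intNormSq A n (approx A k f - u))
      < 2 * (ε / 4 + ε / 4) :=
        (ENNReal.mul_lt_mul_iff_right (by simp) (by simp)).2 (ENNReal.add_lt_add hk hu')
    _ = ε := by
        rw [← two_mul, ← mul_assoc, show (2 * 2 : ℝ≥0∞) = 4 by norm_num]
        exact ENNReal.mul_div_cancel (by simp) (by simp)

end Approx

/-! ### Density in the interpolation spaces -/

section Interp

open Filter Topology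

variable {E : Type*} [AddCommGroup E] [Module ℂ E] {N₀ N₁ : E → ℝ≥0∞}

theorem aemeasurable_interp (N₀ N₁ : E → ℝ≥0∞) (θ : ℝ) (f : E) :
    AEMeasurable (fun t : ℝ => ENNReal.ofReal (t ^ (-2 * θ - 1)) *
      ⨅ f₁ : E, (N₀ (f - f₁) + ENNReal.ofReal (t ^ 2) * N₁ f₁))
      (volume.restrict (Ioi (0 : ℝ))) := by
  refine AEMeasurable.mul (by fun_prop) ?_
  refine aemeasurable_restrict_of_monotoneOn measurableSet_Ioi ?_
  intro a ha b _ hab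
  have ha' : (0 : ℝ) ≤ a := le_of_lt ha
  refine iInf_mono fun f₁ => ?_
  gcongr

theorem lintegral_interp_weight_lt_top {θ : ℝ} (h0 : 0 < θ) (h1 : θ < 1) :
    ∫⁻ t in Ioi (0 : ℝ),
      ENNReal.ofReal (t ^ (-2 * θ - 1)) * min 1 (ENNReal.ofReal (t ^ 2)) < ⊤ := by
  rw [← Ioc_union_Ioi_eq_Ioi zero_le_one, lintegral_union measurableSet_Ioi
    (Set.disjoint_left.2 fun x hx hx' => not_lt_of_ge hx.2 hx')]
  refine ENNReal.add_lt_top.2 ⟨?_, ?_⟩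
  · have hi : IntegrableOn (fun t : ℝ => t ^ (1 - 2 * θ)) (Ioc 0 1) := by
      rw [← intervalIntegrable_iff_integrableOn_Ioc_of_le zero_le_one]
      exact intervalIntegral.intervalIntegrable_rpow' (by linarith)
    refine lt_of_le_of_lt (setLIntegral_mono' measurableSet_Ioc fun t ht => ?_) hi.2
    rw [Real.enorm_of_nonneg (Real.rpow_nonneg ht.1.le _)]
    refine (mul_le_mul_right (min_le_right _ _) _).trans_eq ?_
    rw [← ENNReal.ofReal_mul (Real.rpow_nonneg ht.1.le _), ← Real.rpow_natCast t 2,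
      ← Real.rpow_add ht.1]
    congr 2
    push_cast
    ring
  · have hi : IntegrableOn (fun t : ℝ => t ^ (-2 * θ - 1)) (Ioi 1) :=
      integrableOn_Ioi_rpow_of_lt (by linarith) one_pos
    refine lt_of_le_of_lt (setLIntegral_mono' measurableSet_Ioi fun t ht => ?_) hi.2
    rw [Real.enorm_of_nonneg (Real.rpow_nonneg (zero_le_one.trans (le_of_lt ht)) _)]
    exact (mul_le_mul_right (min_le_left _ _) _).trans_eq (mul_one _)

/-- `X₁` embeds continuously into `[X₀, X₁]_θ` if it embeds continuously into `X₀`. -/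
theorem interpNormSq_le (h0 : IsQuasiSq N₀) (h1 : IsQuasiSq N₁) {c : ℝ≥0∞}
    (h : ∀ f, N₀ f ≤ c * N₁ f) (θ : ℝ) (f : E) :
    interpNormSq N₀ N₁ θ f ≤ (∫⁻ t in Ioi (0 : ℝ), ENNReal.ofReal (t ^ (-2 * θ - 1)) *
      min 1 (ENNReal.ofReal (t ^ 2))) * ((c + 1) * N₁ f) := by
  rw [← lintegral_mul_const _ (by fun_prop)]
  refine lintegral_mono fun t => ?_
  simp only
  rw [mul_assoc]
  gcongr ENNReal.ofReal _ * ?_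
  rcases min_choice 1 (ENNReal.ofReal (t ^ 2)) with h2 | h2 <;> rw [h2]
  · refine (iInf_le _ 0).trans ?_
    rw [sub_zero, h1.zero, mul_zero, add_zero, one_mul]
    exact (h f).trans (by gcongr; exact le_self_add)
  · refine (iInf_le _ f).trans ?_
    rw [sub_self, h0.zero, zero_add]
    gcongr
    exact le_mul_of_one_le_left bot_le (by simp)

theorem lt_top_of_interpNormSq_lt_top (h0 : IsQuasiSq N₀) {c : ℝ≥0∞} (hc : c ≠ ⊤)
    (h : ∀ f, N₀ f ≤ c * N₁ f) {θ : ℝ} {f : E} (hf : interpNormSq N₀ N₁ θ f < ⊤) : N₀ f < ⊤ := by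
  -- the `K`-functional is finite at some `t > 0`, hence `f` is a sum of elements of finite norm
  have hae := ae_lt_top' (aemeasurable_interp N₀ N₁ θ f) hf.ne
  have : ∃ t : ℝ, 0 < t ∧ ENNReal.ofReal (t ^ (-2 * θ - 1)) *
      ⨅ f₁ : E, (N₀ (f - f₁) + ENNReal.ofReal (t ^ 2) * N₁ f₁) < ⊤ := by
    have h2 : (volume.restrict (Ioi (0 : ℝ))) ≠ 0 := by simp [Measure.restrict_eq_zero]
    have : (ae (volume.restrict (Ioi (0 : ℝ)))).NeBot := ae_neBot.2 h2
    obtain ⟨t, ht⟩ := (hae.and (ae_restrict_mem measurableSet_Ioi)).exists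
    exact ⟨t, ht.2, ht.1⟩
  obtain ⟨t, ht, h3⟩ := this
  have hw : ENNReal.ofReal (t ^ (-2 * θ - 1)) ≠ 0 :=
    (ENNReal.ofReal_pos.2 (Real.rpow_pos_of_pos ht _)).ne'
  obtain ⟨f₁, hf₁⟩ := iInf_lt_iff.1 (ENNReal.lt_top_of_mul_ne_top_right h3.ne hw)
  have h4 := ENNReal.add_lt_top.1 hf₁
  have h5 : N₁ f₁ < ⊤ := ENNReal.lt_top_of_mul_ne_top_right h4.2.ne
    (ENNReal.ofReal_pos.2 (by positivity)).ne'
  have h6 := h0.add_le (f - f₁) f₁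
  rw [sub_add_cancel] at h6
  exact h6.trans_lt (ENNReal.mul_lt_top (by simp) (ENNReal.add_lt_top.2
    ⟨h4.1, (h f₁).trans_lt (ENNReal.mul_lt_top hc.lt_top h5)⟩))

/-- Approximations that are uniformly bounded on both spaces of an interpolation couple, and
converge in the larger one, converge in the interpolation space: the `K`-functional of the error
is dominated, and tends to `0` for each `t`. -/
theorem tendsto_interpNormSq (h1 : IsQuasiSq N₁) {P : ℕ → E → E}
    (hP : ∀ k f g, P k (f - g) = P k f - P k g) {c : ℝ≥0∞} (hc : c ≠ ⊤)
    (hc₀ : ∀ k f, N₀ (f - P k f) ≤ c * N₀ f) (hc₁ : ∀ k f, N₁ (f - P k f) ≤ c * N₁ f)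
    {θ : ℝ} {f : E} (hf : interpNormSq N₀ N₁ θ f < ⊤)
    (hlim : Tendsto (fun k => N₀ (f - P k f)) atTop (𝓝 0)) :
    Tendsto (fun k => interpNormSq N₀ N₁ θ (f - P k f)) atTop (𝓝 0) := by
  have h0 : (0 : ℝ≥0∞) = ∫⁻ t in Ioi (0 : ℝ), 0 := by simp
  rw [h0]
  -- the operators `1 - P k` are bounded on both spaces, so `c` times the integrand for `f` is a
  -- majorant
  refine tendsto_lintegral_of_dominated_convergence'
    (fun t => c * (ENNReal.ofReal (t ^ (-2 * θ - 1)) *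
      ⨅ f₁ : E, (N₀ (f - f₁) + ENNReal.ofReal (t ^ 2) * N₁ f₁)))
    (fun k => aemeasurable_interp N₀ N₁ θ _) (fun k => Eventually.of_forall fun t => ?_) ?_
    (Eventually.of_forall fun t => ?_)
  · simp only
    rw [mul_left_comm]
    gcongr ENNReal.ofReal _ * ?_
    rcases eq_or_ne c 0 with rfl | hc0
    · rw [zero_mul]
      refine (iInf_le _ 0).trans ?_
      rw [sub_zero, h1.zero, mul_zero, add_zero]
      exact (hc₀ k f).trans (by simp)
    rw [ENNReal.mul_iInf_of_ne hc0 hc]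
    -- a decomposition of `f` is mapped by `1 - P k` to one of `f - P k f`
    refine le_iInf fun f₁ => (iInf_le _ (f₁ - P k f₁)).trans ?_
    have e : f - P k f - (f₁ - P k f₁) = (f - f₁) - P k (f - f₁) := by
      rw [hP]
      abel
    rw [e, mul_add, mul_left_comm c]
    gcongr
    · exact hc₀ k _
    · exact hc₁ k _
  · rw [lintegral_const_mul' _ _ hc]
    exact (ENNReal.mul_lt_top hc.lt_top hf).ne
  · have h2 := ENNReal.Tendsto.const_mul (a := ENNReal.ofReal (t ^ (-2 * θ - 1))) hlim
      (Or.inr (by simp))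
    rw [mul_zero] at h2
    refine tendsto_of_tendsto_of_tendsto_of_le_of_le tendsto_const_nhds h2 (fun _ => bot_le)
      fun k => ?_
    simp only
    gcongr ENNReal.ofReal _ * ?_
    refine (iInf_le _ 0).trans ?_
    rw [sub_zero, h1.zero, mul_zero, add_zero]

variable {H : Type*} [NormedAddCommGroup H] [InnerProductSpace ℂ H] [CompleteSpace H]
  {A : H →ₗ.[ℂ] H}

theorem scaleNormSq_natCast (A : H →ₗ.[ℂ] H) (n : ℕ) : scaleNormSq A n = intNormSq A n := by
  ext f
  rw [scaleNormSq, if_pos (by simp), Nat.floor_natCast]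

theorem IsQuasiSq.neg {N : E → ℝ≥0∞} (h : IsQuasiSq N) (f : E) : N (-f) ≤ N f := by
  have := h.smul_le (-1) f (by simp)
  simpa using this

theorem intNormSq_sub_approx_le (hA : IsSelfAdjoint A) (k n : ℕ) (f : L2 H) :
    intNormSq A n (f - approx A k f) ≤ 2 * (1 + 2 * 2 ^ n) * intNormSq A n f := by
  rw [sub_eq_add_neg]
  refine ((isQuasiSq_int A n).add_le _ _).trans ?_
  rw [mul_assoc, add_mul, one_mul]
  gcongr 2 * (_ + ?_)
  exact ((isQuasiSq_int A n).neg _).trans (intNormSq_approx_le hA k n f)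

/-- The parameter of a non-integral interpolation space lies in `(0, 1)`. -/
theorem fract_mem_Ioo {s : ℝ} (hs : 0 ≤ s) (h : ¬ s = ⌊s⌋₊) : s - ⌊s⌋₊ ∈ Ioo (0 : ℝ) 1 := by
  have h1 := Nat.floor_le hs
  have h2 := Nat.lt_floor_add_one s
  refine ⟨sub_pos.2 (lt_of_le_of_ne h1 (Ne.symm h)), by linarith⟩

theorem exists_scaleNormSq_le (hA : IsSelfAdjoint A) {s : ℝ} (hs : 0 ≤ s) :
    ∃ c : ℝ≥0∞, c ≠ ⊤ ∧ ∀ f, scaleNormSq A s f ≤ c * intNormSq A (⌊s⌋₊ + 1) f := by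
  by_cases h : s = ⌊s⌋₊
  · refine ⟨2 * 2 ^ (⌊s⌋₊ + 1), by finiteness, fun f => ?_⟩
    rw [scaleNormSq, if_pos h]
    exact intNormSq_le_succ hA _ f
  · have hθ := fract_mem_Ioo hs h
    refine ⟨(∫⁻ t in Ioi (0 : ℝ), ENNReal.ofReal (t ^ (-2 * (s - ⌊s⌋₊) - 1)) *
      min 1 (ENNReal.ofReal (t ^ 2))) * (2 * 2 ^ (⌊s⌋₊ + 1) + 1),
      (ENNReal.mul_lt_top (lintegral_interp_weight_lt_top hθ.1 hθ.2) (by finiteness)).ne,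
      fun f => ?_⟩
    rw [scaleNormSq, if_neg h, mul_assoc]
    exact interpNormSq_le (isQuasiSq_int A _) (isQuasiSq_int A _) (intNormSq_le_succ hA ⌊s⌋₊) _ f

theorem IsSmoothCompact.scaleNormSq_lt_top (hA : IsSelfAdjoint A) {s : ℝ} (hs : 0 ≤ s)
    {φ : ℝ → H} (hφ : IsSmoothCompact A φ) {f : L2 H} (hf : f =ᵐ[halfLine] φ) :
    scaleNormSq A s f < ⊤ := by
  obtain ⟨c, hc, h⟩ := exists_scaleNormSq_le hA hs
  exact (h f).trans_lt (ENNReal.mul_lt_top hc.lt_top (hφ.intNormSq_lt_top hA hf _))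

theorem tendsto_scaleNormSq_approx (hA : IsSelfAdjoint A) {s : ℝ} {f : L2 H}
    (hf : scaleNormSq A s f < ⊤) :
    Tendsto (fun k => scaleNormSq A s (f - approx A k f)) atTop (𝓝 0) := by
  by_cases h : s = ⌊s⌋₊
  · rw [h, scaleNormSq_natCast] at hf ⊢
    exact tendsto_intNormSq_approx hA hf
  · unfold scaleNormSq at hf ⊢
    simp only [if_neg h] at hf ⊢
    have h0 := lt_top_of_interpNormSq_lt_top (isQuasiSq_int A _) (by finiteness)
      (intNormSq_le_succ hA ⌊s⌋₊) hf
    refine tendsto_interpNormSq (isQuasiSq_int A _) (approx_sub A)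
      (c := 2 * (1 + 2 * 2 ^ (⌊s⌋₊ + 1))) (by finiteness) (fun k f => ?_)
      (fun k f => intNormSq_sub_approx_le hA k _ f) hf (tendsto_intNormSq_approx hA h0)
    refine (intNormSq_sub_approx_le hA k _ f).trans ?_
    gcongr
    · norm_num
    · omega

/-- `C₀^∞(ℝ₊, H_∞)` is dense in `ℋ_s`. -/
theorem exists_smooth_near (hA : IsSelfAdjoint A) {s : ℝ} (hs : 0 ≤ s) {f : L2 H}
    (hf : scaleNormSq A s f < ⊤) {ε : ℝ≥0∞} (hε : 0 < ε) :
    ∃ u : L2 H, (∃ φ : ℝ → H, IsSmoothCompact A φ ∧ u =ᵐ[halfLine] φ) ∧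
      scaleNormSq A s (f - u) < ε := by
  obtain ⟨c, hc, h⟩ := exists_scaleNormSq_le hA hs
  obtain ⟨δ, hδ, hδε⟩ : ∃ δ : ℝ≥0∞, 0 < δ ∧ 2 * (δ + c * δ) < ε := by
    have hlim : Tendsto (fun δ : ℝ≥0∞ => 2 * (δ + c * δ)) (𝓝 0) (𝓝 (2 * (0 + c * 0))) := by
      refine ENNReal.Tendsto.const_mul (tendsto_id.add
        (ENNReal.Tendsto.const_mul tendsto_id (Or.inr hc))) (Or.inr (by simp))
    rw [mul_zero, add_zero, mul_zero] at hlim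
    have h2 := (tendsto_order.1 hlim).2 ε hε
    obtain ⟨δ, hδ, h3⟩ := ((h2.filter_mono (nhdsWithin_le_nhds (s := Ioi 0))).and
      self_mem_nhdsWithin).exists
    exact ⟨δ, h3, hδ⟩
  obtain ⟨k, hk⟩ := ((tendsto_order.1 (tendsto_scaleNormSq_approx hA hf)).2 _ hδ).exists
  obtain ⟨u, hu, hu'⟩ := exists_smooth_near_approx hA k (⌊s⌋₊ + 1) f hδ
  refine ⟨u, hu, ?_⟩
  rw [← sub_add_sub_cancel f (approx A k f) u]
  refine (((isQuasiSq_scale A s).add_le _ _).trans ?_).trans_lt hδε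
  gcongr
  exact (h _).trans (by gcongr)

end Interp

/-! ### A dyadic square function estimate -/

section Dyadic

variable {H : Type*} [NormedAddCommGroup H] [InnerProductSpace ℂ H] [CompleteSpace H]

/-- The symbol `r / (r + τ²)`; as `τ → 0` it tends to `1`. -/
def lowSymb (τ r : ℝ) : ℝ := r / (r + τ ^ 2)

/-- The symbol `τ^p r^(1 - p/2) / (r + τ²)`, concentrated near `r = τ²`. -/
def bandSymb (p τ r : ℝ) : ℝ := τ ^ p * r ^ (1 - p / 2) / (r + τ ^ 2)

/-- The symbol `(τ² / (r + τ²))^p`, whose dyadic differences dominate `bandSymb p τ r ^ 2`. -/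
def primSymb (p τ r : ℝ) : ℝ := (τ ^ 2 / (r + τ ^ 2)) ^ p

theorem two_rpow_le {p τ : ℝ} (hp : 0 ≤ p) (hτ : 0 < τ) : ((2 * τ) ^ p)⁻¹ ≤ (τ ^ p)⁻¹ :=
  inv_anti₀ (by positivity) (Real.rpow_le_rpow hτ.le (by linarith) hp)

theorem add_sq_pos {τ r : ℝ} (hτ : 0 < τ) (hr : 0 ≤ r) : 0 < r + τ ^ 2 := by positivity

theorem continuousOn_lowSymb {τ : ℝ} (hτ : 0 < τ) : ContinuousOn (lowSymb τ) (Icc 0 1) :=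
  continuousOn_id.div (by fun_prop) fun _ hr => (add_sq_pos hτ hr.1).ne'

theorem continuousOn_bandSymb {p τ : ℝ} (hp : p ≤ 1) (hτ : 0 < τ) :
    ContinuousOn (bandSymb p τ) (Icc 0 1) :=
  (continuousOn_const.mul (Real.continuous_rpow_const (by linarith)).continuousOn).div
    (by fun_prop) fun _ hr => (add_sq_pos hτ hr.1).ne'

theorem continuousOn_primSymb {p τ : ℝ} (hp : 0 < p) (hτ : 0 < τ) :
    ContinuousOn (primSymb p τ) (Icc 0 1) :=
  (continuousOn_const.div (by fun_prop) fun _ hr => (add_sq_pos hτ hr.1).ne').rpow_const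
    fun _ _ => Or.inr hp.le

theorem primSymb_mem_Icc {p τ r : ℝ} (hp : 0 < p) (hτ : 0 < τ) (hr : 0 ≤ r) :
    primSymb p τ r ∈ Icc (0 : ℝ) 1 := by
  have h := add_sq_pos hτ hr
  refine ⟨Real.rpow_nonneg (by positivity) _, Real.rpow_le_one (by positivity) ?_ hp.le⟩
  rw [div_le_one h]
  linarith

theorem bandSymb_sq_le {p τ r : ℝ} (hp : 0 < p) (hp1 : p ≤ 1) (hτ : 0 < τ) (hr : 0 ≤ r) :
    bandSymb p τ r ^ 2 ≤ 4 / (3 * p) * (primSymb p (2 * τ) r - primSymb p τ r) := by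
  rcases hr.eq_or_lt with rfl | hr
  · have e : ∀ t : ℝ, 0 < t → primSymb p t 0 = 1 := by
      intro t ht
      rw [primSymb, zero_add, div_self (by positivity), Real.one_rpow]
    rw [bandSymb, Real.zero_rpow (by linarith), e _ hτ, e _ (by positivity)]
    simp
  have h1 : 0 < r + τ ^ 2 := by positivity
  have h2 : 0 < r + (2 * τ) ^ 2 := by positivity
  set a := τ ^ 2 / (r + τ ^ 2) with ha
  set a' := (2 * τ) ^ 2 / (r + (2 * τ) ^ 2) with ha'
  have ha0 : 0 < a := by positivity
  have ha0' : 0 < a' := by positivity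
  have haa : a ≤ a' := by
    rw [ha, ha', div_le_div_iff₀ h1 h2]
    nlinarith [mul_pos hr (pow_pos hτ 2)]
  have hdiv : a / a' = 1 + -(3 * r / (4 * (r + τ ^ 2))) := by
    rw [ha, ha']
    field_simp
    ring
  -- Bernoulli's inequality; this is where `p ≤ 1` enters
  have hB : (a / a') ^ p ≤ 1 + p * -(3 * r / (4 * (r + τ ^ 2))) := by
    rw [hdiv]
    refine rpow_one_add_le_one_add_mul_self ?_ hp.le hp1
    rw [neg_le_neg_iff, div_le_one (by positivity)]
    nlinarith
  have hA : a ^ p = a' ^ p * (a / a') ^ p := by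
    rw [← Real.mul_rpow ha0'.le (by positivity), mul_div_cancel₀ _ ha0'.ne']
  have hdiff : a ^ p * (p * (3 * r / (4 * (r + τ ^ 2)))) ≤ a' ^ p - a ^ p := by
    have h3 : a ^ p ≤ a' ^ p := Real.rpow_le_rpow ha0.le haa hp.le
    have h4 : 0 < a' ^ p := by positivity
    have h5 : 0 ≤ p * (3 * r / (4 * (r + τ ^ 2))) := by positivity
    have h6 : a ^ p * (p * (3 * r / (4 * (r + τ ^ 2)))) ≤
        a' ^ p * (p * (3 * r / (4 * (r + τ ^ 2)))) := mul_le_mul_of_nonneg_right h3 h5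
    have h7 := mul_le_mul_of_nonneg_left hB h4.le
    rw [← hA] at h7
    linarith
  have hsq : bandSymb p τ r ^ 2 ≤ a ^ p * (r / (r + τ ^ 2)) := by
    have e1 : (τ ^ p) ^ 2 = (τ ^ 2) ^ p := by
      rw [← Real.rpow_natCast, ← Real.rpow_mul hτ.le, ← Real.rpow_natCast τ 2,
        ← Real.rpow_mul hτ.le, mul_comm]
    have e2 : (r ^ (1 - p / 2)) ^ 2 = r * r ^ (1 - p) := by
      rw [← Real.rpow_natCast, ← Real.rpow_mul hr.le]
      nth_rw 2 [← Real.rpow_one r]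
      rw [← Real.rpow_add hr]
      congr 1
      push_cast
      ring
    have e3 : (r + τ ^ 2) = (r + τ ^ 2) ^ p * (r + τ ^ 2) ^ (1 - p) := by
      rw [← Real.rpow_add h1]
      simp
    have e4 : r ^ (1 - p) ≤ (r + τ ^ 2) ^ (1 - p) :=
      Real.rpow_le_rpow hr.le (by nlinarith) (by linarith)
    rw [bandSymb, div_pow, mul_pow, e1, e2, ha, Real.div_rpow (by positivity) h1.le,
      div_mul_div_comm, div_le_div_iff₀ (by positivity) (by positivity)]
    have e5 : (r + τ ^ 2) ^ 2 = (r + τ ^ 2) ^ p * (r + τ ^ 2) ^ (1 - p) * (r + τ ^ 2) := by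
      rw [← e3, sq]
    rw [e5]
    have : 0 ≤ (τ ^ 2) ^ p * r * ((r + τ ^ 2) ^ p * (r + τ ^ 2)) := by positivity
    nlinarith [mul_le_mul_of_nonneg_left e4 this]
  have : 4 / (3 * p) * (a ^ p * (p * (3 * r / (4 * (r + τ ^ 2))))) =
      a ^ p * (r / (r + τ ^ 2)) := by
    field_simp
  calc bandSymb p τ r ^ 2 ≤ _ := hsq
    _ = _ := this.symm
    _ ≤ _ := mul_le_mul_of_nonneg_left hdiff (by positivity)

namespace IsResolvent

variable {R : H →L[ℂ] H} (hR : IsResolvent R)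
include hR

/-- The operators `bandSymb p τ R`, `τ = a 2^i`, form a square function: the terms are dominated
by a telescoping sum. -/
theorem sum_norm_bandSymb_sq_le {p a : ℝ} (hp : 0 < p) (hp1 : p ≤ 1) (ha : 0 < a) (n : ℕ) (v : H) :
    ∑ i ∈ Finset.range n, ‖cfc (bandSymb p (a * 2 ^ i)) R v‖ ^ 2 ≤ 4 / (3 * p) * ‖v‖ ^ 2 := by
  have hτ : ∀ i : ℕ, 0 < a * 2 ^ i := fun i => by positivity
  set g : ℕ → ℝ := fun i => (⟪v, cfc (primSymb p (a * 2 ^ i)) R v⟫_ℂ).re with hg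
  have hcont := fun i => continuousOn_primSymb hp (hτ i)
  have hstep : ∀ i, ‖cfc (bandSymb p (a * 2 ^ i)) R v‖ ^ 2 ≤ 4 / (3 * p) * (g (i + 1) - g i) := by
    intro i
    rw [hR.norm_cfc_sq (continuousOn_bandSymb hp1 (hτ i))]
    have h1 : ContinuousOn (fun t => primSymb p (a * 2 ^ (i + 1)) t - primSymb p (a * 2 ^ i) t)
        (Icc 0 1) := (hcont _).sub (hcont _)
    refine (hR.inner_cfc_mono ((continuousOn_bandSymb hp1 (hτ i)).pow 2)
      (continuousOn_const.mul h1) (g := fun t => 4 / (3 * p) *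
        (primSymb p (a * 2 ^ (i + 1)) t - primSymb p (a * 2 ^ i) t)) (fun t ht => ?_) v).trans ?_
    · have := bandSymb_sq_le hp hp1 (hτ i) ht.1
      rwa [show 2 * (a * 2 ^ i) = a * 2 ^ (i + 1) by ring] at this
    · rw [cfc_const_mul _ _ R (h1.mono hR.spectrum_subset), cfc_sub _ _ R
        ((hcont _).mono hR.spectrum_subset) ((hcont _).mono hR.spectrum_subset), smul_apply,
        sub_apply, ← Complex.coe_smul, inner_smul_right, Complex.re_ofReal_mul, inner_sub_right,
        Complex.sub_re]
  have hle : ∀ i, g i ≤ ‖v‖ ^ 2 := by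
    intro i
    refine (hR.inner_cfc_mono (hcont i) (continuousOn_const (c := 1))
      (fun t ht => (primSymb_mem_Icc hp (hτ i) ht.1).2) v).trans ?_
    rw [hR.cfc_const_apply, inner_smul_right, inner_self_eq_norm_sq_to_K, Complex.re_ofReal_mul,
      one_mul, ← RCLike.ofReal_pow]
    exact (Complex.ofReal_re _).le
  have hge : ∀ i, 0 ≤ g i := by
    intro i
    refine le_trans ?_ (hR.inner_cfc_mono (continuousOn_const (c := 0)) (hcont i)
      (fun t ht => (primSymb_mem_Icc hp (hτ i) ht.1).1) v)
    rw [hR.cfc_const_apply]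
    simp
  refine (Finset.sum_le_sum fun i _ => hstep i).trans ?_
  rw [← Finset.mul_sum, Finset.sum_range_sub]
  exact mul_le_mul_of_nonneg_left (by linarith [hle n, hge 0]) (by positivity)

theorem norm_lowSymb_le {τ : ℝ} (hτ : 0 < τ) (z : H) : ‖cfc (lowSymb τ) R z‖ ≤ (τ ^ 2)⁻¹ * ‖z‖ := by
  refine hR.norm_cfc_le (continuousOn_lowSymb hτ) (fun t ht => ?_) z
  have h := add_sq_pos hτ ht.1
  rw [lowSymb, abs_of_nonneg (div_nonneg ht.1 h.le), inv_eq_one_div, div_le_div_iff₀ h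
    (by positivity)]
  nlinarith [ht.1, ht.2]

theorem tendsto_lowSymb (z : H) :
    Filter.Tendsto (fun τ => cfc (lowSymb τ) R z) (nhdsWithin 0 (Ioi 0)) (nhds z) := by
  have hco : ∀ τ : ℝ, 0 < τ → ContinuousOn (fun t : ℝ => 1 - lowSymb τ t) (Icc 0 1) := fun τ hτ =>
    continuousOn_const.sub (continuousOn_lowSymb hτ)
  have hform : ∀ τ : ℝ, 0 < τ → ∀ w, w - cfc (lowSymb τ) R w =
      cfc (fun t => 1 - lowSymb τ t) R w := by
    intro τ hτ w
    rw [cfc_sub (fun _ => 1) (lowSymb τ) R continuousOn_const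
      ((continuousOn_lowSymb hτ).mono hR.spectrum_subset), sub_apply, hR.cfc_const_apply]
    simp
  have hsym : ∀ τ : ℝ, 0 < τ → ∀ t ∈ Icc (0 : ℝ) 1, 1 - lowSymb τ t = τ ^ 2 / (t + τ ^ 2) := by
    intro τ hτ t ht
    have := (add_sq_pos hτ ht.1).ne'
    rw [lowSymb]
    field_simp
    ring
  have h1 : ∀ τ : ℝ, 0 < τ → ∀ w, ‖w - cfc (lowSymb τ) R w‖ ≤ ‖w‖ := by
    intro τ hτ w
    rw [hform τ hτ]
    refine (hR.norm_cfc_le (hco τ hτ) (c := 1) (fun t ht => ?_) w).trans (one_mul _).le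
    have h := add_sq_pos hτ ht.1
    rw [hsym τ hτ t ht, abs_of_nonneg (by positivity), div_le_one h]
    linarith [ht.1]
  have h2 : ∀ τ : ℝ, 0 < τ → ∀ y, ‖R y - cfc (lowSymb τ) R (R y)‖ ≤ τ ^ 2 * ‖y‖ := by
    intro τ hτ y
    rw [hform τ hτ]
    have e : cfc (fun t => 1 - lowSymb τ t) R (R y) =
        cfc (fun t => (1 - lowSymb τ t) * t) R y := by
      rw [hR.cfc_mul_apply (hco τ hτ) (g := fun t => t) continuousOn_id]
      exact congrArg (fun S : H →L[ℂ] H => cfc (fun t => 1 - lowSymb τ t) R (S y))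
        (cfc_id' ℝ R hR.isSelfAdjoint).symm
    rw [e]
    refine hR.norm_cfc_le ((hco τ hτ).mul (g := fun t => t) continuousOn_id) (fun t ht => ?_) y
    simp only [Pi.mul_apply]
    have h := add_sq_pos hτ ht.1
    have ht0 := ht.1
    rw [hsym τ hτ t ht, abs_of_nonneg (by positivity), div_mul_eq_mul_div, div_le_iff₀ h]
    nlinarith [sq_nonneg (τ ^ 2)]
  rw [Metric.tendsto_nhds]
  intro ε hε
  obtain ⟨y, hy⟩ := hR.denseRange.exists_dist_lt z (show 0 < ε / 2 by positivity)
  have hlim : Filter.Tendsto (fun τ : ℝ => τ ^ 2 * ‖y‖) (nhdsWithin 0 (Ioi 0)) (nhds 0) := by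
    have : Continuous fun τ : ℝ => τ ^ 2 * ‖y‖ := by fun_prop
    simpa using (this.tendsto 0).mono_left nhdsWithin_le_nhds
  filter_upwards [self_mem_nhdsWithin, hlim.eventually (gt_mem_nhds (show 0 < ε / 2 by positivity))]
    with τ hτ hτ2
  rw [dist_comm, dist_eq_norm] at *
  have e : z - cfc (lowSymb τ) R z = ((z - R y) - cfc (lowSymb τ) R (z - R y)) +
      (R y - cfc (lowSymb τ) R (R y)) := by
    rw [map_sub]; abel
  rw [e]
  rw [norm_sub_rev] at hy
  linarith [norm_add_le ((z - R y) - cfc (lowSymb τ) R (z - R y)) (R y - cfc (lowSymb τ) R (R y)),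
    h1 τ hτ (z - R y), h2 τ hτ y]

/-- The form in which `bandSymb` enters: as the adjoint of `R^(p/2)`-multiples of `lowSymb`. -/
theorem inner_lowSymb {p τ : ℝ} (hp : 0 < p) (hp1 : p ≤ 1) (hτ : 0 < τ) (z w : H) :
    ⟪cfc (lowSymb τ) R z, w⟫_ℂ =
      ((τ ^ p)⁻¹ : ℝ) * ⟪cfc (bandSymb p τ) R z, halfPow R p w⟫_ℂ := by
  have e : cfc (lowSymb τ) R z = ((τ ^ p)⁻¹ : ℝ) • halfPow R p (cfc (bandSymb p τ) R z) := by
    have hb := continuousOn_bandSymb hp1 hτ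
    rw [hR.halfPow_cfc hp.le hb, ← smul_apply, ← cfc_const_mul _
      (fun t => t ^ (p / 2) * bandSymb p τ t) R
      (((continuousOn_rpow_half hp.le).mul hb).mono hR.spectrum_subset)]
    congr 1
    refine hR.cfc_congr' fun t ht => ?_
    have h1 : t ^ (p / 2) * t ^ (1 - p / 2) = t := by
      rw [← Real.rpow_add_of_nonneg ht.1 (by linarith) (by linarith)]
      simp
    have h2 : 0 < τ ^ p := by positivity
    calc lowSymb τ t = (t ^ (p / 2) * t ^ (1 - p / 2)) / (t + τ ^ 2) := by rw [h1, lowSymb]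
      _ = _ := by
        rw [bandSymb]
        have := add_sq_pos hτ ht.1
        field_simp
  rw [e, ← Complex.coe_smul, inner_smul_left, Complex.conj_ofReal, halfPow_inner_comm]

/-- Differences of `lowSymb` across a dyadic step gain half a power of `R` at the cost `τ`. -/
theorem norm_inner_lowSymb_sub_le {p τ q : ℝ} (hp : 0 < p) (hp1 : p ≤ 1) (hτ : 0 < τ)
    (z w b₀ b₁ : H) (hw : halfPow R p w = b₀ + halfPow R 1 b₁) (h₀ : ‖b₀‖ ≤ q)
    (h₁ : τ * ‖b₁‖ ≤ q) :
    ‖⟪cfc (lowSymb τ) R z - cfc (lowSymb (2 * τ)) R z, w⟫_ℂ‖ ≤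
      (τ ^ p)⁻¹ * (‖cfc (bandSymb p τ) R z‖ * (2 * q)) := by
  set d : ℝ → ℝ := fun t => 3 * τ ^ 2 / (t + (2 * τ) ^ 2) with hd
  have h2τ : 0 < 2 * τ := by positivity
  have hdc : ContinuousOn d (Icc 0 1) :=
    continuousOn_const.div (by fun_prop) fun _ hr => (add_sq_pos h2τ hr.1).ne'
  have hl := continuousOn_lowSymb hτ
  -- `lowSymb τ - lowSymb (2 τ) = lowSymb τ * d` with `d r = 3 τ² / (r + 4 τ²)`, and both `d` and
  -- `τ⁻¹ √r d r` are bounded by `1`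
  have e1 : cfc (lowSymb τ) R z - cfc (lowSymb (2 * τ)) R z = cfc (lowSymb τ) R (cfc d R z) := by
    rw [← hR.cfc_mul_apply hl hdc, ← sub_apply, ← cfc_sub _ _ R (hl.mono hR.spectrum_subset)
      ((continuousOn_lowSymb h2τ).mono hR.spectrum_subset)]
    congr 1
    refine hR.cfc_congr' fun t ht => ?_
    have h1 := add_sq_pos hτ ht.1
    have h2 := add_sq_pos h2τ ht.1
    rw [hd, lowSymb, lowSymb, div_sub_div _ _ h1.ne' h2.ne', div_mul_div_comm]
    congr 1
    ring
  have e2 : cfc (bandSymb p τ) R (cfc d R z) = cfc d R (cfc (bandSymb p τ) R z) := by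
    rw [← hR.cfc_mul_apply (continuousOn_bandSymb hp1 hτ) hdc,
      ← hR.cfc_mul_apply hdc (continuousOn_bandSymb hp1 hτ)]
    simp only [mul_comm]
  rw [e1, hR.inner_lowSymb hp hp1 hτ, e2, cfc_inner_comm, norm_mul, Complex.norm_real,
    Real.norm_of_nonneg (by positivity : 0 ≤ (τ ^ p)⁻¹), hw, map_add]
  refine mul_le_mul_of_nonneg_left ((norm_inner_le_norm _ _).trans
    (mul_le_mul_of_nonneg_left ?_ (norm_nonneg _))) (by positivity)
  have h3 : ‖cfc d R b₀‖ ≤ 1 * ‖b₀‖ := by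
    refine hR.norm_cfc_le hdc (fun t ht => ?_) _
    have h2 := add_sq_pos h2τ ht.1
    rw [hd, abs_of_nonneg (by positivity), div_le_one h2]
    nlinarith [ht.1]
  have h4 : ‖cfc d R (halfPow R 1 b₁)‖ ≤ τ * ‖b₁‖ := by
    rw [hR.cfc_halfPow zero_le_one hdc]
    refine hR.norm_cfc_le (hdc.mul (continuousOn_rpow_half zero_le_one)) (fun t ht => ?_) _
    have h2 := add_sq_pos h2τ ht.1
    have h5 := Real.sqrt_nonneg t
    simp only [Pi.mul_apply, hd]
    rw [← Real.sqrt_eq_rpow, abs_of_nonneg (by positivity), div_mul_eq_mul_div,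
      div_le_iff₀ h2]
    nlinarith [Real.sq_sqrt ht.1, mul_nonneg hτ.le (sq_nonneg (√t - 2 * τ)),
      mul_nonneg (mul_nonneg hτ.le hτ.le) h5]
  linarith [norm_add_le (cfc d R b₀) (cfc d R (halfPow R 1 b₁))]

/-- An abstract trace estimate. Suppose that `B τ → z` as `τ → 0` and that `R^(p/2) (B τ)` is
decomposed at each scale `τ` into a part in `H` and a part in `H_1`, and varies slowly. Then `z` is
controlled by the dyadic sum of the squares of the norms of these parts. The quantity
`⟪lowSymb τ R z, B τ⟫` interpolates between `‖z‖²` at `τ = 0` and `0` at `τ = ∞`; its dyadic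
increments are estimated by the Cauchy-Schwarz inequality against the square function
`bandSymb p τ R z`. -/
theorem norm_sq_le_of_dyadic {p M S : ℝ} (hp : 0 < p) (hp1 : p ≤ 1) {z : H} {B : ℝ → H}
    {κ : ℝ → ℝ} (hB : ∀ τ, 0 < τ → ‖B τ‖ ≤ M)
    (hz : Filter.Tendsto B (nhdsWithin 0 (Ioi 0)) (nhds z))
    (h : ∀ τ, 0 < τ → ∀ q, κ τ < q → ∃ b₀ b₁, halfPow R p (B τ) = b₀ + halfPow R 1 b₁ ∧
      ‖b₀‖ ^ 2 ≤ q ∧ τ ^ 2 * ‖b₁‖ ^ 2 ≤ q ∧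
      ‖halfPow R p (B τ) - halfPow R p (B (2 * τ))‖ ^ 2 ≤ q)
    (hS : ∀ a, 0 < a → ∀ n : ℕ,
      ∑ i ∈ Finset.range n, ((a * 2 ^ i) ^ p)⁻¹ ^ 2 * κ (a * 2 ^ i) ≤ S) :
    ‖z‖ ^ 2 ≤ 64 / p * S := by
  set W : ℝ → ℝ := fun τ => (⟪cfc (lowSymb τ) R z, B τ⟫_ℂ).re with hW
  set N : ℝ → ℝ := fun τ => ‖cfc (bandSymb p τ) R z‖ ^ 2 with hN
  -- `δ` is chosen so that the two square functions contribute at most `‖z‖² / 4` each to the sum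
  set δ : ℝ := 3 * p / 16 with hδ
  have hδ0 : 0 < δ := by positivity
  have hstep : ∀ τ, 0 < τ →
      W τ - W (2 * τ) ≤ δ * N τ + δ * N (2 * τ) + 2 / δ * ((τ ^ p)⁻¹ ^ 2 * κ τ) := by
    intro τ hτ
    have h2τ : 0 < 2 * τ := by positivity
    have hT : 0 < (τ ^ p)⁻¹ := by positivity
    have key : ∀ q, κ τ < q →
        W τ - W (2 * τ) - δ * N τ - δ * N (2 * τ) ≤ 2 / δ * ((τ ^ p)⁻¹ ^ 2 * q) := by
      intro q hq
      obtain ⟨b₀, b₁, e, h0, h1, h2⟩ := h τ hτ q hq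
      have hq0 : 0 ≤ q := (sq_nonneg _).trans h0
      have hs : √q ^ 2 = q := Real.sq_sqrt hq0
      have h0' : ‖b₀‖ ≤ √q := Real.le_sqrt_of_sq_le h0
      have h1' : τ * ‖b₁‖ ≤ √q := Real.le_sqrt_of_sq_le (by rwa [mul_pow])
      have h2' := Real.le_sqrt_of_sq_le h2
      have i1 := hR.norm_inner_lowSymb_sub_le hp hp1 hτ z (B τ) b₀ b₁ e h0' h1'
      have i2 : ‖⟪cfc (lowSymb (2 * τ)) R z, B τ - B (2 * τ)⟫_ℂ‖ ≤
          (τ ^ p)⁻¹ * (‖cfc (bandSymb p (2 * τ)) R z‖ * √q) := by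
        rw [hR.inner_lowSymb hp hp1 h2τ, norm_mul, Complex.norm_real,
          Real.norm_of_nonneg (by positivity : 0 ≤ ((2 * τ) ^ p)⁻¹), map_sub]
        exact mul_le_mul (two_rpow_le hp.le hτ) ((norm_inner_le_norm _ _).trans
          (mul_le_mul_of_nonneg_left h2' (norm_nonneg _))) (norm_nonneg _) hT.le
      have e1 : W τ - W (2 * τ) =
          (⟪cfc (lowSymb τ) R z - cfc (lowSymb (2 * τ)) R z, B τ⟫_ℂ).re +
          (⟪cfc (lowSymb (2 * τ)) R z, B τ - B (2 * τ)⟫_ℂ).re := by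
        rw [inner_sub_left, inner_sub_right, Complex.sub_re, Complex.sub_re]
        ring
      have j1 := (Complex.re_le_norm _).trans i1
      have j2 := (Complex.re_le_norm _).trans i2
      set x := ‖cfc (bandSymb p τ) R z‖
      set y := ‖cfc (bandSymb p (2 * τ)) R z‖
      set c := (τ ^ p)⁻¹ * √q with hc
      have e2 : (τ ^ p)⁻¹ ^ 2 * q = c ^ 2 := by rw [hc, mul_pow, hs]
      rw [e2, e1]
      -- weighted arithmetic-geometric mean inequality
      have k1 : (τ ^ p)⁻¹ * (x * (2 * √q)) ≤ δ * x ^ 2 + c ^ 2 / δ := by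
        have : δ * x ^ 2 + c ^ 2 / δ - 2 * c * x = (δ * x - c) ^ 2 / δ := by field_simp; ring
        have := this ▸ div_nonneg (sq_nonneg (δ * x - c)) hδ0.le
        linarith
      have k2 : (τ ^ p)⁻¹ * (y * √q) ≤ δ * y ^ 2 + c ^ 2 / δ := by
        have : δ * y ^ 2 + c ^ 2 / δ - 2 * c * y = (δ * y - c) ^ 2 / δ := by field_simp; ring
        have := this ▸ div_nonneg (sq_nonneg (δ * y - c)) hδ0.le
        have hcy : 0 ≤ c * y := by positivity
        linarith
      have k3 : 2 / δ * c ^ 2 = c ^ 2 / δ + c ^ 2 / δ := by ring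
      simp only [hN]
      linarith
    have hlim : W τ - W (2 * τ) - δ * N τ - δ * N (2 * τ) ≤ 2 / δ * ((τ ^ p)⁻¹ ^ 2 * κ τ) := by
      have hcont : Continuous fun q => 2 / δ * ((τ ^ p)⁻¹ ^ 2 * q) := by fun_prop
      refine ge_of_tendsto ((hcont.tendsto (κ τ)).mono_left
        (nhdsWithin_le_nhds (s := Ioi (κ τ)))) ?_
      filter_upwards [self_mem_nhdsWithin] with q hq using key q hq
    linarith
  have hsum : ∀ a, 0 < a → ∀ n : ℕ, W a - W (a * 2 ^ n) ≤ ‖z‖ ^ 2 / 2 + 2 / δ * S := by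
    intro a ha n
    have h1 : W a - W (a * 2 ^ n) = ∑ i ∈ Finset.range n,
        (W (a * 2 ^ i) - W (2 * (a * 2 ^ i))) := by
      have := Finset.sum_range_sub' (fun i : ℕ => W (a * 2 ^ i)) n
      rw [pow_zero, mul_one] at this
      rw [← this]
      refine Finset.sum_congr rfl fun i _ => ?_
      rw [pow_succ]
      ring_nf
    rw [h1]
    refine (Finset.sum_le_sum fun i _ => hstep (a * 2 ^ i) (by positivity)).trans ?_
    rw [Finset.sum_add_distrib, Finset.sum_add_distrib, ← Finset.mul_sum, ← Finset.mul_sum,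
      ← Finset.mul_sum]
    have s1 := hR.sum_norm_bandSymb_sq_le hp hp1 ha n z
    have s2 := hR.sum_norm_bandSymb_sq_le hp hp1 (show 0 < 2 * a by positivity) n z
    have s3 := mul_le_mul_of_nonneg_left (hS a ha n) (show 0 ≤ 2 / δ by positivity)
    have s4 := mul_le_mul_of_nonneg_left s1 hδ0.le
    have s5 := mul_le_mul_of_nonneg_left s2 hδ0.le
    have e : δ * (4 / (3 * p) * ‖z‖ ^ 2) = ‖z‖ ^ 2 / 4 := by
      rw [hδ]; field_simp; norm_num
    simp only [mul_assoc (2 : ℝ) a] at s5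
    rw [e] at s4 s5
    linarith
  have hM : ∀ τ, 0 < τ → |W τ| ≤ (τ ^ 2)⁻¹ * ‖z‖ * M := by
    intro τ hτ
    refine (Complex.abs_re_le_norm _).trans ((norm_inner_le_norm _ _).trans ?_)
    exact mul_le_mul (hR.norm_lowSymb_le hτ z) (hB τ hτ) (norm_nonneg _) (by positivity)
  have hup : ∀ a, 0 < a → W a ≤ ‖z‖ ^ 2 / 2 + 2 / δ * S := by
    intro a ha
    -- the contribution of large scales vanishes since `B` is bounded
    have hinf : Filter.Tendsto (fun n : ℕ => W (a * 2 ^ n)) Filter.atTop (nhds 0) := by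
      refine squeeze_zero_norm (fun n => hM (a * 2 ^ n) (by positivity)) ?_
      have h1 : Filter.Tendsto (fun n : ℕ => a * (2 : ℝ) ^ n) Filter.atTop Filter.atTop :=
        (tendsto_pow_atTop_atTop_of_one_lt one_lt_two).const_mul_atTop ha
      have h2 := ((Filter.tendsto_pow_atTop two_ne_zero).comp h1).inv_tendsto_atTop
      simpa [mul_assoc] using h2.mul_const (‖z‖ * M)
    have := (hinf.const_sub (W a))
    rw [sub_zero] at this
    exact le_of_tendsto this (Filter.Eventually.of_forall fun n => hsum a ha n)
  have h0 : Filter.Tendsto W (nhdsWithin 0 (Ioi 0)) (nhds (‖z‖ ^ 2)) := by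
    have h1 := (hR.tendsto_lowSymb z).inner hz (𝕜 := ℂ)
    have h2 := (Complex.continuous_re.tendsto _).comp h1
    rw [inner_self_eq_norm_sq_to_K, ← RCLike.ofReal_pow] at h2
    exact h2
  have hfin : ‖z‖ ^ 2 ≤ ‖z‖ ^ 2 / 2 + 2 / δ * S :=
    le_of_tendsto h0 (by filter_upwards [self_mem_nhdsWithin] with a ha using hup a ha)
  have hS0 : 0 ≤ S := by simpa using hS 1 one_pos 0
  have e : 2 / δ * S ≤ 32 / p * S := by
    refine mul_le_mul_of_nonneg_right ?_ hS0
    rw [hδ, div_le_div_iff₀ (by positivity) hp]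
    linarith
  have e' : 64 / p * S = 2 * (32 / p * S) := by ring
  linarith

end IsResolvent

end Dyadic

/-! ### Traces of smooth functions -/

section Trace

variable {V : Type*} [NormedAddCommGroup V] [InnerProductSpace ℂ V]
variable {H : Type*} [NormedAddCommGroup H] [InnerProductSpace ℂ H] [CompleteSpace H]

theorem enorm_sq_eq_ofReal {F : Type*} [NormedAddCommGroup F] (x : F) :
    ‖x‖ₑ ^ 2 = ENNReal.ofReal (‖x‖ ^ 2) := by
  rw [ENNReal.ofReal_pow (norm_nonneg x), ofReal_norm]

theorem norm_sq_le_of_enorm_sq_le {F : Type*} [NormedAddCommGroup F] {x : F} {c : ℝ≥0∞} {M : ℝ}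
    (hM : 0 ≤ M) (h : ‖x‖ₑ ^ 2 ≤ c) (hc : c ≤ ENNReal.ofReal M) : ‖x‖ ^ 2 ≤ M := by
  rw [enorm_sq_eq_ofReal] at h
  exact (ENNReal.ofReal_le_ofReal_iff hM).1 (h.trans hc)

/-- The dyadic form of the interpolation norm: the `K`-functional is monotone. -/
theorem sum_le_interpNormSq {E : Type*} [AddCommGroup E] (N₀ N₁ : E → ℝ≥0∞) {θ : ℝ} (hθ : 0 < θ)
    (f : E) {a : ℝ} (ha : 0 < a) (n : ℕ) :
    ∑ i ∈ Finset.range n, ENNReal.ofReal ((a * 2 ^ i) ^ (-2 * θ)) *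
      ⨅ f₁ : E, (N₀ (f - f₁) + ENNReal.ofReal ((a * 2 ^ i) ^ 2) * N₁ f₁) ≤
        ENNReal.ofReal (2 ^ (2 * θ + 1)) * interpNormSq N₀ N₁ θ f := by
  set K : ℝ → ℝ≥0∞ := fun t => ⨅ f₁ : E, (N₀ (f - f₁) + ENNReal.ofReal (t ^ 2) * N₁ f₁) with hK
  set F : ℝ → ℝ≥0∞ := fun t => ENNReal.ofReal (t ^ (-2 * θ - 1)) * K t with hF
  have hstep : ∀ i : ℕ, ENNReal.ofReal ((a * 2 ^ i) ^ (-2 * θ)) * K (a * 2 ^ i) ≤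
      ENNReal.ofReal (2 ^ (2 * θ + 1)) * ∫⁻ t in Ioc (a * 2 ^ i) (a * 2 ^ (i + 1)), F t := by
    intro i
    set τ := a * 2 ^ i with hτ
    have hτ0 : 0 < τ := by positivity
    have e2 : a * 2 ^ (i + 1) = 2 * τ := by rw [hτ]; ring
    have h1 : ∀ t ∈ Ioc τ (2 * τ),
        ENNReal.ofReal ((2 * τ) ^ (-2 * θ - 1)) * K τ ≤ F t := by
      intro t ht
      have ht0 : 0 < t := hτ0.trans ht.1
      refine mul_le_mul' (ENNReal.ofReal_le_ofReal
        (Real.rpow_le_rpow_of_nonpos ht0 ht.2 (by linarith))) ?_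
      refine iInf_mono fun f₁ => ?_
      gcongr
      exact ht.1.le
    have h2 : ENNReal.ofReal ((2 * τ) ^ (-2 * θ - 1)) * K τ * ENNReal.ofReal τ ≤
        ∫⁻ t in Ioc τ (2 * τ), F t := by
      have h3 := setLIntegral_mono' (μ := volume) measurableSet_Ioc h1
      rwa [setLIntegral_const, Real.volume_Ioc, show 2 * τ - τ = τ by ring] at h3
    rw [e2]
    refine le_trans (le_of_eq ?_) (mul_le_mul_right h2 _)
    have e3 : (2 : ℝ) ^ (2 * θ + 1) * ((2 * τ) ^ (-2 * θ - 1) * τ) = τ ^ (-2 * θ) := by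
      rw [Real.mul_rpow two_pos.le hτ0.le, mul_assoc, ← Real.rpow_add_one hτ0.ne', ← mul_assoc,
        ← Real.rpow_add two_pos]
      ring_nf
      simp
    rw [← e3, ENNReal.ofReal_mul (by positivity), ENNReal.ofReal_mul (by positivity)]
    ring
  refine (Finset.sum_le_sum fun i _ => hstep i).trans ?_
  rw [← Finset.mul_sum]
  gcongr
  have hmono : Monotone fun i : ℕ => a * (2 : ℝ) ^ i := fun i j hij =>
    mul_le_mul_of_nonneg_left (pow_le_pow_right₀ one_le_two hij) ha.le
  have hdisj : Pairwise (Function.onFun Disjoint fun i : ℕ => Ioc (a * 2 ^ i) (a * 2 ^ (i + 1))) :=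
    hmono.pairwise_disjoint_on_Ioc_succ
  rw [← lintegral_biUnion_finset (hdisj.set_pairwise _) (fun i _ => measurableSet_Ioc)]
  refine lintegral_mono_set (iUnion₂_subset fun i _ t ht => ?_)
  exact lt_trans (show (0 : ℝ) < a * 2 ^ i by positivity) ht.1

theorem norm_integral_Ioc_sq_le {ψ : ℝ → V} (h : IsHalfSmooth ψ) {x : ℝ} (hx : 0 ≤ x) :
    ‖∫ t in (0 : ℝ)..x, ψ t‖ ^ 2 ≤ x * ‖h.toL2‖ ^ 2 := by
  have hm : AEStronglyMeasurable ψ (volume.restrict (Ioc 0 x)) :=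
    (h.memLp 2).1.mono_measure (Measure.restrict_mono Ioc_subset_Ioi_self le_rfl)
  have h1 := eLpNorm_le_eLpNorm_mul_rpow_measure_univ (p := 1) (q := 2) one_le_two hm
  have h2 : eLpNorm ψ 2 (volume.restrict (Ioc 0 x)) ≤ ‖h.toL2‖ₑ := by
    rw [Lp.enorm_def, eLpNorm_congr_ae h.coeFn_toL2]
    exact eLpNorm_mono_measure _ (Measure.restrict_mono Ioc_subset_Ioi_self le_rfl)
  have h3 : ‖∫ t in (0 : ℝ)..x, ψ t‖ₑ ≤ ‖h.toL2‖ₑ * ENNReal.ofReal x ^ (1 / 2 : ℝ) := by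
    rw [intervalIntegral.integral_of_le hx]
    refine (enorm_integral_le_lintegral_enorm _).trans ?_
    rw [← eLpNorm_one_eq_lintegral_enorm]
    refine h1.trans (mul_le_mul' h2 (le_of_eq ?_))
    rw [Measure.restrict_apply_univ, Real.volume_Ioc, sub_zero]
    congr 1
    norm_num
  have h4 : ‖∫ t in (0 : ℝ)..x, ψ t‖ₑ ^ 2 ≤ ENNReal.ofReal (x * ‖h.toL2‖ ^ 2) := by
    refine (pow_le_pow_left' h3 2).trans (le_of_eq ?_)
    rw [mul_pow, ← ENNReal.rpow_natCast (_ ^ (1 / 2 : ℝ)), ← ENNReal.rpow_mul,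
      ENNReal.ofReal_mul hx, enorm_sq_eq_ofReal, mul_comm]
    norm_num
  exact norm_sq_le_of_enorm_sq_le (by positivity) h4 le_rfl

theorem IsHalfSmooth.intervalIntegrable {ψ : ℝ → V} (h : IsHalfSmooth ψ) {x : ℝ} (hx : 0 ≤ x) :
    IntervalIntegrable ψ volume 0 x :=
  (h.continuousOn.mono fun t ht => by
    rw [uIcc_of_le hx] at ht
    exact ht.1).intervalIntegrable

theorem IsHalfSmooth.norm_sub_sq_le [CompleteSpace V] {ψ : ℝ → V} (h : IsHalfSmooth ψ) {x : ℝ}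
    (hx : 0 ≤ x) : ‖ψ x - ψ 0‖ ^ 2 ≤ x * ‖h.derivWithin.toL2‖ ^ 2 := by
  rw [← intervalIntegral.integral_eq_sub_of_hasDerivAt_of_le hx
    (h.continuousOn.mono fun t ht => ht.1)
    (fun t ht => hasDerivAt_derivWithin h.smooth ht.1) (h.derivWithin.intervalIntegrable hx)]
  exact norm_integral_Ioc_sq_le h.derivWithin hx

/-- The mean value over `(0, τ)`. -/
def mean (ψ : ℝ → V) (τ : ℝ) : V := τ⁻¹ • ∫ t in (0 : ℝ)..τ, ψ t

theorem norm_mean_sq_le {ψ : ℝ → V} (h : IsHalfSmooth ψ) {τ : ℝ} (hτ : 0 < τ) :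
    ‖mean ψ τ‖ ^ 2 ≤ τ⁻¹ * ‖h.toL2‖ ^ 2 := by
  rw [mean, norm_smul, mul_pow, Real.norm_of_nonneg (by positivity)]
  refine (mul_le_mul_of_nonneg_left (norm_integral_Ioc_sq_le h hτ.le) (by positivity)).trans_eq ?_
  field_simp

theorem norm_mean_sub_sq_le [CompleteSpace V] {ψ : ℝ → V} (h : IsHalfSmooth ψ) {τ : ℝ}
    (hτ : 0 < τ) : ‖mean ψ τ - ψ 0‖ ^ 2 ≤ τ * ‖h.derivWithin.toL2‖ ^ 2 := by
  have e : mean ψ τ - ψ 0 = τ⁻¹ • ∫ t in (0 : ℝ)..τ, (ψ t - ψ 0) := by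
    rw [intervalIntegral.integral_sub (h.intervalIntegrable hτ.le) intervalIntegrable_const,
      intervalIntegral.integral_const, sub_zero, smul_sub, smul_smul, inv_mul_cancel₀ hτ.ne',
      one_smul, mean]
  have h1 : ‖∫ t in (0 : ℝ)..τ, (ψ t - ψ 0)‖ ≤ √(τ * ‖h.derivWithin.toL2‖ ^ 2) * |τ - 0| := by
    refine intervalIntegral.norm_integral_le_of_norm_le_const fun t ht => ?_
    rw [uIoc_of_le hτ.le] at ht
    exact Real.le_sqrt_of_sq_le ((h.norm_sub_sq_le ht.1.le).trans
      (mul_le_mul_of_nonneg_right ht.2 (sq_nonneg _)))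
  rw [sub_zero, abs_of_pos hτ] at h1
  have h2 : ‖mean ψ τ - ψ 0‖ ≤ √(τ * ‖h.derivWithin.toL2‖ ^ 2) := by
    rw [e, norm_smul, Real.norm_of_nonneg (by positivity), inv_mul_le_iff₀ hτ, mul_comm]
    exact h1
  exact (Real.le_sqrt (norm_nonneg _) (by positivity)).1 h2

theorem clm_mean {ψ : ℝ → H} (h : IsHalfSmooth ψ) (T : H →L[ℂ] H) {τ : ℝ} (hτ : 0 < τ) :
    T (mean ψ τ) = mean (fun t => T (ψ t)) τ := by
  rw [mean, mean, ← Complex.coe_smul, map_smul, Complex.coe_smul,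
    ContinuousLinearMap.intervalIntegral_comp_comm T (h.intervalIntegrable hτ.le)]

theorem mean_add {ψ χ : ℝ → V} (h : IsHalfSmooth ψ) (h' : IsHalfSmooth χ) {τ : ℝ} (hτ : 0 < τ) :
    mean (fun t => ψ t + χ t) τ = mean ψ τ + mean χ τ := by
  rw [mean, mean, mean, intervalIntegral.integral_add (h.intervalIntegrable hτ.le)
    (h'.intervalIntegrable hτ.le), smul_add]

theorem mean_congr {ψ χ : ℝ → V} (h : ∀ x, 0 ≤ x → ψ x = χ x) {τ : ℝ} (hτ : 0 < τ) :
    mean ψ τ = mean χ τ := by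
  rw [mean, mean, intervalIntegral.integral_congr fun t ht => ?_]
  rw [uIcc_of_le hτ.le] at ht
  exact h t ht.1

theorem tendsto_mean [CompleteSpace V] {ψ : ℝ → V} (h : IsHalfSmooth ψ) :
    Filter.Tendsto (mean ψ) (nhdsWithin 0 (Ioi 0)) (nhds (ψ 0)) := by
  rw [tendsto_iff_norm_sub_tendsto_zero]
  have hlim : Filter.Tendsto (fun τ : ℝ => √(τ * ‖h.derivWithin.toL2‖ ^ 2))
      (nhdsWithin 0 (Ioi 0)) (nhds 0) := by
    have : Continuous fun τ : ℝ => √(τ * ‖h.derivWithin.toL2‖ ^ 2) := by fun_prop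
    simpa using (this.tendsto 0).mono_left nhdsWithin_le_nhds
  refine squeeze_zero' (Filter.Eventually.of_forall fun _ => norm_nonneg _) ?_ hlim
  filter_upwards [self_mem_nhdsWithin] with τ hτ
  exact Real.le_sqrt_of_sq_le (norm_mean_sub_sq_le h hτ)

theorem norm_mean_le {ψ : ℝ → V} {C : ℝ} (hC : ∀ x, 0 ≤ x → ‖ψ x‖ ≤ C) {τ : ℝ} (hτ : 0 < τ) :
    ‖mean ψ τ‖ ≤ C := by
  have h1 : ‖∫ t in (0 : ℝ)..τ, ψ t‖ ≤ C * |τ - 0| := by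
    refine intervalIntegral.norm_integral_le_of_norm_le_const fun t ht => ?_
    rw [uIoc_of_le hτ.le] at ht
    exact hC t ht.1.le
  rw [sub_zero, abs_of_pos hτ] at h1
  rw [mean, norm_smul, Real.norm_of_nonneg (by positivity), inv_mul_le_iff₀ hτ, mul_comm]
  exact h1

theorem norm_integral_inner_le {ψ χ : ℝ → V} (h : IsHalfSmooth ψ) (h' : IsHalfSmooth χ) :
    ‖∫ x in Ioi 0, ⟪ψ x, χ x⟫_ℂ‖ ≤ ‖h.toL2‖ * ‖h'.toL2‖ := by
  have e : ∫ x in Ioi 0, ⟪ψ x, χ x⟫_ℂ = ⟪h.toL2, h'.toL2⟫_ℂ := by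
    rw [L2.inner_def]
    refine integral_congr_ae ?_
    filter_upwards [h.coeFn_toL2, h'.coeFn_toL2] with x h1 h2
    rw [h1, h2]
  rw [e]
  exact norm_inner_le_norm _ _

theorem IsHalfSmooth.integrable_inner {ψ χ : ℝ → V} (h : IsHalfSmooth ψ) (h' : IsHalfSmooth χ) :
    IntegrableOn (fun x => ⟪ψ x, χ x⟫_ℂ) (Ioi 0) := by
  have := L2.integrable_inner (𝕜 := ℂ) h.toL2 h'.toL2
  refine this.congr ?_
  filter_upwards [h.coeFn_toL2, h'.coeFn_toL2] with x h1 h2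
  rw [h1, h2]

theorem integral_inner_derivWithin [CompleteSpace V] {ψ χ : ℝ → V} (h : IsHalfSmooth ψ)
    (h' : IsHalfSmooth χ) : ∫ x in Ioi 0, ⟪ψ x, derivWithin χ (Ici 0) x⟫_ℂ =
      -⟪ψ 0, χ 0⟫_ℂ - ∫ x in Ioi 0, ⟪derivWithin ψ (Ici 0) x, χ x⟫_ℂ := by
  have hcont : ContinuousOn (fun x => ⟪ψ x, χ x⟫_ℂ) (Ici 0) := h.continuousOn.inner h'.continuousOn
  have i1 := h.integrable_inner h'.derivWithin
  have i2 := h.derivWithin.integrable_inner h'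
  have hlim : Filter.Tendsto (fun x => ⟪ψ x, χ x⟫_ℂ) Filter.atTop (nhds 0) := by
    simpa using h.tendsto_zero.inner h'.tendsto_zero (𝕜 := ℂ)
  have key := integral_Ioi_of_hasDerivAt_of_tendsto (hcont 0 self_mem_Ici)
    (fun x hx => (hasDerivAt_derivWithin h.smooth hx).inner ℂ (hasDerivAt_derivWithin h'.smooth hx))
    (i1.add i2) hlim
  rw [integral_add i1 i2, zero_sub] at key
  exact eq_sub_of_add_eq key

/-- The boundary value at `0` in the norm of `H_(-1/2)`, by integration by parts. -/
theorem IsResolvent.norm_boundary_sq {R : H →L[ℂ] H} (hR : IsResolvent R) {χ : ℝ → H}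
    (h : IsHalfSmooth χ) : ‖halfPow R (1 / 2) (χ 0)‖ ^ 2 =
      -2 * (∫ x in Ioi 0, ⟪halfPow R 1 (χ x), derivWithin χ (Ici 0) x⟫_ℂ).re := by
  have hQ : ∀ x y, ⟪halfPow R (1 / 2) x, halfPow R (1 / 2) y⟫_ℂ = ⟪halfPow R 1 x, y⟫_ℂ := by
    intro x y
    rw [← halfPow_inner_comm, ← hR.halfPow_add (by norm_num) (by norm_num)]
    norm_num
  have key := integral_inner_derivWithin (h.clm_comp (halfPow R 1)) h
  have h3 : ∫ x in Ioi 0, ⟪derivWithin (fun y => halfPow R 1 (χ y)) (Ici 0) x, χ x⟫_ℂ =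
      (starRingEnd ℂ) (∫ x in Ioi 0, ⟪halfPow R 1 (χ x), derivWithin χ (Ici 0) x⟫_ℂ) := by
    rw [← integral_conj]
    refine setIntegral_congr_fun measurableSet_Ioi fun x hx => ?_
    rw [derivWithin_clm_comp h.smooth _ (le_of_lt hx), halfPow_inner_comm, inner_conj_symm]
  rw [h3, ← hQ, inner_self_eq_norm_sq_to_K, ← RCLike.ofReal_pow] at key
  have key2 := congrArg Complex.re key
  have e : ((RCLike.ofReal (‖halfPow R (1 / 2) (χ 0)‖ ^ 2) : ℂ)).re =
      ‖halfPow R (1 / 2) (χ 0)‖ ^ 2 := Complex.ofReal_re _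
  rw [Complex.sub_re, Complex.neg_re, Complex.conj_re, e] at key2
  linarith

variable {A : H →ₗ.[ℂ] H}

/-- The trace estimate for integral order. -/
theorem enorm_trace_sq_le_int (hA : IsSelfAdjoint A) (n : ℕ) {φ : ℝ → H} (hφ : IsSmoothCompact A φ)
    {f : L2 H} (hf : f =ᵐ[halfLine] φ) {z : H}
    (hz : halfPow (invOneAddSq A) (n + 1 / 2) z = φ 0) :
    ‖z‖ₑ ^ 2 ≤ 2 * 2 ^ (n + 1) * intNormSq A (n + 1) f := by
  have hR := isResolvent_invOneAddSq hA
  set R := invOneAddSq A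
  have hn : (0 : ℝ) ≤ n := n.cast_nonneg
  obtain ⟨χ, h, hχ⟩ := hφ.exists_lift hA (s := n + 1) (by positivity)
  have hz' : z = halfPow R (1 / 2) (χ 0) := by
    refine hR.halfPow_injective (s := n + 1 / 2) (by positivity) ?_
    rw [hz, ← hR.halfPow_add (by positivity) (by norm_num), ← hχ 0 le_rfl]
    congr 2
    ring
  have h1 := h.clm_comp (halfPow R 1)
  have e1 : ∫ x in Ioi 0, ⟪halfPow R 1 (χ x), derivWithin χ (Ici 0) x⟫_ℂ =
      ∫ x in Ioi 0, ⟪χ x, derivWithin (fun y => halfPow R 1 (χ y)) (Ici 0) x⟫_ℂ := by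
    refine setIntegral_congr_fun measurableSet_Ioi fun x hx => ?_
    rw [derivWithin_clm_comp h.smooth _ (le_of_lt hx), halfPow_inner_comm]
  have h2 : ‖z‖ ^ 2 ≤ ‖h.toL2‖ ^ 2 + ‖h1.derivWithin.toL2‖ ^ 2 := by
    rw [hz', hR.norm_boundary_sq h, e1]
    have := (Complex.abs_re_le_norm _).trans (norm_integral_inner_le h h1.derivWithin)
    nlinarith [(abs_le.1 this).1, sq_nonneg (‖h.toL2‖ - ‖h1.derivWithin.toL2‖)]
  have h3 : ‖z‖ₑ ^ 2 ≤ ‖h.toL2‖ₑ ^ 2 + ‖h1.derivWithin.toL2‖ₑ ^ 2 := by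
    simp only [enorm_sq_eq_ofReal]
    rw [← ENNReal.ofReal_add (by positivity) (by positivity)]
    exact ENNReal.ofReal_le_ofReal h2
  have k1 : ‖h.toL2‖ₑ ^ 2 ≤ 2 ^ (n + 1) * intNormSq A (n + 1) f := by
    have := le_derivNormSq_of_lift hA (l := 0) (j := n + 1) (f := f) h (by
      filter_upwards [hf, ae_restrict_mem measurableSet_Ioi] with x hx hx0
      rw [hx, ← hχ x (le_of_lt hx0)]
      push_cast
      rfl)
    have e : (h.hderiv 0).toL2 = h.toL2 := by
      refine Lp.ext ?_
      filter_upwards [(h.hderiv 0).coeFn_toL2, h.coeFn_toL2] with x h1 h2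
      rw [h1, h2, hderiv, iteratedDerivWithin_zero]
    rw [e] at this
    exact this.trans (mul_le_mul_right (derivNormSq_le_intNormSq (by omega) f) _)
  have k2 : ‖h1.derivWithin.toL2‖ₑ ^ 2 ≤ 2 ^ (n + 1) * intNormSq A (n + 1) f := by
    have := le_derivNormSq_of_lift hA (l := 1) (j := n) (f := f) h1 (by
      filter_upwards [hf, ae_restrict_mem measurableSet_Ioi] with x hx hx0
      rw [hx, ← hχ x (le_of_lt hx0), ← hR.halfPow_add hn zero_le_one])
    have e : (h1.hderiv 1).toL2 = h1.derivWithin.toL2 := by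
      refine Lp.ext ?_
      filter_upwards [(h1.hderiv 1).coeFn_toL2, h1.derivWithin.coeFn_toL2] with x h1 h2
      rw [h1, h2, hderiv, iteratedDerivWithin_one]
    rw [e] at this
    refine this.trans (mul_le_mul' (pow_le_pow_right₀ one_le_two (Nat.le_succ n))
      (derivNormSq_le_intNormSq (by omega) f))
  refine h3.trans ((add_le_add k1 k2).trans (le_of_eq ?_))
  ring

end Trace

/-! ### Interpolation of the trace estimates -/

section InterpTrace

variable {H : Type*} [NormedAddCommGroup H] [InnerProductSpace ℂ H] [CompleteSpace H]
variable {A : H →ₗ.[ℂ] H}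

theorem IsSmoothCompact.sub {φ φ' : ℝ → H} (h : IsSmoothCompact A φ) (h' : IsSmoothCompact A φ') :
    IsSmoothCompact A (fun x => φ x - φ' x) where
  smooth s hs := by
    obtain ⟨Φ, h1, h2⟩ := h.smooth s hs
    obtain ⟨Φ', h1', h2'⟩ := h'.smooth s hs
    exact ⟨fun x => Φ x - Φ' x, h1.sub h1', fun x hx => by rw [map_sub, h2 x hx, h2' x hx]⟩
  compact := by
    obtain ⟨b, hb⟩ := h.compact
    obtain ⟨b', hb'⟩ := h'.compact
    refine ⟨max b b', fun x hx => ?_⟩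
    rw [hb x ((le_max_left _ _).trans hx), hb' x ((le_max_right _ _).trans hx), sub_zero]

theorem coeFn_sub_ae {f u : L2 H} {φ φ' : ℝ → H} (hf : f =ᵐ[halfLine] φ)
    (hu : u =ᵐ[halfLine] φ') : (f - u : L2 H) =ᵐ[halfLine] fun x => φ x - φ' x := by
  filter_upwards [hf, hu, Lp.coeFn_sub f u] with x h1 h2 h3
  rw [h3, Pi.sub_apply, h1, h2]

/-- In the `K`-functional the decomposition may be taken to be smooth. -/
theorem exists_smooth_decomposition (hA : IsSelfAdjoint A) (n : ℕ) (f : L2 H) {t m : ℝ}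
    (hm : ⨅ f₁, (intNormSq A n (f - f₁) + ENNReal.ofReal (t ^ 2) * intNormSq A (n + 1) f₁) <
      ENNReal.ofReal m) (ht : 0 < t) :
    ∃ (u : L2 H) (φ : ℝ → H), IsSmoothCompact A φ ∧ u =ᵐ[halfLine] φ ∧
      intNormSq A n (f - u) ≤ ENNReal.ofReal (3 * m) ∧
      ENNReal.ofReal (t ^ 2) * intNormSq A (n + 1) u ≤ ENNReal.ofReal (3 * m) := by
  have h0 := isQuasiSq_int A n
  have h1 := isQuasiSq_int A (n + 1)
  obtain ⟨f₁, hf₁⟩ := iInf_lt_iff.1 hm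
  set M := ENNReal.ofReal m with hM
  have hM0 : 0 < M := bot_le.trans_lt hf₁
  set T := ENNReal.ofReal (t ^ 2) with hT
  have hT0 : T ≠ 0 := (ENNReal.ofReal_pos.2 (by positivity)).ne'
  have hTt : T ≠ ⊤ := ENNReal.ofReal_ne_top
  set c : ℝ≥0∞ := 2 * 2 ^ (n + 1) with hc
  have hct : c ≠ ⊤ := by finiteness
  have a0 : intNormSq A n (f - f₁) ≤ M := le_self_add.trans hf₁.le
  have a1 : T * intNormSq A (n + 1) f₁ ≤ M := le_add_self.trans hf₁.le
  have hfin : intNormSq A (n + 1) f₁ < ⊤ :=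
    ENNReal.lt_top_of_mul_ne_top_right (a1.trans_lt ENNReal.ofReal_lt_top).ne hT0
  -- the error of the smooth approximation of `f₁`, small in both norms of the couple
  set ε := M / (2 * (c + T)) with hε
  have hcT : 2 * (c + T) ≠ ⊤ := by finiteness
  have hcT0 : 2 * (c + T) ≠ 0 := by simp [hT0]
  have hε0 : 0 < ε := ENNReal.div_pos hM0.ne' hcT
  have hεM : 2 * ((c + T) * ε) = M := by
    rw [← mul_assoc, hε, ENNReal.mul_div_cancel hcT0 hcT]
  obtain ⟨u, ⟨φ, hφ, hu⟩, hε1⟩ := exists_smooth_near_int hA hfin hε0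
  have e3 : ENNReal.ofReal (3 * m) = 2 * M + M := by
    rw [ENNReal.ofReal_mul (by norm_num), ENNReal.ofReal_ofNat, ← hM]
    ring
  refine ⟨u, φ, hφ, hu, ?_, ?_⟩
  · have e : f - u = (f - f₁) + (f₁ - u) := by abel
    rw [e, e3]
    refine (h0.add_le _ _).trans ?_
    rw [mul_add]
    refine add_le_add (mul_le_mul_right a0 _) ?_
    rw [← hεM]
    refine mul_le_mul_right ((intNormSq_le_succ hA n _).trans (mul_le_mul' ?_ hε1.le)) _
    exact le_self_add
  · have e : u = f₁ + -(f₁ - u) := by abel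
    nth_rw 1 [e]
    rw [e3]
    refine (mul_le_mul_right (h1.add_le _ _) _).trans ?_
    rw [mul_left_comm, mul_add, mul_add]
    refine add_le_add (mul_le_mul_right a1 _) ?_
    rw [← hεM]
    refine mul_le_mul_right (mul_le_mul' ?_ ((h1.neg _).trans hε1.le)) _
    exact le_add_self

/-- The real-valued form of `sum_le_interpNormSq`. -/
theorem sum_toReal_le_interpNormSq {E : Type*} [AddCommGroup E] {N₀ N₁ : E → ℝ≥0∞} {θ : ℝ}
    (hθ : 0 < θ) {f : E} (hI : interpNormSq N₀ N₁ θ f ≠ ⊤) {a : ℝ} (ha : 0 < a) (n : ℕ) :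
    ∑ i ∈ Finset.range n, (a * 2 ^ i) ^ (-2 * θ) *
      (⨅ f₁ : E, (N₀ (f - f₁) + ENNReal.ofReal ((a * 2 ^ i) ^ 2) * N₁ f₁)).toReal ≤
        2 ^ (2 * θ + 1) * (interpNormSq N₀ N₁ θ f).toReal := by
  have h := sum_le_interpNormSq N₀ N₁ hθ f ha n
  have hfin : ENNReal.ofReal (2 ^ (2 * θ + 1)) * interpNormSq N₀ N₁ θ f ≠ ⊤ :=
    ENNReal.mul_ne_top ENNReal.ofReal_ne_top hI
  have h2 := ENNReal.toReal_mono hfin h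
  rw [ENNReal.toReal_sum (fun i hi => (lt_of_le_of_lt (Finset.single_le_sum
    (f := fun i : ℕ => ENNReal.ofReal ((a * 2 ^ i) ^ (-2 * θ)) *
      ⨅ f₁ : E, (N₀ (f - f₁) + ENNReal.ofReal ((a * 2 ^ i) ^ 2) * N₁ f₁))
    (fun _ _ => bot_le) hi) (h.trans_lt hfin.lt_top)).ne), ENNReal.toReal_mul,
    ENNReal.toReal_ofReal (by positivity)] at h2
  refine le_trans (le_of_eq (Finset.sum_congr rfl fun i _ => ?_)) h2
  rw [ENNReal.toReal_mul, ENNReal.toReal_ofReal (by positivity)]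

theorem kFunctional_ne_top {φ : ℝ → H} (hA : IsSelfAdjoint A) (hφ : IsSmoothCompact A φ) {f : L2 H}
    (hf : f =ᵐ[halfLine] φ) (n : ℕ) (t : ℝ) :
    ⨅ f₁, (intNormSq A n (f - f₁) + ENNReal.ofReal (t ^ 2) * intNormSq A (n + 1) f₁) ≠ ⊤ := by
  refine ((iInf_le _ 0).trans_lt ?_).ne
  rw [sub_zero, (isQuasiSq_int A (n + 1)).zero, mul_zero, add_zero]
  exact hφ.intNormSq_lt_top hA hf n

theorem interpNormSq_int_ne_top {φ : ℝ → H} (hA : IsSelfAdjoint A) (hφ : IsSmoothCompact A φ)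
    {f : L2 H} (hf : f =ᵐ[halfLine] φ) (n : ℕ) {θ : ℝ} (h0 : 0 < θ) (h1 : θ < 1) :
    interpNormSq (intNormSq A n) (intNormSq A (n + 1)) θ f ≠ ⊤ := by
  refine ((interpNormSq_le (isQuasiSq_int A n) (isQuasiSq_int A (n + 1)) (intNormSq_le_succ hA n)
    θ f).trans_lt (ENNReal.mul_lt_top (lintegral_interp_weight_lt_top h0 h1)
      (ENNReal.mul_lt_top (by finiteness) (hφ.intNormSq_lt_top hA hf _)))).ne

theorem inv_rpow_sq_mul {τ p θ c : ℝ} (hτ : 0 < τ) (hc : -2 * p + c = -2 * θ) :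
    (τ ^ p)⁻¹ ^ 2 * τ ^ c = τ ^ (-2 * θ) := by
  rw [← hc, Real.rpow_add hτ, ← Real.rpow_neg hτ.le, ← Real.rpow_natCast, ← Real.rpow_mul hτ.le]
  congr 2
  push_cast
  ring

/-- The conclusion of the abstract trace estimate in terms of the interpolation norm. -/
theorem enorm_sq_le_interp {E : Type*} [AddCommGroup E] {N₀ N₁ : E → ℝ≥0∞} {f : E}
    {R : H →L[ℂ] H} (hR : IsResolvent R) {p θ c d M : ℝ} (hp : 0 < p) (hp1 : p ≤ 1) (hθ : 0 < θ)
    (hd : 0 ≤ d) (hc : -2 * p + c = -2 * θ) (hI : interpNormSq N₀ N₁ θ f ≠ ⊤)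
    {z : H} {B : ℝ → H}
    (hB : ∀ τ, 0 < τ → ‖B τ‖ ≤ M) (hz : Filter.Tendsto B (nhdsWithin 0 (Ioi 0)) (nhds z))
    (h : ∀ τ, 0 < τ → ∀ m,
      (⨅ f₁, (N₀ (f - f₁) + ENNReal.ofReal (τ ^ 2) * N₁ f₁)).toReal < m →
      ∃ b₀ b₁, halfPow R p (B τ) = b₀ + halfPow R 1 b₁ ∧
      ‖b₀‖ ^ 2 ≤ d * τ ^ c * m ∧ τ ^ 2 * ‖b₁‖ ^ 2 ≤ d * τ ^ c * m ∧
      ‖halfPow R p (B τ) - halfPow R p (B (2 * τ))‖ ^ 2 ≤ d * τ ^ c * m) :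
    ‖z‖ₑ ^ 2 ≤ ENNReal.ofReal (64 / p * (d * 2 ^ (2 * θ + 1))) * interpNormSq N₀ N₁ θ f := by
  rcases hd.eq_or_lt with rfl | hd
  · have : ‖z‖ ^ 2 ≤ 64 / p * 0 := by
      refine hR.norm_sq_le_of_dyadic hp hp1 (κ := fun _ => 0) hB hz (fun τ hτ q hq => ?_) (by simp)
      obtain ⟨b₀, b₁, h1, h2, h3, h4⟩ := h τ hτ _ (lt_add_one _)
      simp only [zero_mul] at h2 h3 h4
      exact ⟨b₀, b₁, h1, h2.trans hq.le, h3.trans hq.le, h4.trans hq.le⟩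
    have hz0 : z = 0 := by
      rw [mul_zero] at this
      exact norm_eq_zero.1 (pow_eq_zero_iff two_ne_zero |>.1 (le_antisymm this (sq_nonneg _)))
    simp [hz0]
  set K : ℝ → ℝ := fun t => (⨅ f₁, (N₀ (f - f₁) + ENNReal.ofReal (t ^ 2) * N₁ f₁)).toReal
  have key : ‖z‖ ^ 2 ≤ 64 / p * (d * (2 ^ (2 * θ + 1) * (interpNormSq N₀ N₁ θ f).toReal)) := by
    refine hR.norm_sq_le_of_dyadic hp hp1 (κ := fun τ => d * τ ^ c * K τ) hB hz
      (fun τ hτ q hq => ?_) (fun a ha n => ?_)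
    · have hpos : 0 < d * τ ^ c := by positivity
      obtain ⟨b₀, b₁, h1, h2, h3, h4⟩ := h τ hτ (q / (d * τ ^ c)) (by
        rw [lt_div_iff₀ hpos, mul_comm]; exact hq)
      rw [mul_div_cancel₀ _ hpos.ne'] at h2 h3 h4
      exact ⟨b₀, b₁, h1, h2, h3, h4⟩
    · refine le_trans (le_of_eq ?_) (mul_le_mul_of_nonneg_left
        (sum_toReal_le_interpNormSq hθ hI ha n) hd.le)
      rw [Finset.mul_sum]
      refine Finset.sum_congr rfl fun i _ => ?_
      rw [← inv_rpow_sq_mul (show 0 < a * 2 ^ i by positivity) hc]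
      ring
  rw [enorm_sq_eq_ofReal, ← ENNReal.ofReal_toReal hI, ← ENNReal.ofReal_mul (by positivity)]
  refine ENNReal.ofReal_le_ofReal (key.trans (le_of_eq ?_))
  ring

/-- The trace estimate for the order `n + 1 + θ`. -/
theorem enorm_trace_sq_le_succ (hA : IsSelfAdjoint A) (n : ℕ) {θ : ℝ} (h0 : 0 < θ) (h1 : θ < 1) :
    ∃ C : ℝ≥0, ∀ φ : ℝ → H, IsSmoothCompact A φ → ∀ f : L2 H, f =ᵐ[halfLine] φ → ∀ z : H,
      halfPow (invOneAddSq A) (n + 1 / 2 + θ) z = φ 0 →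
      ‖z‖ₑ ^ 2 ≤ C * interpNormSq (intNormSq A (n + 1)) (intNormSq A (n + 1 + 1)) θ f := by
  have hR := isResolvent_invOneAddSq hA
  have hn : (0 : ℝ) ≤ n := n.cast_nonneg
  set d : ℝ := 2 * 2 ^ (n + 2) * 3 with hd
  refine ⟨(64 / θ * (d * 2 ^ (2 * θ + 1))).toNNReal, fun φ hφ f hf z hz => ?_⟩
  have hI := interpNormSq_int_ne_top hA hφ hf (n + 1) h0 h1
  -- `f = (f - u) + u` splits `R^(θ/2) z` into `ψ₀ 0` and `R^(1/2) (ψ₁ 0)`, which are estimated by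
  -- the integral orders `n + 1` and `n + 2`; the comparison function `B` is constant
  refine enorm_sq_le_interp hR h0 h1.le h0 (by positivity) (c := 0) (by ring) hI
    (B := fun _ => z) (M := ‖z‖) (fun _ _ => le_rfl) tendsto_const_nhds fun τ hτ m hm => ?_
  have hm0 : 0 ≤ m := ENNReal.toReal_nonneg.trans hm.le
  rw [Real.rpow_zero, mul_one]
  obtain ⟨u, φ₁, hφ₁, hu, k0, k1⟩ := exists_smooth_decomposition hA (n + 1) f
    ((ENNReal.lt_ofReal_iff_toReal_lt (kFunctional_ne_top hA hφ hf _ _)).2 hm) hτ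
  obtain ⟨ψ₀, hψ₀, e0⟩ := (hφ.sub hφ₁).exists_lift hA (s := n + 1 / 2) (by positivity)
  obtain ⟨ψ₁, hψ₁, e1⟩ := hφ₁.exists_lift hA (s := (n + 1 : ℕ) + 1 / 2) (by positivity)
  have t0 := enorm_trace_sq_le_int hA n (hφ.sub hφ₁) (coeFn_sub_ae hf hu) (e0 0 le_rfl)
  have t1 := enorm_trace_sq_le_int hA (n + 1) hφ₁ hu (e1 0 le_rfl)
  have c0 : ∀ k : ℕ, ENNReal.ofReal (2 * 2 ^ k) = 2 * 2 ^ k := fun k => by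
    rw [ENNReal.ofReal_mul two_pos.le, ENNReal.ofReal_pow two_pos.le, ENNReal.ofReal_ofNat]
  refine ⟨ψ₀ 0, ψ₁ 0, ?_, ?_, ?_, ?_⟩
  · refine hR.halfPow_injective (s := n + 1 / 2) (by positivity) ?_
    rw [map_add, e0 0 le_rfl, ← hR.halfPow_add (by positivity) h0.le, hz,
      ← hR.halfPow_add (by positivity) zero_le_one]
    have := e1 0 le_rfl
    push_cast at this
    rw [show (n : ℝ) + 1 / 2 + 1 = n + 1 + 1 / 2 by ring, this]
    abel
  · refine norm_sq_le_of_enorm_sq_le (by positivity) (t0.trans (mul_le_mul_right k0 _)) ?_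
    rw [← c0, ← ENNReal.ofReal_mul (by positivity)]
    refine ENNReal.ofReal_le_ofReal ?_
    rw [hd, ← mul_assoc]
    gcongr ?_ * 3 * m
    · gcongr 2 * 2 ^ ?_ <;> norm_num
  · have h2 := (mul_le_mul_right t1 (ENNReal.ofReal (τ ^ 2)))
    rw [mul_left_comm] at h2
    have h3 := h2.trans (mul_le_mul_right k1 _)
    rw [enorm_sq_eq_ofReal, ← c0, ← ENNReal.ofReal_mul (by positivity),
      ← ENNReal.ofReal_mul (by positivity), ENNReal.ofReal_le_ofReal_iff (by positivity)] at h3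
    refine h3.trans_eq ?_
    rw [hd]
    ring
  · refine le_trans (le_of_eq (by simp)) (show 0 ≤ d * m by positivity)

/-- The trace estimate for the order `1/2 < θ < 1`. Here `H_(θ - 1/2)` is reached from mean values
over `(0, τ)`. -/
theorem enorm_trace_sq_le_zero (hA : IsSelfAdjoint A) {θ : ℝ} (h0 : 1 / 2 < θ) (h1 : θ < 1) :
    ∃ C : ℝ≥0, ∀ φ : ℝ → H, IsSmoothCompact A φ → ∀ f : L2 H, f =ᵐ[halfLine] φ → ∀ z : H,
      halfPow (invOneAddSq A) (θ - 1 / 2) z = φ 0 →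
      ‖z‖ₑ ^ 2 ≤ C * interpNormSq (intNormSq A 0) (intNormSq A (0 + 1)) θ f := by
  have hR := isResolvent_invOneAddSq hA
  set R := invOneAddSq A
  set p := θ - 1 / 2 with hp
  have hp0 : 0 < p := by linarith
  refine ⟨(64 / p * (60 * 2 ^ (2 * θ + 1))).toNNReal, fun φ hφ f hf z hz => ?_⟩
  have hI := interpNormSq_int_ne_top hA hφ hf 0 (by linarith) h1
  obtain ⟨ψ, hψ, e⟩ := hφ.exists_lift hA hp0.le
  have hzψ : z = ψ 0 := hR.halfPow_injective hp0.le (hz.trans (e 0 le_rfl).symm)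
  obtain ⟨M, hM⟩ := hψ.exists_bound
  refine enorm_sq_le_interp hR hp0 (by linarith) (by linarith) (by norm_num) (c := -1)
    (by rw [hp]; ring) hI (B := mean ψ) (M := M) (fun τ hτ => norm_mean_le hM hτ)
    (hzψ ▸ tendsto_mean hψ) fun τ hτ m hm => ?_
  have hm0 : 0 ≤ m := ENNReal.toReal_nonneg.trans hm.le
  rw [Real.rpow_neg_one]
  obtain ⟨u, φ₁, hφ₁, hu, k0, k1⟩ := exists_smooth_decomposition hA 0 f
    ((ENNReal.lt_ofReal_iff_toReal_lt (kFunctional_ne_top hA hφ hf _ _)).2 hm) hτ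
  have g0 := (hφ.sub hφ₁).isHalfSmooth hA
  have g1 := hφ₁.isHalfSmooth hA
  obtain ⟨χ, hχ, eχ⟩ := hφ₁.exists_lift hA zero_le_one
  have l0 : ‖g0.toL2‖ ^ 2 ≤ 3 * m := by
    have := le_derivNormSq_of_lift hA (l := 0) (j := 0) (f := f - u) g0 (by
      filter_upwards [coeFn_sub_ae hf hu] with x hx
      rw [hx, Nat.cast_zero, hR.halfPow_zero]
      rfl)
    have e : (g0.hderiv 0).toL2 = g0.toL2 := by
      refine Lp.ext ?_
      filter_upwards [(g0.hderiv 0).coeFn_toL2, g0.coeFn_toL2] with x h1 h2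
      rw [h1, h2, hderiv, iteratedDerivWithin_zero]
    rw [e, pow_zero, one_mul] at this
    exact norm_sq_le_of_enorm_sq_le (by positivity)
      (this.trans (derivNormSq_le_intNormSq (n := 0) (by omega) _)) k0
  have l1 : τ ^ 2 * ‖hχ.toL2‖ ^ 2 ≤ 6 * m := by
    have := le_derivNormSq_of_lift hA (l := 0) (j := 1) (f := u) hχ (by
      filter_upwards [hu, ae_restrict_mem measurableSet_Ioi] with x hx hx0
      rw [hx, Nat.cast_one, eχ x (le_of_lt hx0)])
    have e : (hχ.hderiv 0).toL2 = hχ.toL2 := by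
      refine Lp.ext ?_
      filter_upwards [(hχ.hderiv 0).coeFn_toL2, hχ.coeFn_toL2] with x h1 h2
      rw [h1, h2, hderiv, iteratedDerivWithin_zero]
    rw [e, pow_one] at this
    have h2 := mul_le_mul_right (this.trans (mul_le_mul_right
      (derivNormSq_le_intNormSq (n := 0 + 1) (by omega) u) 2)) (ENNReal.ofReal (τ ^ 2))
    rw [mul_left_comm] at h2
    have h3 := h2.trans (mul_le_mul_right k1 _)
    rw [enorm_sq_eq_ofReal, ← ENNReal.ofReal_mul (by positivity)] at h3
    have e2 : (2 : ℝ≥0∞) * ENNReal.ofReal (3 * m) = ENNReal.ofReal (2 * (3 * m)) := by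
      rw [ENNReal.ofReal_mul two_pos.le, ENNReal.ofReal_ofNat]
    rw [e2, ENNReal.ofReal_le_ofReal_iff (by positivity)] at h3
    linarith
  have l2 : τ ^ 2 * ‖g1.derivWithin.toL2‖ ^ 2 ≤ 3 * m := by
    have := le_derivNormSq_of_lift hA (l := 1) (j := 0) (f := u) g1 (by
      filter_upwards [hu] with x hx
      rw [hx, Nat.cast_zero, hR.halfPow_zero]
      rfl)
    have e : (g1.hderiv 1).toL2 = g1.derivWithin.toL2 := by
      refine Lp.ext ?_
      filter_upwards [(g1.hderiv 1).coeFn_toL2, g1.derivWithin.coeFn_toL2] with x h1 h2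
      rw [h1, h2, hderiv, iteratedDerivWithin_one]
    rw [e, pow_zero, one_mul] at this
    have h3 := (mul_le_mul_right (this.trans
      (derivNormSq_le_intNormSq (n := 0 + 1) (by omega) u)) (ENNReal.ofReal (τ ^ 2))).trans k1
    rwa [enorm_sq_eq_ofReal, ← ENNReal.ofReal_mul (by positivity),
      ENNReal.ofReal_le_ofReal_iff (by positivity)] at h3
  -- There is no trace on `ℋ_0`: the values at `0` are replaced by mean values over `(0, τ)`, which
  -- cost `τ⁻¹` in the squared `L²` norm.
  have hmean : ∀ t : ℝ, 0 < t → halfPow R p (mean ψ t) =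
      mean (fun x => φ x - φ₁ x) t + mean φ₁ t := by
    intro t ht
    rw [clm_mean hψ _ ht, ← mean_add g0 g1 ht]
    refine mean_congr (fun x hx => ?_) ht
    rw [e x hx, sub_add_cancel]
  have h2τ : 0 < 2 * τ := by positivity
  refine ⟨mean (fun x => φ x - φ₁ x) τ, mean χ τ, ?_, ?_, ?_, ?_⟩
  · rw [hmean τ hτ, clm_mean hχ _ hτ, mean_congr eχ hτ]
  · refine (norm_mean_sq_le g0 hτ).trans ?_
    rw [mul_assoc, mul_left_comm]
    gcongr
    linarith
  · have h2 := norm_mean_sq_le hχ hτ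
    have h3 : τ ^ 2 * ‖mean χ τ‖ ^ 2 ≤ τ⁻¹ * (τ ^ 2 * ‖hχ.toL2‖ ^ 2) := by
      rw [mul_left_comm]
      gcongr
    have h4 := mul_le_mul_of_nonneg_left l1 (inv_pos.2 hτ).le
    have h5 := mul_nonneg (inv_pos.2 hτ).le hm0
    linarith
  · rw [hmean τ hτ, hmean _ h2τ]
    set a := mean (fun x => φ x - φ₁ x) τ
    set a' := mean (fun x => φ x - φ₁ x) (2 * τ)
    have b1 : ‖a‖ ^ 2 ≤ τ⁻¹ * (3 * m) := (norm_mean_sq_le g0 hτ).trans (by gcongr)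
    have b2 : ‖a'‖ ^ 2 ≤ τ⁻¹ * (3 * m) := (norm_mean_sq_le g0 h2τ).trans (by
      gcongr
      linarith)
    have e2 : ‖g1.derivWithin.toL2‖ ^ 2 * τ ≤ τ⁻¹ * (3 * m) := by
      rw [inv_mul_eq_div, le_div_iff₀ hτ]
      linarith
    have b3 : ‖mean φ₁ τ - φ₁ 0‖ ^ 2 ≤ τ⁻¹ * (3 * m) :=
      (norm_mean_sub_sq_le g1 hτ).trans (by linarith)
    have b4 : ‖mean φ₁ (2 * τ) - φ₁ 0‖ ^ 2 ≤ 2 * (τ⁻¹ * (3 * m)) :=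
      (norm_mean_sub_sq_le g1 h2τ).trans (by linarith)
    -- the means of `φ - φ₁` are small separately, those of `φ₁` are both close to `φ₁ 0`
    have e3 : a + mean φ₁ τ - (a' + mean φ₁ (2 * τ)) =
        (a - a') + ((mean φ₁ τ - φ₁ 0) - (mean φ₁ (2 * τ) - φ₁ 0)) := by abel
    rw [e3]
    have hsq : ∀ x y : H, ‖x - y‖ ^ 2 ≤ 2 * (‖x‖ ^ 2 + ‖y‖ ^ 2) := fun x y => by
      nlinarith [norm_sub_le x y, sq_nonneg (‖x‖ - ‖y‖), norm_nonneg (x - y)]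
    have hsq' : ∀ x y : H, ‖x + y‖ ^ 2 ≤ 2 * (‖x‖ ^ 2 + ‖y‖ ^ 2) := fun x y => by
      nlinarith [norm_add_le x y, sq_nonneg (‖x‖ - ‖y‖), norm_nonneg (x + y)]
    refine (hsq' _ _).trans ?_
    have := hsq a a'
    have := hsq (mean φ₁ τ - φ₁ 0) (mean φ₁ (2 * τ) - φ₁ 0)
    linarith

/-- The trace estimate on smooth functions: the norm of `φ 0` in `H_(s - 1/2)` is controlled by
the norm of `φ` in `ℋ_s`. -/
theorem enorm_trace_sq_le (hA : IsSelfAdjoint A) {s : ℝ} (hs : 1 / 2 < s) :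
    ∃ C : ℝ≥0, ∀ φ : ℝ → H, IsSmoothCompact A φ → ∀ f : L2 H, f =ᵐ[halfLine] φ → ∀ z : H,
      halfPow (invOneAddSq A) (s - 1 / 2) z = φ 0 → ‖z‖ₑ ^ 2 ≤ C * scaleNormSq A s f := by
  by_cases h : s = ⌊s⌋₊
  · obtain ⟨n, hn⟩ : ∃ n, ⌊s⌋₊ = n + 1 := by
      refine Nat.exists_eq_succ_of_ne_zero fun h0 => ?_
      rw [h0, Nat.cast_zero] at h
      linarith
    refine ⟨2 * 2 ^ (n + 1), fun φ hφ f hf z hz => ?_⟩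
    rw [scaleNormSq, if_pos h, hn]
    have e : s - 1 / 2 = n + 1 / 2 := by
      rw [h, hn]
      push_cast
      ring
    rw [e] at hz
    push_cast
    exact enorm_trace_sq_le_int hA n hφ hf hz
  · have hθ := fract_mem_Ioo (by linarith) h
    simp only [scaleNormSq, if_neg h]
    rcases Nat.eq_zero_or_eq_succ_pred ⌊s⌋₊ with h0 | h0
    · rw [h0, Nat.cast_zero, sub_zero] at hθ ⊢
      exact enorm_trace_sq_le_zero hA hs hθ.2
    · set n := ⌊s⌋₊.pred
      have e : s - 1 / 2 = n + 1 / 2 + (s - ⌊s⌋₊) := by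
        rw [h0]
        push_cast
        ring
      rw [e]
      have := enorm_trace_sq_le_succ hA n hθ.1 hθ.2
      rw [h0] at this ⊢
      exact this

end InterpTrace

/-! ### Extension by density -/

section Extension

open Filter Topology

variable {E F : Type*} [AddCommGroup E] [Module ℂ E] [NormedAddCommGroup F] [NormedSpace ℂ F]
variable {N : E → ℝ≥0∞}

theorem IsQuasiSq.sub_le (hN : IsQuasiSq N) (f g : E) : N (f - g) ≤ 2 * (N f + N g) := by
  rw [sub_eq_add_neg]
  exact (hN.add_le f (-g)).trans (by gcongr; exact hN.neg g)

theorem exists_pos_mul_lt {c ε : ℝ≥0∞} (hc : c ≠ ⊤) (hε : 0 < ε) : ∃ δ, 0 < δ ∧ c * δ < ε := by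
  have hlim : Tendsto (fun δ : ℝ≥0∞ => c * δ) (𝓝 0) (𝓝 (c * 0)) :=
    ENNReal.Tendsto.const_mul tendsto_id (Or.inr hc)
  rw [mul_zero] at hlim
  obtain ⟨δ, h1, h2⟩ := ((hlim.eventually (gt_mem_nhds hε)).filter_mono
    (nhdsWithin_le_nhds (s := Ioi 0))).and self_mem_nhdsWithin |>.exists
  exact ⟨δ, h2, h1⟩

/-- `y` is a value at `f` of the closure of the linear relation `G`. -/
def IsClosureValue (N : E → ℝ≥0∞) (G : Submodule ℂ (E × F)) (f : E) (y : F) : Prop :=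
  ∀ ε : ℝ≥0∞, 0 < ε → ∃ p ∈ G, N (f - p.1) < ε ∧ ‖y - p.2‖ₑ ^ 2 < ε

namespace IsClosureValue

variable {G : Submodule ℂ (E × F)} {f f' : E} {y y' : F}

theorem of_mem (hN : IsQuasiSq N) {p : E × F} (hp : p ∈ G) : IsClosureValue N G p.1 p.2 :=
  fun ε hε => ⟨p, hp, by rwa [sub_self, hN.zero], by simpa using hε⟩

theorem add (hN : IsQuasiSq N) (h : IsClosureValue N G f y) (h' : IsClosureValue N G f' y') :
    IsClosureValue N G (f + f') (y + y') := by
  intro ε hε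
  obtain ⟨δ, hδ, hδε⟩ := exists_pos_mul_lt (c := 4) (by simp) hε
  obtain ⟨p, hp, h1, h2⟩ := h δ hδ
  obtain ⟨p', hp', h1', h2'⟩ := h' δ hδ
  have e4 : 2 * (δ + δ) = 4 * δ := by ring
  refine ⟨p + p', G.add_mem hp hp', ?_, ?_⟩
  · rw [Prod.fst_add, add_sub_add_comm]
    refine ((hN.add_le _ _).trans ?_).trans_lt hδε
    rw [← e4]
    gcongr
  · rw [Prod.snd_add, add_sub_add_comm]
    refine ((isQuasiSq_enorm.add_le _ _).trans ?_).trans_lt hδε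
    rw [← e4]
    gcongr

theorem smul (hN : IsQuasiSq N) (c : ℂ) (h : IsClosureValue N G f y) :
    IsClosureValue N G (c • f) (c • y) := by
  rcases eq_or_ne c 0 with rfl | hc
  · rw [zero_smul, zero_smul]
    exact of_mem hN G.zero_mem
  intro ε hε
  obtain ⟨δ, hδ, hδε⟩ := exists_pos_mul_lt (c := ‖c‖ₑ ^ 2) (by finiteness) hε
  obtain ⟨p, hp, h1, h2⟩ := h δ hδ
  refine ⟨c • p, G.smul_mem c hp, ?_, ?_⟩
  · rw [Prod.smul_fst, ← smul_sub]
    exact ((hN.smul_le c _ hc).trans (by gcongr)).trans_lt hδε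
  · rw [Prod.smul_snd, ← smul_sub]
    exact ((isQuasiSq_enorm.smul_le c _ hc).trans (by gcongr)).trans_lt hδε

theorem enorm_sq_le (hN : IsQuasiSq N) {C : ℝ≥0} (hG : ∀ p ∈ G, ‖p.2‖ₑ ^ 2 ≤ C * N p.1)
    (h : IsClosureValue N G f y) : ‖y‖ₑ ^ 2 ≤ (4 * C : ℝ≥0) * N f := by
  have key : ∀ δ : ℝ≥0∞, 0 < δ → ‖y‖ₑ ^ 2 ≤ 2 * (δ + C * (2 * (N f + δ))) := by
    intro δ hδ
    obtain ⟨p, hp, h1, h2⟩ := h δ hδ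
    have e1 : y = (y - p.2) + p.2 := by abel
    have e2 : p.1 = f - (f - p.1) := by abel
    have h3 : N p.1 ≤ 2 * (N f + δ) := by
      rw [e2]
      exact (hN.sub_le _ _).trans (by gcongr)
    rw [e1]
    refine (isQuasiSq_enorm.add_le _ _).trans ?_
    gcongr
    exact (hG p hp).trans (by gcongr)
  have hlim : Tendsto (fun δ : ℝ≥0∞ => 2 * (δ + C * (2 * (N f + δ)))) (𝓝[>] 0)
      (𝓝 (2 * (0 + C * (2 * (N f + 0))))) := by
    refine Tendsto.mono_left ?_ nhdsWithin_le_nhds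
    refine ENNReal.Tendsto.const_mul ?_ (Or.inr (by simp))
    refine tendsto_id.add (ENNReal.Tendsto.const_mul ?_ (Or.inr (by simp)))
    exact ENNReal.Tendsto.const_mul (tendsto_const_nhds.add tendsto_id) (Or.inr (by simp))
  refine (ge_of_tendsto hlim
    (by filter_upwards [self_mem_nhdsWithin] with δ hδ using key δ hδ)).trans (le_of_eq ?_)
  push_cast
  ring

theorem unique (hN : IsQuasiSq N) {C : ℝ≥0} (hG : ∀ p ∈ G, ‖p.2‖ₑ ^ 2 ≤ C * N p.1)
    (h : IsClosureValue N G f y) (h' : IsClosureValue N G f y') : y = y' := by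
  have h1 := h.add hN (h'.smul hN (-1))
  rw [neg_one_smul, neg_one_smul, add_neg_cancel, ← sub_eq_add_neg] at h1
  have h2 := h1.enorm_sq_le hN hG
  rw [hN.zero, mul_zero] at h2
  have h3 : ‖y - y'‖ₑ = 0 := by simpa using h2
  exact sub_eq_zero.1 (enorm_eq_zero.1 h3)

/-- A bounded relation takes Cauchy sequences to Cauchy sequences, so its closure has a value at
every limit of its domain. -/
theorem exists_of_dense [CompleteSpace F] (hN : IsQuasiSq N) {C : ℝ≥0}
    (hG : ∀ p ∈ G, ‖p.2‖ₑ ^ 2 ≤ C * N p.1)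
    (hd : ∀ ε : ℝ≥0∞, 0 < ε → ∃ p ∈ G, N (f - p.1) < ε) : ∃ y, IsClosureValue N G f y := by
  choose p hpG hp using fun k : ℕ => hd (k + 1 : ℝ≥0∞)⁻¹ (by simp)
  have hδ : Tendsto (fun k : ℕ => (k + 1 : ℝ≥0∞)⁻¹) atTop (𝓝 0) := by
    have := (tendsto_add_atTop_iff_nat 1).2 ENNReal.tendsto_inv_nat_nhds_zero
    simpa using this
  have hc : CauchySeq fun k => (p k).2 := by
    rw [EMetric.cauchySeq_iff]
    intro ε hε
    have hε2 : 0 < ε ^ 2 := ENNReal.pow_pos hε 2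
    obtain ⟨δ, hδ0, hδε⟩ := exists_pos_mul_lt (c := C * 4) (by finiteness) hε2
    obtain ⟨n, hn⟩ := (hδ.eventually (gt_mem_nhds hδ0)).exists_forall_of_atTop
    refine ⟨n, fun k hk l hl => ?_⟩
    rw [edist_eq_enorm_sub]
    refine lt_of_pow_lt_pow_left' 2 ?_
    refine lt_of_le_of_lt (hG (p k - p l) (G.sub_mem (hpG k) (hpG l))) (lt_of_le_of_lt ?_ hδε)
    rw [mul_assoc]
    gcongr
    have e : (p k - p l).1 = (f - (p l).1) - (f - (p k).1) := by
      rw [Prod.fst_sub]; abel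
    rw [e]
    refine (hN.sub_le _ _).trans ?_
    have e4 : 4 * δ = 2 * (δ + δ) := by ring
    rw [e4]
    gcongr
    · exact ((hp l).trans (hn l hl)).le
    · exact ((hp k).trans (hn k hk)).le
  obtain ⟨y, hy⟩ := cauchySeq_tendsto_of_complete hc
  refine ⟨y, fun ε hε => ?_⟩
  have hy2 : Tendsto (fun k => ‖y - (p k).2‖ₑ ^ 2) atTop (𝓝 0) := by
    have h1 : Tendsto (fun k => ‖y - (p k).2‖ₑ) atTop (𝓝 0) := by
      have := (hy.const_sub y).enorm
      simpa using this
    simpa using ENNReal.Tendsto.pow (n := 2) h1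
  obtain ⟨k, h1, h2⟩ := ((hδ.eventually (gt_mem_nhds hε)).and
    (hy2.eventually (gt_mem_nhds hε))).exists
  exact ⟨p k, hpG k, (hp k).trans h1, h2⟩

end IsClosureValue

/-- A linear relation that is bounded with respect to `N` and whose domain is dense in `X`
extends uniquely to a bounded linear map on `X`. -/
theorem existsUnique_extension [CompleteSpace F] (hN : IsQuasiSq N) (X : Submodule ℂ E)
    (G : Submodule ℂ (E × F)) {C : ℝ≥0} (hG : ∀ p ∈ G, ‖p.2‖ₑ ^ 2 ≤ C * N p.1)
    (hd : ∀ f ∈ X, ∀ ε : ℝ≥0∞, 0 < ε → ∃ p ∈ G, p.1 ∈ X ∧ N (f - p.1) < ε) :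
    ∃! r : X →ₗ[ℂ] F, (∃ C : ℝ≥0, ∀ f : X, ‖r f‖ₑ ^ 2 ≤ C * N f) ∧
      ∀ p ∈ G, ∀ h : p.1 ∈ X, r ⟨p.1, h⟩ = p.2 := by
  choose r hr using fun f : X => IsClosureValue.exists_of_dense hN hG
    (fun ε hε => let ⟨p, hp, _, h⟩ := hd f f.2 ε hε; ⟨p, hp, h⟩)
  refine ⟨{ toFun := r
            map_add' := fun f g => (hr (f + g)).unique hN hG ((hr f).add hN (hr g))
            map_smul' := fun c f => (hr (c • f)).unique hN hG ((hr f).smul hN c) },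
    ⟨⟨4 * C, fun f => (hr f).enorm_sq_le hN hG⟩,
      fun p hp h => (hr ⟨p.1, h⟩).unique hN hG (IsClosureValue.of_mem hN hp)⟩, ?_⟩
  rintro r' ⟨⟨C', hC'⟩, h'⟩
  refine LinearMap.ext fun f => ?_
  refine IsClosureValue.unique hN hG (fun ε hε => ?_) (hr f)
  obtain ⟨δ, hδ, hδε⟩ := exists_pos_mul_lt (c := C' + 1) (by finiteness) hε
  obtain ⟨p, hp, hX, h⟩ := hd f f.2 δ hδ
  have h1 : N (f - p.1) ≤ (C' + 1) * δ := h.le.trans (le_mul_of_one_le_left bot_le (by simp))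
  refine ⟨p, hp, h1.trans_lt hδε, ?_⟩
  rw [← h' p hp hX, ← map_sub]
  refine (hC' _).trans_lt (lt_of_le_of_lt ?_ hδε)
  exact mul_le_mul' le_self_add h.le

end Extension

/-! ### The trace on `ℋ_s` -/

section TraceMap

variable {H : Type*} [NormedAddCommGroup H] [InnerProductSpace ℂ H] [CompleteSpace H]
variable {A : H →ₗ.[ℂ] H}

/-- The pairs `(φ, φ 0)` with `φ` in `C₀^∞(ℝ₊, H_∞)`, as a linear relation between `L²(ℝ₊, H)`
and `H`. -/
def smoothTrace (A : H →ₗ.[ℂ] H) : Submodule ℂ (L2 H × H) where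
  carrier := {p | ∃ φ : ℝ → H, IsSmoothCompact A φ ∧ p.1 =ᵐ[halfLine] φ ∧ p.2 = φ 0}
  zero_mem' := ⟨fun _ => 0, ⟨fun _ _ => ⟨fun _ => 0, contDiffOn_const, fun _ _ => map_zero _⟩,
    ⟨0, fun _ _ => rfl⟩⟩, Lp.coeFn_zero _ _ _, rfl⟩
  add_mem' := by
    rintro ⟨u, x⟩ ⟨u', x'⟩ ⟨φ, h, h1, h2⟩ ⟨φ', h', h1', h2'⟩
    refine ⟨fun x => φ x + φ' x, ⟨fun s hs => ?_, ?_⟩, ?_, ?_⟩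
    · obtain ⟨Φ, k1, k2⟩ := h.smooth s hs
      obtain ⟨Φ', k1', k2'⟩ := h'.smooth s hs
      exact ⟨fun x => Φ x + Φ' x, k1.add k1', fun x hx => by rw [map_add, k2 x hx, k2' x hx]⟩
    · obtain ⟨b, hb⟩ := h.compact
      obtain ⟨b', hb'⟩ := h'.compact
      refine ⟨max b b', fun x hx => ?_⟩
      rw [hb x ((le_max_left _ _).trans hx), hb' x ((le_max_right _ _).trans hx), add_zero]
    · filter_upwards [h1, h1', Lp.coeFn_add u u'] with x k k' k''
      exact k''.trans (congrArg₂ (· + ·) k k')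
    · exact congrArg₂ (· + ·) h2 h2'
  smul_mem' := by
    rintro c ⟨u, x⟩ ⟨φ, h, h1, h2⟩
    refine ⟨fun x => c • φ x, ⟨fun s hs => ?_, ?_⟩, ?_, congrArg (c • ·) h2⟩
    · obtain ⟨Φ, k1, k2⟩ := h.smooth s hs
      exact ⟨fun x => c • Φ x, k1.const_smul c, fun x hx => by rw [map_smul, k2 x hx]⟩
    · obtain ⟨b, hb⟩ := h.compact
      exact ⟨b, fun x hx => by rw [hb x hx, smul_zero]⟩
    · filter_upwards [h1, Lp.coeFn_smul c u] with x k k'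
      exact k'.trans (congrArg (c • ·) k)

theorem exists_hsVal_eq {φ : ℝ → H} (hφ : IsSmoothCompact A φ) {s : ℝ}
    (hs : 0 ≤ s) : ∃ y : Hs A s, Hs.val A s y = φ 0 :=
  let ⟨Φ, _, h⟩ := hφ.smooth s hs
  ⟨Φ 0, h 0 le_rfl⟩

theorem exists_mem_scaleSpace (hA : IsSelfAdjoint A) {s : ℝ} (hs : 0 ≤ s) {φ : ℝ → H}
    (hφ : IsSmoothCompact A φ) : ∃ u ∈ scaleSpace A s, u =ᵐ[halfLine] φ :=
  ⟨(hφ.isHalfSmooth hA).toL2,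
    hφ.scaleNormSq_lt_top hA hs (hφ.isHalfSmooth hA).coeFn_toL2,
    (hφ.isHalfSmooth hA).coeFn_toL2⟩

theorem existsUnique_trace (hA : IsSelfAdjoint A) {s : ℝ} (hs : 1 / 2 < s) :
    ∃! r : scaleSpace A s →ₗ[ℂ] Hs A (s - 1 / 2),
      (∃ C : ℝ≥0, ∀ f : scaleSpace A s, ‖r f‖ₑ ^ 2 ≤ C * scaleNormSq A s (f : L2 H)) ∧
      ∀ φ : ℝ → H, IsSmoothCompact A φ → ∀ f : scaleSpace A s, (f : L2 H) =ᵐ[halfLine] φ →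
        Hs.val A (s - 1 / 2) (r f) = φ 0 := by
  have hs0 : 0 ≤ s := by linarith
  have hσ : 0 ≤ s - 1 / 2 := by linarith
  have := completeSpace_hs hA hσ
  set G : Submodule ℂ (L2 H × Hs A (s - 1 / 2)) :=
    (smoothTrace A).comap (LinearMap.id.prodMap (Hs.val A (s - 1 / 2)).toLinearMap) with hGdef
  obtain ⟨C, hC⟩ := enorm_trace_sq_le hA hs
  have hG : ∀ p ∈ G, ‖p.2‖ₑ ^ 2 ≤ (2 * C : ℝ≥0) * scaleNormSq A s p.1 := by
    rintro ⟨u, y⟩ ⟨φ, hφ, h1, h2⟩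
    obtain ⟨z, rfl⟩ := (hsEquiv hA hσ).surjective y
    have h3 := hC φ hφ u h1 z h2
    have h4 : ‖hsEquiv hA hσ z‖ₑ ^ 2 ≤ (2 : ℝ≥0) * ‖z‖ₑ ^ 2 :=
      enorm_sq_le_of_norm_sq_le (norm_hsEquiv_sq_le hA hσ z)
    refine h4.trans ((mul_le_mul_right h3 _).trans (le_of_eq ?_))
    push_cast
    ring
  have key := existsUnique_extension (isQuasiSq_scale A s) (scaleSpace A s) G hG
    (fun f hf ε hε => by
      obtain ⟨u, ⟨φ, hφ, hu⟩, h⟩ := exists_smooth_near hA hs0 hf hε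
      obtain ⟨y, hy⟩ := exists_hsVal_eq hφ hσ
      exact ⟨(u, y), ⟨φ, hφ, hu, hy⟩, hφ.scaleNormSq_lt_top hA hs0 hu, h⟩)
  refine (existsUnique_congr fun r => and_congr_right fun _ => ⟨fun h φ hφ f hf => ?_,
    fun h p hp hX => ?_⟩).1 key
  · obtain ⟨y, hy⟩ := exists_hsVal_eq hφ hσ
    rw [← hy]
    exact congrArg _ (h (f, y) ⟨φ, hφ, hf, hy⟩ f.2)
  · obtain ⟨φ, hφ, h1, h2⟩ := hp
    exact hsVal_injective hA hσ ((h φ hφ ⟨p.1, hX⟩ h1).trans h2.symm)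

end TraceMap

/-! ### The operator `A` and its resolvent -/

section GraphElements

variable {E F : Type*} [NormedAddCommGroup E] [InnerProductSpace ℂ E]
  [NormedAddCommGroup F] [InnerProductSpace ℂ F] {T : E →ₗ.[ℂ] F}

theorem GraphSpace.mem_graph (z : GraphSpace T) :
    (GraphSpace.val T z, GraphSpace.app T z) ∈ T.graph := by
  obtain ⟨_, p, hp, rfl⟩ := z
  exact hp

/-- The element `(x, T x)` of the graph. -/
def GraphSpace.mk {x : E} {y : F} (h : (x, y) ∈ T.graph) : GraphSpace T :=
  ⟨(WithLp.linearEquiv 2 ℂ (E × F)).symm (x, y), (x, y), h, rfl⟩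

theorem GraphSpace.norm_sq (z : GraphSpace T) :
    ‖z‖ ^ 2 = ‖GraphSpace.val T z‖ ^ 2 + ‖GraphSpace.app T z‖ ^ 2 :=
  WithLp.prod_norm_sq_eq_of_L2 _

theorem GraphSpace.val_injective : Function.Injective (GraphSpace.val T) := by
  rw [injective_iff_map_eq_zero]
  intro z hz
  have h : GraphSpace.app T z = 0 := by
    have h1 := GraphSpace.mem_graph z
    rw [hz] at h1
    exact T.graph_fst_eq_zero_snd h1 rfl
  have h2 := GraphSpace.norm_sq z
  rw [hz, h] at h2
  simpa using h2

end GraphElements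

section Resolvent

variable {H : Type*} [NormedAddCommGroup H] [InnerProductSpace ℂ H] [CompleteSpace H]
variable {A : H →ₗ.[ℂ] H}

/-- `A (1 + A²)⁻¹` as a linear map. -/
def mulResLinear (hA : IsSelfAdjoint A) : H →ₗ[ℂ] H :=
  A.toFun ∘ₗ (invOneAddSq A).toLinearMap.codRestrict A.domain
    fun x => (invOneAddSq_spec A hA x).1

theorem invOneAddSq_add (hA : IsSelfAdjoint A) (x : H) :
    ∃ h : mulResLinear hA x ∈ A.domain, invOneAddSq A x + A ⟨mulResLinear hA x, h⟩ = x :=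
  (invOneAddSq_spec A hA x).2

/-- `‖A R x‖² = ⟪R x, x⟫ - ‖R x‖²`, since `A² R = 1 - R`. -/
theorem norm_mulResLinear_sq_le (hA : IsSelfAdjoint A) (x : H) :
    ‖mulResLinear hA x‖ ^ 2 ≤ ‖halfPow (invOneAddSq A) 1 x‖ ^ 2 := by
  have hR := isResolvent_invOneAddSq hA
  obtain ⟨h2, h3⟩ := invOneAddSq_add hA x
  have e1 : ⟪mulResLinear hA x, mulResLinear hA x⟫_ℂ =
      ⟪invOneAddSq A x, A ⟨mulResLinear hA x, h2⟩⟫_ℂ :=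
    inner_apply_comm hA ⟨_, (invOneAddSq_spec A hA x).1⟩ ⟨_, h2⟩
  rw [← eq_sub_iff_add_eq'] at h3
  rw [h3, inner_sub_right] at e1
  have e2 : ⟪invOneAddSq A x, x⟫_ℂ =
      ⟪halfPow (invOneAddSq A) 1 x, halfPow (invOneAddSq A) 1 x⟫_ℂ := by
    have := hR.halfPow_add zero_le_one zero_le_one x
    rw [one_add_one_eq_two, hR.halfPow_two] at this
    rw [this, halfPow_inner_comm]
  rw [e2, inner_self_eq_norm_sq_to_K, inner_self_eq_norm_sq_to_K, inner_self_eq_norm_sq_to_K,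
    ← RCLike.ofReal_pow, ← RCLike.ofReal_pow, ← RCLike.ofReal_pow, ← RCLike.ofReal_sub] at e1
  have e3 := RCLike.ofReal_injective e1
  nlinarith [sq_nonneg ‖invOneAddSq A x‖]

/-- The bounded operator `A (1 + A²)⁻¹`. -/
def mulRes (hA : IsSelfAdjoint A) : H →L[ℂ] H :=
  (mulResLinear hA).mkContinuous 1 fun x => by
    rw [one_mul]
    refine le_trans (abs_le_of_sq_le_sq' (norm_mulResLinear_sq_le hA x) (norm_nonneg _)).2 ?_
    exact (isResolvent_invOneAddSq hA).norm_halfPow_le zero_le_one x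

theorem norm_mulRes_le (hA : IsSelfAdjoint A) (x : H) :
    ‖mulRes hA x‖ ≤ ‖halfPow (invOneAddSq A) 1 x‖ :=
  (abs_le_of_sq_le_sq' (norm_mulResLinear_sq_le hA x) (norm_nonneg _)).2

theorem mulRes_mem_graph (hA : IsSelfAdjoint A) (x : H) :
    (invOneAddSq A x, mulRes hA x) ∈ A.graph :=
  (LinearPMap.mem_graph_iff A).2 ⟨⟨_, (invOneAddSq_spec A hA x).1⟩, rfl, rfl⟩

theorem mulRes_graph (hA : IsSelfAdjoint A) (x : H) :
    (mulRes hA x, x - invOneAddSq A x) ∈ A.graph := by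
  obtain ⟨h2, h3⟩ := invOneAddSq_add hA x
  exact (LinearPMap.mem_graph_iff A).2 ⟨⟨_, h2⟩, rfl, (eq_sub_of_add_eq' h3)⟩

theorem inner_graph_comm (hA : IsSelfAdjoint A) {p q : H × H} (hp : p ∈ A.graph)
    (hq : q ∈ A.graph) : ⟪p.2, q.1⟫_ℂ = ⟪p.1, q.2⟫_ℂ := by
  obtain ⟨x, hx, hx2⟩ := (LinearPMap.mem_graph_iff A).1 hp
  obtain ⟨y, hy, hy2⟩ := (LinearPMap.mem_graph_iff A).1 hq
  rw [← hx, ← hx2, ← hy, ← hy2]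
  exact inner_apply_comm hA x y

/-- `(1 + A²)⁻¹ x` is the only solution `y` of `y + A² y = x`. -/
theorem eq_invOneAddSq (hA : IsSelfAdjoint A) {x y w : H} (h1 : (y, w) ∈ A.graph)
    (h2 : (w, x - y) ∈ A.graph) : y = invOneAddSq A x := by
  have k1 := A.graph.sub_mem h1 (mulRes_mem_graph hA x)
  have k2 := A.graph.sub_mem h2 (mulRes_graph hA x)
  have e := inner_graph_comm hA k1 k2
  simp only [Prod.mk_sub_mk] at e
  set d := y - invOneAddSq A x with hd
  have e1 : x - y - (x - invOneAddSq A x) = -d := by rw [hd]; abel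
  rw [e1, inner_neg_right, inner_self_eq_norm_sq_to_K, inner_self_eq_norm_sq_to_K,
    ← RCLike.ofReal_pow, ← RCLike.ofReal_pow, ← RCLike.ofReal_neg] at e
  have e2 := RCLike.ofReal_injective e
  have : ‖d‖ = 0 := by
    nlinarith [sq_nonneg ‖w - mulRes hA x‖, sq_nonneg ‖d‖, norm_nonneg d]
  exact sub_eq_zero.1 (norm_eq_zero.1 this)

/-- `A (1 + A²)⁻¹` extends `(1 + A²)⁻¹ A`. -/
theorem mulRes_eq_of_mem_graph (hA : IsSelfAdjoint A) {p : H × H} (hp : p ∈ A.graph) :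
    mulRes hA p.1 = invOneAddSq A p.2 := by
  refine eq_invOneAddSq hA (mulRes_graph hA p.1) ?_
  exact A.graph.sub_mem hp (mulRes_mem_graph hA p.1)

theorem inner_mulRes_comm (hA : IsSelfAdjoint A) (x y : H) :
    ⟪mulRes hA x, y⟫_ℂ = ⟪x, mulRes hA y⟫_ℂ := by
  have e1 := inner_graph_comm hA (mulRes_mem_graph hA x) (mulRes_mem_graph hA y)
  have e2 := inner_graph_comm hA (mulRes_graph hA x) (mulRes_graph hA y)
  simp only [inner_sub_left, inner_sub_right] at e1 e2
  have e3 : ⟪mulRes hA x, invOneAddSq A y⟫_ℂ = ⟪invOneAddSq A x, mulRes hA y⟫_ℂ := e1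
  rw [e3] at e2
  exact (sub_left_inj.1 e2).symm

theorem commute_mulRes (hA : IsSelfAdjoint A) : Commute (invOneAddSq A) (mulRes hA) := by
  refine ContinuousLinearMap.ext fun x => ?_
  exact (mulRes_eq_of_mem_graph hA (mulRes_mem_graph hA x)).symm

theorem cfc_mulRes (hA : IsSelfAdjoint A) (f : ℝ → ℝ) (x : H) :
    cfc f (invOneAddSq A) (mulRes hA x) = mulRes hA (cfc f (invOneAddSq A) x) :=
  congrArg (fun T : H →L[ℂ] H => T x) ((commute_mulRes hA).cfc_real f).eq

theorem resolvent_specCutDiv (hA : IsSelfAdjoint A) (k : ℕ) (x : H) :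
    invOneAddSq A (specCutDiv (invOneAddSq A) k 2 x) = specCut (invOneAddSq A) k x := by
  have hR := isResolvent_invOneAddSq hA
  have := hR.halfPow_specCutDiv k two_pos.le x
  rwa [hR.halfPow_two] at this

theorem specCutDiv_resolvent (hA : IsSelfAdjoint A) (k : ℕ) (x : H) :
    specCutDiv (invOneAddSq A) k 2 (invOneAddSq A x) = specCut (invOneAddSq A) k x := by
  rw [← resolvent_specCutDiv hA k x]
  exact congrArg (fun T : H →L[ℂ] H => T x)
    ((Commute.refl (invOneAddSq A)).cfc_real (cutDiv k 2)).eq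

/-- The map `y ↦ (R y, A R y)`, `R = (1 + A²)⁻¹`, of `H` into the graph of `A`. -/
def toGraph (hA : IsSelfAdjoint A) : H →L[ℂ] GraphSpace A :=
  ((WithLp.prodContinuousLinearEquiv 2 ℂ H H).symm.toContinuousLinearMap ∘L
    ((invOneAddSq A).prod (mulRes hA))).codRestrict _
      fun x => ⟨_, mulRes_mem_graph hA x, rfl⟩

theorem val_toGraph (hA : IsSelfAdjoint A) (x : H) :
    GraphSpace.val A (toGraph hA x) = invOneAddSq A x := rfl

theorem app_toGraph (hA : IsSelfAdjoint A) (x : H) :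
    GraphSpace.app A (toGraph hA x) = mulRes hA x := rfl

/-- The spectral cut-offs commute with `A`. -/
theorem mulRes_specCutDiv_val (hA : IsSelfAdjoint A) (k : ℕ) (z : GraphSpace A) :
    mulRes hA (specCutDiv (invOneAddSq A) k 2 (GraphSpace.val A z)) =
      specCut (invOneAddSq A) k (GraphSpace.app A z) := by
  rw [specCutDiv, ← cfc_mulRes, mulRes_eq_of_mem_graph hA (GraphSpace.mem_graph z)]
  exact specCutDiv_resolvent hA k _

/-! ### The structure operator `γ` -/

variable {γ : H →L[ℂ] H}

namespace IsCompatible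

theorem inner_comm (h : IsCompatible γ A) (x y : H) : ⟪γ x, y⟫_ℂ = -⟪x, γ y⟫_ℂ := by
  rw [← ContinuousLinearMap.adjoint_inner_right, h.adjoint_eq, neg_apply, inner_neg_right]

theorem apply_apply (h : IsCompatible γ A) (x : H) : γ (γ x) = -x :=
  congrArg (fun T : H →L[ℂ] H => T x) h.sq_eq

theorem norm_apply (h : IsCompatible γ A) (x : H) : ‖γ x‖ = ‖x‖ := by
  have h1 : ⟪γ x, γ x⟫_ℂ = ⟪x, x⟫_ℂ := by
    rw [h.inner_comm, h.apply_apply, inner_neg_right, neg_neg]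
  rw [inner_self_eq_norm_sq_to_K, inner_self_eq_norm_sq_to_K, ← RCLike.ofReal_pow,
    ← RCLike.ofReal_pow] at h1
  exact (sq_eq_sq₀ (norm_nonneg _) (norm_nonneg _)).1 (RCLike.ofReal_injective h1)

theorem mem_graph (h : IsCompatible γ A) {p : H × H} (hp : p ∈ A.graph) :
    (γ p.1, -γ p.2) ∈ A.graph := by
  obtain ⟨x, hx, hx2⟩ := (LinearPMap.mem_graph_iff A).1 hp
  have hγ : γ x ∈ A.domain := h.map_domain.le ⟨x, x.2, rfl⟩
  refine (LinearPMap.mem_graph_iff A).2 ⟨⟨γ x, hγ⟩, by rw [← hx], ?_⟩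
  rw [← hx2]
  exact eq_neg_of_add_eq_zero_right (h.anticomm x hγ)

theorem commute_resolvent (h : IsCompatible γ A) (hA : IsSelfAdjoint A) :
    Commute (invOneAddSq A) γ := by
  refine ContinuousLinearMap.ext fun x => (eq_invOneAddSq hA (h.mem_graph (mulRes_mem_graph hA x))
    ?_).symm
  have := A.graph.neg_mem (h.mem_graph (mulRes_graph hA x))
  simpa [map_sub] using this

theorem cfc_comm (h : IsCompatible γ A) (hA : IsSelfAdjoint A) (f : ℝ → ℝ) (x : H) :
    cfc f (invOneAddSq A) (γ x) = γ (cfc f (invOneAddSq A) x) :=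
  congrArg (fun T : H →L[ℂ] H => T x) ((h.commute_resolvent hA).cfc_real f).eq

theorem mulRes_comm (h : IsCompatible γ A) (hA : IsSelfAdjoint A) (x : H) :
    mulRes hA (γ x) = -γ (mulRes hA x) := by
  have h1 : (invOneAddSq A (γ x), -γ (mulRes hA x)) ∈ A.graph := by
    have h2 : invOneAddSq A (γ x) = γ (invOneAddSq A x) :=
      congrArg (fun T : H →L[ℂ] H => T x) (h.commute_resolvent hA).eq
    rw [h2]
    exact h.mem_graph (mulRes_mem_graph hA x)
  have h3 := A.graph.sub_mem (mulRes_mem_graph hA (γ x)) h1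
  exact sub_eq_zero.1 (A.graph_fst_eq_zero_snd h3 (sub_self _))

end IsCompatible

end Resolvent

/-! ### The operator `D_max` -/

section Model

variable {H : Type*} [NormedAddCommGroup H] [InnerProductSpace ℂ H] [CompleteSpace H]
variable {A : H →ₗ.[ℂ] H} {γ : H →L[ℂ] H}

/-- A test function whose class in `L²` vanishes is zero on `(0, ∞)`, and so is its derivative;
hence `minGraph` is the graph of an operator. -/
theorem minGraph_snd_eq_zero {p : L2 H × L2 H} (hp : p ∈ minGraph γ A) (h0 : p.1 = 0) :
    p.2 = 0 := by
  obtain ⟨φ, h1, h2, h3, h4, h5⟩ := hp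
  have hcont : Continuous fun x => GraphSpace.val A (φ x) :=
    (GraphSpace.val A).continuous.comp h1.continuous
  have hzero : ∀ x, 0 ≤ x → GraphSpace.val A (φ x) = 0 := by
    intro x hx
    refine eqOn_of_ae_eq (χ := fun _ => 0) hcont.continuousOn continuousOn_const ?_ hx
    rw [h0] at h4
    exact h4.symm.trans (Lp.coeFn_zero H 2 halfLine)
  refine Lp.ext ?_
  filter_upwards [h5, Lp.coeFn_zero H 2 halfLine, ae_restrict_mem measurableSet_Ioi]
    with x hx hx0 hxpos
  have hφ : φ x = 0 :=
    GraphSpace.val_injective ((hzero x (le_of_lt hxpos)).trans (map_zero _).symm)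
  have hd : deriv (fun y => GraphSpace.val A (φ y)) x = 0 := by
    have : (fun y => GraphSpace.val A (φ y)) =ᶠ[nhds x] fun _ => 0 := by
      filter_upwards [Ioi_mem_nhds hxpos] with y hy
      exact hzero y (le_of_lt hy)
    rw [this.deriv_eq, deriv_const]
  rw [hx, hx0, hd, hφ]
  simp

theorem Dmin_graph (γ : H →L[ℂ] H) (A : H →ₗ.[ℂ] H) : (Dmin γ A).graph = minGraph γ A :=
  Submodule.toLinearPMap_graph_eq _ fun _ hp h0 => minGraph_snd_eq_zero hp h0

/-- The test functions `η R y`, `R = (1 + A²)⁻¹`. -/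
theorem exists_mem_minGraph (γ : H →L[ℂ] H) (hA : IsSelfAdjoint A) {η : ℝ → ℝ}
    (hη : ContDiff ℝ ∞ η)
    (hc : HasCompactSupport η) (hs : tsupport η ⊆ Ioi 0) (y : H) :
    ∃ p ∈ minGraph γ A, p.1 =ᵐ[halfLine] (fun x => η x • invOneAddSq A y) ∧
      p.2 =ᵐ[halfLine] fun x => γ (deriv η x • invOneAddSq A y + η x • mulRes hA y) := by
  have hη' := (contDiff_infty_iff_deriv.1 hη).2
  have g0 := isHalfSmooth_test_smul hη hc (contDiffOn_const (c := invOneAddSq A y))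
  have g1 := isHalfSmooth_test_smul hη' hc.deriv (contDiffOn_const (c := γ (invOneAddSq A y)))
  have g2 := isHalfSmooth_test_smul hη hc (contDiffOn_const (c := γ (mulRes hA y)))
  refine ⟨(g0.toL2, g1.toL2 + g2.toL2), ⟨fun x => η x • toGraph hA y, hη.smul contDiff_const,
    hc.smul_right, (tsupport_smul_subset_left _ _).trans hs, ?_, ?_⟩, g0.coeFn_toL2, ?_⟩
  · filter_upwards [g0.coeFn_toL2] with x hx
    rw [hx, ← Complex.coe_smul, ← Complex.coe_smul, map_smul, val_toGraph]
  · filter_upwards [g1.coeFn_toL2, g2.coeFn_toL2, Lp.coeFn_add g1.toL2 g2.toL2] with x h1 h2 h3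
    have e : (fun y' => GraphSpace.val A (η y' • toGraph hA y)) =
        fun y' => η y' • invOneAddSq A y := by
      funext y'
      rw [← Complex.coe_smul, ← Complex.coe_smul, map_smul, val_toGraph]
    have hd : deriv (fun y' => η y' • invOneAddSq A y) x = deriv η x • invOneAddSq A y :=
      (((hη.differentiable (by simp)) x).hasDerivAt.smul_const _).deriv
    rw [h3, Pi.add_apply, h1, h2, e, hd]
    simp only [← Complex.coe_smul, map_add, map_smul, app_toGraph]
  · filter_upwards [g1.coeFn_toL2, g2.coeFn_toL2, Lp.coeFn_add g1.toL2 g2.toL2] with x h1 h2 h3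
    rw [h3, Pi.add_apply, h1, h2]
    simp only [← Complex.coe_smul, map_add, map_smul]

theorem inner_L2_smul_add {g p : L2 H} {η ξ : ℝ → ℝ} {y z : H} (hη : Continuous η)
    (hc : HasCompactSupport η) (hξ : Continuous ξ) (hd : HasCompactSupport ξ)
    (hp : p =ᵐ[halfLine] fun x => η x • y + ξ x • z) :
    ⟪g, p⟫_ℂ = ⟪∫ x in Ioi 0, η x • g x, y⟫_ℂ + ⟪∫ x in Ioi 0, ξ x • g x, z⟫_ℂ := by
  have e : ∀ (η : ℝ → ℝ) (y : H), Continuous η → HasCompactSupport η →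
      Integrable (fun x => ⟪η x • g x, y⟫_ℂ) halfLine ∧
      ⟪∫ x in Ioi 0, η x • g x, y⟫_ℂ = ∫ x in Ioi 0, ⟪η x • g x, y⟫_ℂ := by
    intro η y h1 h2
    have hi := integrable_test g h1 h2
    refine ⟨hi.inner_const y, ?_⟩
    rw [← inner_conj_symm, ← integral_inner hi, ← integral_conj]
    simp only [inner_conj_symm]
  rw [(e η y hη hc).2, (e ξ z hξ hd).2, ← integral_add (e η y hη hc).1 (e ξ z hξ hd).1,
    L2.inner_def]
  refine integral_congr_ae ?_
  filter_upwards [hp] with x hx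
  simp only [hx, ← Complex.coe_smul, inner_smul_left, inner_smul_right, inner_add_right,
    Complex.conj_ofReal]

/-- If `g` is orthogonal to all `η R y`, then `R (∫ η g) = 0` for all test functions `η`. -/
theorem dense_domain_Dmin (γ : H →L[ℂ] H) (hA : IsSelfAdjoint A) :
    Dense ((Dmin γ A).domain : Set (L2 H)) := by
  rw [Submodule.dense_iff_topologicalClosure_eq_top,
    Submodule.topologicalClosure_eq_top_iff, Submodule.eq_bot_iff]
  intro g hg
  rw [Submodule.mem_orthogonal'] at hg
  refine L2.ext_of_integral_eq fun η h1 h2 h3 => ?_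
  have hR := isResolvent_invOneAddSq hA
  have e0 : ∫ x in Ioi 0, η x • (0 : L2 H) x = 0 := by
    have : (fun x => η x • (0 : L2 H) x) =ᵐ[halfLine] fun _ => 0 := by
      filter_upwards [Lp.coeFn_zero H 2 halfLine] with x hx
      rw [hx, Pi.zero_apply, smul_zero]
    rw [integral_congr_ae this, integral_zero]
  rw [e0]
  refine hR.inj _ ?_
  have key : ∀ y, ⟪∫ x in Ioi 0, η x • g x, invOneAddSq A y⟫_ℂ = 0 := by
    intro y
    obtain ⟨p, hp, hp1, -⟩ := exists_mem_minGraph γ hA h1 h2 h3 y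
    have hp2 : p.1 =ᵐ[halfLine] fun x => η x • invOneAddSq A y + η x • (0 : H) := by
      simpa using hp1
    have e := inner_L2_smul_add (g := g) h1.continuous h2 h1.continuous h2 hp2
    rw [inner_zero_right, add_zero] at e
    rw [← e]
    exact hg _ ⟨p, hp, rfl⟩
  have h := key (invOneAddSq A (∫ x in Ioi 0, η x • g x))
  have h2 := halfPow_inner_comm (invOneAddSq A) 2
  rw [hR.halfPow_two] at h2
  rwa [← h2, inner_self_eq_zero] at h

/-- `D_max u = g` means that `⟪g, v⟫ = ⟪u, D v⟫` for all `v` in `C₀^∞((0, ∞), H_1)`. -/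
theorem mem_Dmax_graph_iff (hA : IsSelfAdjoint A) {u g : L2 H} :
    (u, g) ∈ (Dmax γ A).graph ↔ ∀ p ∈ minGraph γ A, ⟪g, p.1⟫_ℂ = ⟪u, p.2⟫_ℂ := by
  have hd := dense_domain_Dmin γ hA
  constructor
  · intro h p hp
    obtain ⟨x, hx, hx2⟩ := (LinearPMap.mem_graph_iff _).1 h
    rw [← Dmin_graph] at hp
    obtain ⟨y, hy, hy2⟩ := (LinearPMap.mem_graph_iff _).1 hp
    have := LinearPMap.adjoint_isFormalAdjoint hd x y
    rw [hy, hy2] at this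
    simp only at hx hx2
    rw [← hx, ← hx2]
    exact this
  · intro h
    have h' : ∀ x : (Dmin γ A).domain, ⟪g, (x : L2 H)⟫_ℂ = ⟪u, Dmin γ A x⟫_ℂ := fun x =>
      h (x, Dmin γ A x) (by rw [← Dmin_graph]; exact LinearPMap.mem_graph _ x)
    have hu : u ∈ (Dmax γ A).domain := LinearPMap.mem_adjoint_domain_of_exists u ⟨g, h'⟩
    exact (LinearPMap.mem_graph_iff _).2 ⟨⟨u, hu⟩, rfl, LinearPMap.adjoint_apply_eq hd ⟨u, hu⟩ h'⟩

theorem isHalfSmooth_of_contDiff {V : Type*} [NormedAddCommGroup V] [InnerProductSpace ℂ V]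
    {φ : ℝ → V} (h : ContDiff ℝ ∞ φ) (hc : HasCompactSupport φ) : IsHalfSmooth φ := by
  refine ⟨h.contDiffOn, ?_⟩
  obtain ⟨r, hr⟩ := hc.isCompact.isBounded.subset_closedBall 0
  refine ⟨r + 1, fun x hx => image_eq_zero_of_notMem_tsupport fun hx' => ?_⟩
  have := hr hx'
  rw [mem_closedBall_zero_iff, Real.norm_eq_abs] at this
  linarith [le_abs_self x]

/-- On functions `φ = R ψ`, `R = (1 + A²)⁻¹`, smooth up to `0`, the operator `D_max` acts as
`γ (d/dx + A)`, without any boundary condition. -/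
theorem mem_Dmax_graph_of_lift (hA : IsSelfAdjoint A) (hγ : IsCompatible γ A) {φ ψ : ℝ → H}
    (hφ : IsHalfSmooth φ) (hψ : IsHalfSmooth ψ) (h : ∀ x, 0 ≤ x → invOneAddSq A (ψ x) = φ x)
    {u : L2 H} (hu : u =ᵐ[halfLine] φ) :
    (u, (hφ.derivWithin.clm_comp γ).toL2 + ((hψ.clm_comp (mulRes hA)).clm_comp γ).toL2) ∈
      (Dmax γ A).graph := by
  rw [mem_Dmax_graph_iff hA]
  rintro ⟨v, w⟩ ⟨Φ, h1, h2, h3, h4, h5⟩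
  set V : ℝ → H := fun x => GraphSpace.val A (Φ x) with hV
  have hΦ := isHalfSmooth_of_contDiff h1 h2
  have hVs : IsHalfSmooth V := hΦ.clm_comp (GraphSpace.val A)
  have hV0 : V 0 = 0 := by
    have : Φ 0 = 0 := image_eq_zero_of_notMem_tsupport fun h => lt_irrefl (0 : ℝ) (h3 h)
    rw [hV]
    simp only [this, map_zero]
  set φ' := derivWithin φ (Ici 0) with hφ'
  set V' := derivWithin V (Ici 0) with hV'
  have hγφ := hφ.clm_comp γ
  have hγφ' := hφ.derivWithin.clm_comp γ
  have hγψ := (hψ.clm_comp (mulRes hA)).clm_comp γ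
  -- The terms with `A` agree by symmetry of `γ A`; those with derivatives by integration by parts,
  -- where the boundary term vanishes because the test function `V` is zero at `0`.
  have eL : ⟪(hγφ'.toL2 + hγψ.toL2 : L2 H), v⟫_ℂ =
      (∫ x in Ioi 0, ⟪γ (φ' x), V x⟫_ℂ) + ∫ x in Ioi 0, ⟪γ (mulRes hA (ψ x)), V x⟫_ℂ := by
    rw [← integral_add (hγφ'.integrable_inner hVs) (hγψ.integrable_inner hVs), L2.inner_def]
    refine integral_congr_ae ?_
    filter_upwards [hγφ'.coeFn_toL2, hγψ.coeFn_toL2, Lp.coeFn_add hγφ'.toL2 hγψ.toL2, h4]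
      with x k1 k2 k3 k4
    rw [k3, Pi.add_apply, k1, k2, k4, inner_add_left]
  have eR : ⟪u, w⟫_ℂ = -(∫ x in Ioi 0, ⟪γ (φ x), V' x⟫_ℂ) +
      ∫ x in Ioi 0, ⟪γ (mulRes hA (ψ x)), V x⟫_ℂ := by
    rw [neg_add_eq_sub, ← integral_sub (hγψ.integrable_inner hVs)
      (hγφ.integrable_inner hVs.derivWithin), L2.inner_def]
    refine integral_congr_ae ?_
    filter_upwards [hu, h5, ae_restrict_mem measurableSet_Ioi] with x k1 k2 k3
    have k4 : deriv V x = V' x := (derivWithin_of_mem_nhds (Ici_mem_nhds k3)).symm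
    have k5 : ⟪φ x, γ (V' x)⟫_ℂ = -⟪γ (φ x), V' x⟫_ℂ := by rw [hγ.inner_comm, neg_neg]
    have k6 : ⟪φ x, γ (GraphSpace.app A (Φ x))⟫_ℂ = ⟪γ (mulRes hA (ψ x)), V x⟫_ℂ := by
      have := inner_graph_comm hA (mulRes_mem_graph hA (γ (ψ x))) (GraphSpace.mem_graph (Φ x))
      simp only at this
      rw [hγ.mulRes_comm hA, inner_neg_left] at this
      have e2 : invOneAddSq A (γ (ψ x)) = γ (φ x) := by
        rw [← h x (le_of_lt k3)]
        exact congrArg (fun T : H →L[ℂ] H => T (ψ x)) (hγ.commute_resolvent hA).eq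
      rw [e2, hγ.inner_comm (φ x), neg_inj] at this
      exact this.symm
    rw [k1, k2, k4, map_add, inner_add_right, k5, k6, neg_add_eq_sub]
  have ibp := integral_inner_derivWithin hγφ hVs
  rw [hV0, inner_zero_right, neg_zero, zero_sub] at ibp
  have e3 : ∫ x in Ioi 0, ⟪derivWithin (fun y => γ (φ y)) (Ici 0) x, V x⟫_ℂ =
      ∫ x in Ioi 0, ⟪γ (φ' x), V x⟫_ℂ := by
    refine setIntegral_congr_fun measurableSet_Ioi fun x hx => ?_
    rw [derivWithin_clm_comp hφ.smooth _ (le_of_lt hx)]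
  rw [e3] at ibp
  simp only
  rw [eL, eR, ibp, neg_neg]

theorem exists_lift_pair (hA : IsSelfAdjoint A) {φ : ℝ → H} (hφ : IsSmoothCompact A φ) :
    ∃ ψ : ℝ → H, IsHalfSmooth ψ ∧ ∀ x, 0 ≤ x → invOneAddSq A (ψ x) = φ x := by
  obtain ⟨ψ, h1, h2⟩ := hφ.exists_lift hA (s := 2) two_pos.le
  rw [(isResolvent_invOneAddSq hA).halfPow_two] at h2
  exact ⟨ψ, h1, h2⟩

theorem unique_of_mem_Dmax_graph {u g g' : L2 H} (h : (u, g) ∈ (Dmax γ A).graph)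
    (h' : (u, g') ∈ (Dmax γ A).graph) : g = g' := by
  have := (Dmax γ A).graph.sub_mem h h'
  exact sub_eq_zero.1 ((Dmax γ A).graph_fst_eq_zero_snd this (sub_self u))

/-- On smooth functions, `D_max` is bounded with respect to the norm of `ℋ_1`. -/
theorem enorm_Dmax_sq_le (hA : IsSelfAdjoint A) (hγ : IsCompatible γ A) {φ : ℝ → H}
    (hφ : IsSmoothCompact A φ) {u g : L2 H} (hu : u =ᵐ[halfLine] φ)
    (h : (u, g) ∈ (Dmax γ A).graph) : ‖g‖ₑ ^ 2 ≤ (6 : ℝ≥0) * intNormSq A 1 u := by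
  have hR := isResolvent_invOneAddSq hA
  obtain ⟨ψ, hψ, e⟩ := exists_lift_pair hA hφ
  have hφs := hφ.isHalfSmooth hA
  rw [unique_of_mem_Dmax_graph h (mem_Dmax_graph_of_lift hA hγ hφs hψ e hu)]
  have hχ := hψ.clm_comp (halfPow (invOneAddSq A) 1)
  have eχ : ∀ x, 0 ≤ x → halfPow (invOneAddSq A) 1 (halfPow (invOneAddSq A) 1 (ψ x)) = φ x := by
    intro x hx
    rw [← hR.halfPow_add zero_le_one zero_le_one, one_add_one_eq_two, hR.halfPow_two, e x hx]
  have b1 : ‖(hφs.derivWithin.clm_comp γ).toL2‖ₑ ^ 2 ≤ intNormSq A 1 u := by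
    have k1 := le_derivNormSq_of_lift hA (l := 1) (j := 0) (f := u) hφs (by
      filter_upwards [hu] with x hx
      rw [hx, Nat.cast_zero, hR.halfPow_zero]
      rfl)
    rw [pow_zero, one_mul] at k1
    refine (le_trans ?_ k1).trans (derivNormSq_le_intNormSq (by omega) u)
    refine (enorm_sq_le_of_ae (c := 1) (by simp) ?_).trans_eq (one_mul _)
    filter_upwards [(hφs.derivWithin.clm_comp γ).coeFn_toL2, (hφs.hderiv 1).coeFn_toL2]
      with x h1 h2
    rw [h1, h2, one_mul, hderiv, iteratedDerivWithin_one]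
    exact enorm_sq_le_of_norm_le (hγ.norm_apply _).le
  have b2 : ‖((hψ.clm_comp (mulRes hA)).clm_comp γ).toL2‖ₑ ^ 2 ≤ 2 * intNormSq A 1 u := by
    have k1 := le_derivNormSq_of_lift hA (l := 0) (j := 1) (f := u) hχ (by
      filter_upwards [hu, ae_restrict_mem measurableSet_Ioi] with x hx hx0
      rw [hx, Nat.cast_one, eχ x (le_of_lt hx0)])
    rw [pow_one] at k1
    refine (le_trans ?_ k1).trans (mul_le_mul_right (derivNormSq_le_intNormSq (by omega) u) _)
    refine (enorm_sq_le_of_ae (c := 1) (by simp) ?_).trans_eq (one_mul _)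
    filter_upwards [((hψ.clm_comp (mulRes hA)).clm_comp γ).coeFn_toL2, (hχ.hderiv 0).coeFn_toL2]
      with x h1 h2
    rw [h1, h2, one_mul, hderiv, iteratedDerivWithin_zero]
    exact enorm_sq_le_of_norm_le ((hγ.norm_apply _).trans_le (norm_mulRes_le hA _))
  refine (isQuasiSq_enorm.add_le _ _).trans ?_
  refine (mul_le_mul_right (add_le_add b1 b2) _).trans (le_of_eq ?_)
  push_cast
  ring

theorem enorm_sq_le_intNormSq (hA : IsSelfAdjoint A) (f : L2 H) (n : ℕ) :
    ‖f‖ₑ ^ 2 ≤ intNormSq A n f := by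
  have := le_derivNormSq hA (X := ‖f‖ₑ ^ 2) (c := 1) (l := 0) (j := 0) (f := f)
    one_ne_zero (by simp) (fun y hy => by
      rw [Nat.cast_zero, powL2_zero hA] at hy
      rw [eq_of_isWeakDeriv_zero hy, one_mul])
  rw [pow_zero, one_mul, one_mul] at this
  exact this.trans (derivNormSq_le_intNormSq (by omega) f)

/-- The part of the graph of `D_max` over `C₀^∞(ℝ₊, H_∞)`. -/
def smoothDmax (γ : H →L[ℂ] H) (A : H →ₗ.[ℂ] H) : Submodule ℂ (L2 H × L2 H) :=
  (Dmax γ A).graph ⊓ ((smoothTrace A).map (LinearMap.fst ℂ _ _)).comap (LinearMap.fst ℂ _ _)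

theorem mem_smoothDmax {p : L2 H × L2 H} : p ∈ smoothDmax γ A ↔ p ∈ (Dmax γ A).graph ∧
    ∃ φ : ℝ → H, IsSmoothCompact A φ ∧ p.1 =ᵐ[halfLine] φ := by
  constructor
  · rintro ⟨h1, ⟨u, x⟩, ⟨φ, hφ, h2, -⟩, h3⟩
    have h3' : u = p.1 := h3
    exact ⟨h1, φ, hφ, h3' ▸ h2⟩
  · rintro ⟨h1, φ, hφ, h2⟩
    exact ⟨h1, (p.1, φ 0), ⟨φ, hφ, h2, rfl⟩, rfl⟩

/-- Functions in `ℋ_1` can be approximated in the graph norm of `D_max` by smooth ones. -/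
theorem exists_closureValue (hA : IsSelfAdjoint A) (hγ : IsCompatible γ A) {w : L2 H}
    (hw : intNormSq A 1 w < ⊤) :
    ∃ g, (w, g) ∈ (Dmax γ A).graph ∧
      IsClosureValue (intNormSq A 1) (smoothDmax γ A) w g := by
  obtain ⟨g, hg⟩ := IsClosureValue.exists_of_dense (isQuasiSq_int A 1) (G := smoothDmax γ A)
    (f := w) (C := 6)
    (fun p hp => by
      obtain ⟨h1, φ, hφ, h2⟩ := mem_smoothDmax.1 hp
      exact enorm_Dmax_sq_le hA hγ hφ h2 h1)
    (fun ε hε => by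
      obtain ⟨u, ⟨φ, hφ, hu⟩, h⟩ := exists_smooth_near_int hA hw hε
      obtain ⟨ψ, hψ, e⟩ := exists_lift_pair hA hφ
      exact ⟨(u, _), mem_smoothDmax.2 ⟨mem_Dmax_graph_of_lift hA hγ
        (hφ.isHalfSmooth hA) hψ e hu, φ, hφ, hu⟩, h⟩)
  -- `D_max` is closed: its defining identity passes to the limit
  refine ⟨g, (mem_Dmax_graph_iff hA).2 fun p hp => ?_, hg⟩
  refine sub_eq_zero.1 (norm_le_zero_iff.1 (le_of_forall_pos_le_add fun ε hε => ?_))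
  set M := ‖p.1‖ + ‖p.2‖ + 1 with hM
  have hM0 : 0 < M := by positivity
  have hδ : 0 < ε / M := by positivity
  obtain ⟨q, hq, h1, h2⟩ := hg (ENNReal.ofReal ((ε / M) ^ 2)) (ENNReal.ofReal_pos.2 (by positivity))
  have h3 := (mem_Dmax_graph_iff hA).1 (mem_smoothDmax.1 hq).1 p hp
  have k1 : ‖w - q.1‖ ^ 2 ≤ (ε / M) ^ 2 := norm_sq_le_of_enorm_sq_le (by positivity)
    (enorm_sq_le_intNormSq hA _ 1) h1.le
  have k2 : ‖g - q.2‖ ^ 2 ≤ (ε / M) ^ 2 := norm_sq_le_of_enorm_sq_le (by positivity) h2.le le_rfl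
  have l1 := (abs_le_of_sq_le_sq' k1 hδ.le).2
  have l2 := (abs_le_of_sq_le_sq' k2 hδ.le).2
  have e : ⟪g, p.1⟫_ℂ - ⟪w, p.2⟫_ℂ = ⟪g - q.2, p.1⟫_ℂ - ⟪w - q.1, p.2⟫_ℂ := by
    rw [inner_sub_left, inner_sub_left, h3]
    ring
  rw [e, zero_add]
  refine (norm_sub_le _ _).trans ((add_le_add (norm_inner_le_norm _ _)
    (norm_inner_le_norm _ _)).trans ?_)
  have m1 := mul_le_mul_of_nonneg_right l1 (norm_nonneg p.2)
  have m2 := mul_le_mul_of_nonneg_right l2 (norm_nonneg p.1)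
  have m3 : ε / M * M = ε := div_mul_cancel₀ _ hM0.ne'
  have m4 : ε / M * M = ε / M * ‖p.1‖ + ε / M * ‖p.2‖ + ε / M := by rw [hM]; ring
  linarith

end Model

/-! ### Density in the domain of `D_max` -/

section ModelDensity

open Filter Topology

variable {H : Type*} [NormedAddCommGroup H] [InnerProductSpace ℂ H] [CompleteSpace H]
variable {A : H →ₗ.[ℂ] H} {γ : H →L[ℂ] H}

theorem inner_pointwise_comm {S : H →L[ℂ] H} (hS : ∀ x y, ⟪S x, y⟫_ℂ = ⟪x, S y⟫_ℂ) (f g : L2 H) :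
    ⟪pointwise S f, g⟫_ℂ = ⟪f, pointwise S g⟫_ℂ := by
  rw [L2.inner_def, L2.inner_def]
  refine integral_congr_ae ?_
  filter_upwards [coeFn_pointwise S f, coeFn_pointwise S g] with x h1 h2
  rw [h1, h2, hS]

theorem specCut_mem_minGraph (hA : IsSelfAdjoint A) (hγ : IsCompatible γ A) (k : ℕ)
    {p : L2 H × L2 H} (hp : p ∈ minGraph γ A) :
    (pointwise (specCut (invOneAddSq A) k) p.1, pointwise (specCut (invOneAddSq A) k) p.2) ∈
      minGraph γ A := by
  obtain ⟨φ, h1, h2, h3, h4, h5⟩ := hp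
  -- the cut-off acts on the graph of `A`, since it commutes with `A`
  set J : GraphSpace A →L[ℂ] GraphSpace A :=
    toGraph hA ∘L specCutDiv (invOneAddSq A) k 2 ∘L GraphSpace.val A with hJ
  have hval : ∀ z, GraphSpace.val A (J z) = specCut (invOneAddSq A) k (GraphSpace.val A z) :=
    fun z => resolvent_specCutDiv hA k _
  have happ : ∀ z, GraphSpace.app A (J z) = specCut (invOneAddSq A) k (GraphSpace.app A z) :=
    fun z => mulRes_specCutDiv_val hA k z
  refine ⟨fun x => J (φ x), (J.restrictScalars ℝ).contDiff.comp h1, h2.comp_left (map_zero J),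
    (tsupport_comp_subset (map_zero J) φ).trans h3, ?_, ?_⟩
  · filter_upwards [h4, coeFn_pointwise (specCut (invOneAddSq A) k) p.1] with x k1 k2
    rw [k2, k1, hval]
  · filter_upwards [h5, coeFn_pointwise (specCut (invOneAddSq A) k) p.2] with x k1 k2
    have hd : HasDerivAt (fun y => specCut (invOneAddSq A) k (GraphSpace.val A (φ y)))
        (specCut (invOneAddSq A) k (deriv (fun y => GraphSpace.val A (φ y)) x)) x :=
      ((specCut (invOneAddSq A) k).restrictScalars ℝ).hasFDerivAt.comp_hasDerivAt x
        (differentiable_val_comp A h1 x).hasDerivAt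
    rw [k2, k1, happ]
    simp only [hval]
    rw [hd.deriv, ← map_add]
    exact hγ.cfc_comm hA _ _

/-- `D_max` commutes with the spectral cut-offs. -/
theorem specCut_mem_Dmax_graph (hA : IsSelfAdjoint A) (hγ : IsCompatible γ A) (k : ℕ)
    {u g : L2 H} (h : (u, g) ∈ (Dmax γ A).graph) :
    (pointwise (specCut (invOneAddSq A) k) u, pointwise (specCut (invOneAddSq A) k) g) ∈
      (Dmax γ A).graph := by
  rw [mem_Dmax_graph_iff hA] at h ⊢
  intro p hp
  have hS : ∀ x y, ⟪specCut (invOneAddSq A) k x, y⟫_ℂ = ⟪x, specCut (invOneAddSq A) k y⟫_ℂ :=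
    cfc_inner_comm _ _
  rw [inner_pointwise_comm hS, inner_pointwise_comm hS]
  exact h _ (specCut_mem_minGraph hA hγ k hp)

/-- The spectral cut-off of an element of the domain of `D_max` has a weak derivative in `L²`,
because `A` is bounded on the range of the cut-off. -/
theorem isWeakDeriv_specCut (hA : IsSelfAdjoint A) (hγ : IsCompatible γ A) (k : ℕ)
    {u g : L2 H} (h : (u, g) ∈ (Dmax γ A).graph) :
    IsWeakDeriv 1 (pointwise (specCut (invOneAddSq A) k) u)
      (-(pointwise (mulRes hA ∘L specCutDiv (invOneAddSq A) k 2) u +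
        pointwise (γ ∘L specCut (invOneAddSq A) k) g)) := by
  intro η h1 h2 h3
  have hη' := (contDiff_infty_iff_deriv.1 h1).2
  set S := specCut (invOneAddSq A) k with hS
  set T := specCutDiv (invOneAddSq A) k 2 with hT
  have e1 : ∫ x in Ioi 0, η x • (-(pointwise (mulRes hA ∘L T) u + pointwise (γ ∘L S) g) : L2 H) x =
      -(mulRes hA (T (∫ x in Ioi 0, η x • u x)) + γ (S (∫ x in Ioi 0, η x • g x))) := by
    have i1 := integral_pointwise (mulRes hA ∘L T) u h1.continuous h2
    have i2 := integral_pointwise (γ ∘L S) g h1.continuous h2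
    rw [ContinuousLinearMap.comp_apply] at i1 i2
    rw [← i1, ← i2, ← integral_add (integrable_test _ h1.continuous h2)
      (integrable_test _ h1.continuous h2), ← integral_neg]
    refine integral_congr_ae ?_
    filter_upwards [Lp.coeFn_neg (pointwise (mulRes hA ∘L T) u + pointwise (γ ∘L S) g),
      Lp.coeFn_add (pointwise (mulRes hA ∘L T) u) (pointwise (γ ∘L S) g)] with x k1 k2
    rw [k1, Pi.neg_apply, k2, Pi.add_apply, smul_neg, smul_add]
  rw [e1, iteratedDeriv_one, integral_pointwise S u hη'.continuous h2.deriv, pow_one,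
    neg_one_smul, neg_neg]
  refine ext_inner_right ℂ fun y => ?_
  obtain ⟨p, hp, hp1, hp2⟩ := exists_mem_minGraph γ hA h1 h2 h3 (T (γ y))
  have key := (mem_Dmax_graph_iff hA).1 h p hp
  -- `D_max u = g` is tested against `η R T γ y = η γ S y`, where `S` is the cut-off and `T = S R⁻¹`
  have hST : invOneAddSq A (T (γ y)) = γ (S y) := by
    rw [hT, resolvent_specCutDiv hA, specCut, hγ.cfc_comm hA]
    rfl
  have hBT : γ (mulRes hA (T (γ y))) = mulRes hA (T y) := by
    rw [hT, specCutDiv, hγ.cfc_comm hA, hγ.mulRes_comm hA, map_neg, hγ.apply_apply, neg_neg]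
  have hp1' : p.1 =ᵐ[halfLine] fun x => η x • γ (S y) + η x • (0 : H) := by
    rw [hST] at hp1
    simpa using hp1
  have hp2' : p.2 =ᵐ[halfLine] fun x => deriv η x • (-S y) + η x • mulRes hA (T y) := by
    filter_upwards [hp2] with x hx
    rw [hx, hST, ← hBT, map_add]
    simp only [← Complex.coe_smul, map_smul, hγ.apply_apply]
  rw [inner_L2_smul_add h1.continuous h2 h1.continuous h2 hp1',
    inner_L2_smul_add hη'.continuous h2.deriv h1.continuous h2 hp2', inner_zero_right, add_zero,
    inner_neg_right, ← inner_mulRes_comm] at key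
  have c1 : ∀ x z, ⟪S x, z⟫_ℂ = ⟪x, S z⟫_ℂ := cfc_inner_comm _ _
  have c2 : ∀ x z, ⟪mulRes hA (T x), z⟫_ℂ = ⟪mulRes hA x, T z⟫_ℂ := by
    intro x z
    rw [hT, specCutDiv, ← cfc_mulRes hA, cfc_inner_comm]
  have c3 : ∀ x, ⟪γ (S x), y⟫_ℂ = -⟪x, γ (S y)⟫_ℂ := by
    intro x
    have : S (γ y) = γ (S y) := hγ.cfc_comm hA _ y
    rw [hγ.inner_comm, c1, this]
  rw [inner_add_left, c1, c2, c3, key]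
  ring

/-- The spectral cut-offs map the domain of `D_max` into `ℋ_1`. -/
theorem intNormSq_specCut_lt_top (hA : IsSelfAdjoint A) (hγ : IsCompatible γ A) (k : ℕ)
    {u g : L2 H} (h : (u, g) ∈ (Dmax γ A).graph) :
    intNormSq A 1 (pointwise (specCut (invOneAddSq A) k) u) < ⊤ := by
  have key : ∀ {l j : ℕ} {f y : L2 H}, IsWeakDeriv l f (powL2 A j y) → derivNormSq A l j f < ⊤ :=
    fun h => (derivNormSq_le hA h).trans_lt
      (ENNReal.mul_lt_top (by simp) (ENNReal.pow_lt_top (by simp)))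
  refine intNormSq_lt_top fun l j hlj => ?_
  rcases Nat.eq_zero_or_pos l with rfl | hl
  · have h0 := isWeakDeriv_zero_self (pointwise (specCut (invOneAddSq A) k) u)
    nth_rw 2 [specCut_eq_powL2 hA k j.cast_nonneg u] at h0
    exact key h0
  · obtain ⟨rfl, rfl⟩ : l = 1 ∧ j = 0 := by omega
    refine key (y := -(pointwise (mulRes hA ∘L specCutDiv (invOneAddSq A) k 2) u +
      pointwise (γ ∘L specCut (invOneAddSq A) k) g)) ?_
    rw [Nat.cast_zero, powL2_zero hA]
    exact isWeakDeriv_specCut hA hγ k h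

/-- Every element of the graph of `D_max` is a limit of elements over `C₀^∞(ℝ₊, H_∞)`. -/
theorem exists_smooth_near_Dmax (hA : IsSelfAdjoint A) (hγ : IsCompatible γ A) {u g : L2 H}
    (h : (u, g) ∈ (Dmax γ A).graph) {ε : ℝ≥0∞} (hε : 0 < ε) :
    ∃ p ∈ smoothDmax γ A, ‖u - p.1‖ₑ ^ 2 < ε ∧ ‖g - p.2‖ₑ ^ 2 < ε := by
  have hR := isResolvent_invOneAddSq hA
  obtain ⟨δ, hδ, hδε⟩ := exists_pos_mul_lt (c := 4) (by simp) hε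
  obtain ⟨k, hk1, hk2⟩ := (((norm_sq_sub_tendsto_pointwise hR.norm_specCut_le hR.tendsto_specCut
    u).eventually (gt_mem_nhds hδ)).and ((norm_sq_sub_tendsto_pointwise hR.norm_specCut_le
      hR.tendsto_specCut g).eventually (gt_mem_nhds hδ))).exists
  -- the cut-off moves `u` into `ℋ_1` and commutes with `D_max`; the rest is density in `ℋ_1`
  obtain ⟨g', hg', hcl⟩ := exists_closureValue hA hγ (intNormSq_specCut_lt_top hA hγ k h)
  rw [← unique_of_mem_Dmax_graph (specCut_mem_Dmax_graph hA hγ k h) hg'] at hcl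
  obtain ⟨p, hp, h1, h2⟩ := hcl δ hδ
  have e4 : 2 * (δ + δ) = 4 * δ := by ring
  have key : ∀ {x y z : L2 H}, ‖x - y‖ₑ ^ 2 < δ → ‖y - z‖ₑ ^ 2 < δ → ‖x - z‖ₑ ^ 2 < ε := by
    intro x y z k1 k2
    rw [← sub_add_sub_cancel x y z]
    refine ((isQuasiSq_enorm.add_le _ _).trans ?_).trans_lt hδε
    rw [← e4]
    gcongr
  exact ⟨p, hp, key hk1 ((enorm_sq_le_intNormSq hA _ 1).trans_lt h1), key hk2 h2⟩

theorem GraphSpace.enorm_sq {E F : Type*} [NormedAddCommGroup E] [InnerProductSpace ℂ E]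
    [NormedAddCommGroup F] [InnerProductSpace ℂ F] {T : E →ₗ.[ℂ] F} (z : GraphSpace T) :
    ‖z‖ₑ ^ 2 = ‖GraphSpace.val T z‖ₑ ^ 2 + ‖GraphSpace.app T z‖ₑ ^ 2 := by
  rw [enorm_sq_eq_ofReal, enorm_sq_eq_ofReal, enorm_sq_eq_ofReal, GraphSpace.norm_sq,
    ENNReal.ofReal_add (by positivity) (by positivity)]

theorem exists_smooth_near_graphSpace (hA : IsSelfAdjoint A) (hγ : IsCompatible γ A)
    (e : GraphSpace (Dmax γ A)) {ε : ℝ≥0∞} (hε : 0 < ε) :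
    ∃ d : GraphSpace (Dmax γ A), (∃ φ : ℝ → H, IsSmoothCompact A φ ∧
      GraphSpace.val (Dmax γ A) d =ᵐ[halfLine] φ) ∧ ‖e - d‖ₑ ^ 2 < ε := by
  obtain ⟨δ, hδ, hδε⟩ := exists_pos_mul_lt (c := 2) (by simp) hε
  obtain ⟨p, hp, h1, h2⟩ := exists_smooth_near_Dmax hA hγ (GraphSpace.mem_graph e) hδ
  obtain ⟨hp1, φ, hφ, hp2⟩ := mem_smoothDmax.1 hp
  refine ⟨GraphSpace.mk hp1, ⟨φ, hφ, hp2⟩, lt_of_le_of_lt ?_ hδε⟩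
  rw [GraphSpace.enorm_sq, map_sub, map_sub, two_mul]
  exact add_le_add h1.le h2.le

theorem exists_graphSpace_val_eq (hA : IsSelfAdjoint A) (hγ : IsCompatible γ A) {φ : ℝ → H}
    (hφ : IsSmoothCompact A φ) : ∃ u : GraphSpace (Dmax γ A),
      GraphSpace.val (Dmax γ A) u =ᵐ[halfLine] φ := by
  obtain ⟨ψ, hψ, e⟩ := exists_lift_pair hA hφ
  have hs := hφ.isHalfSmooth hA
  exact ⟨GraphSpace.mk (mem_Dmax_graph_of_lift hA hγ hs hψ e hs.coeFn_toL2), hs.coeFn_toL2⟩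

theorem dense_smooth_graphSpace (hA : IsSelfAdjoint A) (hγ : IsCompatible γ A) :
    Dense {u : GraphSpace (Dmax γ A) | ∃ φ : ℝ → H, IsSmoothCompact A φ ∧
      GraphSpace.val (Dmax γ A) u =ᵐ[halfLine] φ} := by
  intro e
  rw [EMetric.mem_closure_iff]
  intro ε hε
  obtain ⟨d, hd, h⟩ := exists_smooth_near_graphSpace hA hγ e (ENNReal.pow_pos hε 2)
  refine ⟨d, hd, ?_⟩
  rw [edist_eq_enorm_sub]
  exact lt_of_pow_lt_pow_left' 2 h

/-! ### The trace on the domain of `D_max` -/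

/-- The trace estimate in `H_(-1/2)`. In the boundary term `‖φ 0‖² = -2 Re ∫ ⟪φ, φ'⟫` of
`H_(-1/2)` the derivative is expressed by `D_max φ` and `A φ`, and `(1 + A²)^(-1/2) A` is
bounded. -/
theorem norm_trace_sq_le_Dmax (hA : IsSelfAdjoint A) (hγ : IsCompatible γ A) {φ : ℝ → H}
    (hφ : IsSmoothCompact A φ) {u g : L2 H} (hu : u =ᵐ[halfLine] φ)
    (h : (u, g) ∈ (Dmax γ A).graph) :
    ‖halfPow (invOneAddSq A) (1 / 2) (φ 0)‖ ^ 2 ≤ 3 * (‖u‖ ^ 2 + ‖g‖ ^ 2) := by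
  have hR := isResolvent_invOneAddSq hA
  set R := invOneAddSq A
  obtain ⟨ψ, hψ, e⟩ := exists_lift_pair hA hφ
  have hs := hφ.isHalfSmooth hA
  have hg := unique_of_mem_Dmax_graph h (mem_Dmax_graph_of_lift hA hγ hs hψ e hu)
  have hPφ := hs.clm_comp (halfPow R 1)
  have hBψ := hψ.clm_comp (mulRes hA)
  have hPB := hBψ.clm_comp (halfPow R 1)
  -- the function `φ' + A φ`, which equals `-γ (D_max φ)`
  have hG : IsHalfSmooth fun x => derivWithin φ (Ici 0) x + mulRes hA (ψ x) := by
    have h1 : IsHalfSmooth fun x => (0 : H) := ⟨contDiffOn_const, 0, fun _ _ => rfl⟩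
    have h2 := hs.derivWithin.sub (h1.sub hBψ)
    simpa using h2
  have n1 : ‖hPφ.toL2‖ ≤ ‖u‖ := by
    refine Lp.norm_le_norm_of_ae_le ?_
    filter_upwards [hPφ.coeFn_toL2, hu] with x h1 h2
    rw [h1, h2]
    exact hR.norm_halfPow_le zero_le_one _
  have n2 : ‖hG.toL2‖ ≤ ‖g‖ := by
    rw [hg]
    refine Lp.norm_le_norm_of_ae_le ?_
    filter_upwards [hG.coeFn_toL2, (hs.derivWithin.clm_comp γ).coeFn_toL2,
      (hBψ.clm_comp γ).coeFn_toL2, Lp.coeFn_add (hs.derivWithin.clm_comp γ).toL2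
        (hBψ.clm_comp γ).toL2] with x h1 h2 h3 h4
    rw [h4, Pi.add_apply, h2, h3, ← map_add, hγ.norm_apply, h1]
  have n3 : ‖hPB.toL2‖ ≤ ‖u‖ := by
    refine Lp.norm_le_norm_of_ae_le ?_
    filter_upwards [hPB.coeFn_toL2, hu, ae_restrict_mem measurableSet_Ioi] with x h1 h2 h3
    rw [h1, h2, ← e x (le_of_lt h3), halfPow, cfc_mulRes hA]
    refine (norm_mulRes_le hA _).trans (le_of_eq ?_)
    change ‖halfPow R 1 (halfPow R 1 (ψ x))‖ = _
    rw [← hR.halfPow_add zero_le_one zero_le_one, one_add_one_eq_two, hR.halfPow_two]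
  have n4 : ‖hs.toL2‖ = ‖u‖ := by
    congr 1
    exact Lp.ext (hs.coeFn_toL2.trans hu.symm)
  have hsplit : ∫ x in Ioi 0, ⟪halfPow R 1 (φ x), derivWithin φ (Ici 0) x⟫_ℂ =
      (∫ x in Ioi 0, ⟪halfPow R 1 (φ x), derivWithin φ (Ici 0) x + mulRes hA (ψ x)⟫_ℂ) -
        ∫ x in Ioi 0, ⟪φ x, halfPow R 1 (mulRes hA (ψ x))⟫_ℂ := by
    rw [← integral_sub (hPφ.integrable_inner hG) (hs.integrable_inner hPB)]
    refine setIntegral_congr_fun measurableSet_Ioi fun x _ => ?_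
    rw [inner_add_right, halfPow_inner_comm R 1 (φ x) (mulRes hA (ψ x)), add_sub_cancel_right]
  rw [hR.norm_boundary_sq hs, hsplit, Complex.sub_re]
  have i1 := (Complex.abs_re_le_norm _).trans (norm_integral_inner_le hPφ hG)
  have i2 := (Complex.abs_re_le_norm _).trans (norm_integral_inner_le hs hPB)
  have j1 := mul_le_mul n1 n2 (norm_nonneg _) (norm_nonneg _)
  have j2 := mul_le_mul n4.le n3 (norm_nonneg _) (norm_nonneg _)
  nlinarith [(abs_le.1 i1).1, (abs_le.1 i2).2, sq_nonneg (‖u‖ - ‖g‖), sq_nonneg ‖g‖]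

/-- On `H`, the norm of `H_(-1/2)` is bounded by that of `R^(1/4) x`, up to a constant. -/
theorem norm_ofH_sq_le (hA : IsSelfAdjoint A) (x : H) :
    ‖HsDual.ofH A (1 / 2) x‖ ^ 2 ≤ 2 * ‖halfPow (invOneAddSq A) (1 / 2) x‖ ^ 2 := by
  set c := ‖halfPow (invOneAddSq A) (1 / 2) x‖
  have h : ‖HsDual.ofH A (1 / 2) x‖ ≤ √2 * c := by
    refine ContinuousLinearMap.opNorm_le_bound _ (by positivity) fun v => ?_
    obtain ⟨y, rfl⟩ := (hsEquiv hA (s := 1 / 2) (by norm_num)).surjective v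
    have e : HsDual.ofH A (1 / 2) x (hsEquiv hA (s := 1 / 2) (by norm_num) y) =
        ⟪y, halfPow (invOneAddSq A) (1 / 2) x⟫_ℂ := by
      rw [← halfPow_inner_comm]
      rfl
    have h1 := norm_sq_le_hsEquiv hA (s := 1 / 2) (by norm_num) y
    have h2 : (2 : ℝ) ^ (1 / 2 : ℝ) ≤ 2 := by
      conv_rhs => rw [← Real.rpow_one 2]
      exact Real.rpow_le_rpow_of_exponent_le one_le_two (by norm_num)
    have h3 : ‖y‖ ≤ √2 * ‖hsEquiv hA (s := 1 / 2) (by norm_num) y‖ := by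
      rw [← Real.sqrt_sq (norm_nonneg (hsEquiv hA (s := 1 / 2) (by norm_num) y)),
        ← Real.sqrt_mul two_pos.le]
      exact Real.le_sqrt_of_sq_le (h1.trans (mul_le_mul_of_nonneg_right h2 (sq_nonneg _)))
    rw [e]
    refine (norm_inner_le_norm _ _).trans
      ((mul_le_mul_of_nonneg_right h3 (norm_nonneg _)).trans_eq ?_)
    ring
  calc ‖HsDual.ofH A (1 / 2) x‖ ^ 2 ≤ (√2 * c) ^ 2 := by gcongr
    _ = 2 * c ^ 2 := by rw [mul_pow, Real.sq_sqrt two_pos.le]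

/-- The inclusion `H ⊆ H_(-s)` as a linear map. -/
def HsDual.ofHLinear (A : H →ₗ.[ℂ] H) (s : ℝ) : H →ₗ[ℂ] HsDual A s where
  toFun := HsDual.ofH A s
  map_add' x y := by
    refine ContinuousLinearMap.ext fun v => ?_
    exact inner_add_right _ _ _
  map_smul' c x := by
    refine ContinuousLinearMap.ext fun v => ?_
    exact inner_smul_right _ _ _

/-- A densely defined bounded linear relation between a normed space and a Banach space extends
uniquely to a bounded operator. -/
theorem existsUnique_clm_extension {E F : Type*} [NormedAddCommGroup E] [NormedSpace ℂ E]
    [NormedAddCommGroup F] [NormedSpace ℂ F] [CompleteSpace F] (G : Submodule ℂ (E × F)) {C : ℝ≥0}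
    (hG : ∀ p ∈ G, ‖p.2‖ ^ 2 ≤ C * ‖p.1‖ ^ 2) (hd : Dense (Prod.fst '' (G : Set (E × F)))) :
    ∃! r : E →L[ℂ] F, ∀ p ∈ G, r p.1 = p.2 := by
  obtain ⟨r, ⟨⟨C, hC⟩, hr⟩, -⟩ := existsUnique_extension (E := E) isQuasiSq_enorm ⊤ G
    (fun p hp => enorm_sq_le_of_norm_sq_le (hG p hp))
    (fun f _ ε hε => by
      obtain ⟨_, ⟨p, hp, rfl⟩, h⟩ :=
        EMetric.mem_closure_iff.1 (hd f) (ε ^ (1 / 2 : ℝ)) (ENNReal.rpow_pos_of_nonneg hε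
          (by norm_num))
      refine ⟨p, hp, trivial, ?_⟩
      rw [edist_eq_enorm_sub] at h
      have h2 := ENNReal.rpow_lt_rpow h two_pos
      rw [← ENNReal.rpow_mul, one_div_mul_cancel two_ne_zero, ENNReal.rpow_one] at h2
      exact_mod_cast h2)
  refine ⟨(r ∘ₗ Submodule.topEquiv.symm.toLinearMap).mkContinuous (√C) fun f => ?_,
    fun p hp => hr p hp trivial, fun r' hr' => ?_⟩
  · have h1 := hC (Submodule.topEquiv.symm f)
    rw [enorm_sq_eq_ofReal, enorm_sq_eq_ofReal, ← ENNReal.ofReal_coe_nnreal,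
      ← ENNReal.ofReal_mul (by positivity), ENNReal.ofReal_le_ofReal_iff (by positivity)] at h1
    rw [← Real.sqrt_sq (norm_nonneg f), ← Real.sqrt_mul C.coe_nonneg]
    exact Real.le_sqrt_of_sq_le h1
  · refine ContinuousLinearMap.coeFn_injective (Continuous.ext_on hd r'.continuous
      (ContinuousLinearMap.continuous _) ?_)
    rintro _ ⟨p, hp, rfl⟩
    rw [hr' p hp]
    exact (hr p hp trivial).symm

theorem norm_ofH_trace_sq_le_Dmax (hA : IsSelfAdjoint A) (hγ : IsCompatible γ A) {φ : ℝ → H}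
    (hφ : IsSmoothCompact A φ) {u : GraphSpace (Dmax γ A)}
    (hu : GraphSpace.val (Dmax γ A) u =ᵐ[halfLine] φ) :
    ‖HsDual.ofH A (1 / 2) (φ 0)‖ ^ 2 ≤ 6 * ‖u‖ ^ 2 := by
  have h1 := norm_trace_sq_le_Dmax hA hγ hφ hu (GraphSpace.mem_graph u)
  have h2 := norm_ofH_sq_le hA (φ 0)
  have h3 : ‖u‖ ^ 2 = _ := GraphSpace.norm_sq u
  rw [← h3] at h1
  exact h2.trans ((mul_le_mul_of_nonneg_left h1 two_pos.le).trans_eq (by ring))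

/-- The pairs `(u, φ 0)` of an element of `D(D_max)` represented by a function `φ` that is smooth
up to the boundary, and its boundary value in `H_(-1/2)`. -/
def smoothTraceDmax (γ : H →L[ℂ] H) (A : H →ₗ.[ℂ] H) :
    Submodule ℂ (GraphSpace (Dmax γ A) × HsDual A (1 / 2)) :=
  ((smoothTrace A).comap ((GraphSpace.val (Dmax γ A)).toLinearMap.prodMap LinearMap.id)).map
    (LinearMap.id.prodMap (HsDual.ofHLinear A (1 / 2)))

theorem mem_smoothTraceDmax {p : GraphSpace (Dmax γ A) × HsDual A (1 / 2)} :
    p ∈ smoothTraceDmax γ A ↔ ∃ φ : ℝ → H, IsSmoothCompact A φ ∧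
      GraphSpace.val (Dmax γ A) p.1 =ᵐ[halfLine] φ ∧ p.2 = HsDual.ofH A (1 / 2) (φ 0) := by
  constructor
  · rintro ⟨⟨u, x⟩, ⟨φ, hφ, h1, h2⟩, rfl⟩
    exact ⟨φ, hφ, h1, congrArg (HsDual.ofH A (1 / 2)) h2⟩
  · rintro ⟨φ, hφ, h1, h2⟩
    exact ⟨(p.1, φ 0), ⟨φ, hφ, h1, rfl⟩, Prod.ext rfl h2.symm⟩

theorem norm_sq_le_of_mem_smoothTraceDmax (hA : IsSelfAdjoint A) (hγ : IsCompatible γ A)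
    {p : GraphSpace (Dmax γ A) × HsDual A (1 / 2)} (hp : p ∈ smoothTraceDmax γ A) :
    ‖p.2‖ ^ 2 ≤ 6 * ‖p.1‖ ^ 2 := by
  obtain ⟨φ, hφ, h1, h2⟩ := mem_smoothTraceDmax.1 hp
  rw [h2]
  exact norm_ofH_trace_sq_le_Dmax hA hγ hφ h1

theorem dense_fst_smoothTraceDmax (hA : IsSelfAdjoint A) (hγ : IsCompatible γ A) :
    Dense (Prod.fst '' (smoothTraceDmax γ A :
      Set (GraphSpace (Dmax γ A) × HsDual A (1 / 2)))) := by
  refine (dense_smooth_graphSpace hA hγ).mono ?_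
  rintro u ⟨φ, hφ, hu⟩
  exact ⟨(u, HsDual.ofH A (1 / 2) (φ 0)), mem_smoothTraceDmax.2 ⟨φ, hφ, hu, rfl⟩, rfl⟩

set_option maxHeartbeats 1000000 in
-- The instances on `GraphSpace` and `HsDual` are slow to unify.
theorem existsUnique_clm_smoothTraceDmax (hA : IsSelfAdjoint A) (hγ : IsCompatible γ A) :
    ∃! r : GraphSpace (Dmax γ A) →L[ℂ] HsDual A (1 / 2),
      ∀ p ∈ smoothTraceDmax γ A, r p.1 = p.2 := by
  refine existsUnique_clm_extension (E := GraphSpace (Dmax γ A)) (F := HsDual A (1 / 2))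
    (smoothTraceDmax γ A) (C := 6) ?_ ?_
  · exact fun p hp => norm_sq_le_of_mem_smoothTraceDmax hA hγ hp
  · exact dense_fst_smoothTraceDmax hA hγ

theorem existsUnique_trace_Dmax (hA : IsSelfAdjoint A) (hγ : IsCompatible γ A) :
    ∃! r : GraphSpace (Dmax γ A) →L[ℂ] HsDual A (1 / 2),
      ∀ φ : ℝ → H, IsSmoothCompact A φ → ∀ u : GraphSpace (Dmax γ A),
        GraphSpace.val (Dmax γ A) u =ᵐ[halfLine] φ → r u = HsDual.ofH A (1 / 2) (φ 0) := by
  obtain ⟨r, hr, hr2⟩ := existsUnique_clm_smoothTraceDmax hA hγ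
  refine ⟨r, fun φ hφ u hu => hr (u, _) (mem_smoothTraceDmax.2 ⟨φ, hφ, hu, rfl⟩),
    fun r' hr' => hr2 r' fun p hp => ?_⟩
  obtain ⟨φ, hφ, h1, h2⟩ := mem_smoothTraceDmax.1 hp
  rw [h2]
  exact hr' φ hφ p.1 h1

end ModelDensity

end TraceThm

end

/-- Trace theorem for the abstract Sobolev scale. -/
theorem mainTheorem10 {H : Type*} [NormedAddCommGroup H] [InnerProductSpace ℂ H] [CompleteSpace H]
    (A : H →ₗ.[ℂ] H) (hA : IsSelfAdjoint A) :
    (∀ s : ℝ, 1 / 2 < s →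
      (∀ φ : ℝ → H, TraceThm.IsSmoothCompact A φ →
        ∃ u ∈ TraceThm.scaleSpace A s, u =ᵐ[TraceThm.halfLine] φ) ∧
      (∀ f ∈ TraceThm.scaleSpace A s, ∀ ε : ℝ≥0∞, 0 < ε →
        ∃ u : TraceThm.L2 H, (∃ φ : ℝ → H, TraceThm.IsSmoothCompact A φ ∧
          u =ᵐ[TraceThm.halfLine] φ) ∧ TraceThm.scaleNormSq A s (f - u) < ε) ∧
      ∃! r : TraceThm.scaleSpace A s →ₗ[ℂ] TraceThm.Hs A (s - 1 / 2),
        (∃ C : ℝ≥0, ∀ f : TraceThm.scaleSpace A s,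
          ‖r f‖ₑ ^ 2 ≤ C * TraceThm.scaleNormSq A s (f : TraceThm.L2 H)) ∧
        ∀ φ : ℝ → H, TraceThm.IsSmoothCompact A φ → ∀ f : TraceThm.scaleSpace A s,
          (f : TraceThm.L2 H) =ᵐ[TraceThm.halfLine] φ →
            TraceThm.Hs.val A (s - 1 / 2) (r f) = φ 0) ∧
    (∀ γ : H →L[ℂ] H, TraceThm.IsCompatible γ A →
      (∀ φ : ℝ → H, TraceThm.IsSmoothCompact A φ →
        ∃ u : TraceThm.GraphSpace (TraceThm.Dmax γ A),
          TraceThm.GraphSpace.val (TraceThm.Dmax γ A) u =ᵐ[TraceThm.halfLine] φ) ∧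
      Dense {u : TraceThm.GraphSpace (TraceThm.Dmax γ A) |
        ∃ φ : ℝ → H, TraceThm.IsSmoothCompact A φ ∧
          TraceThm.GraphSpace.val (TraceThm.Dmax γ A) u =ᵐ[TraceThm.halfLine] φ} ∧
      ∃! r : TraceThm.GraphSpace (TraceThm.Dmax γ A) →L[ℂ] TraceThm.HsDual A (1 / 2),
        ∀ φ : ℝ → H, TraceThm.IsSmoothCompact A φ →
          ∀ u : TraceThm.GraphSpace (TraceThm.Dmax γ A),
            TraceThm.GraphSpace.val (TraceThm.Dmax γ A) u =ᵐ[TraceThm.halfLine] φ →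
              r u = TraceThm.HsDual.ofH A (1 / 2) (φ 0)) := by
  refine ⟨fun s hs => ⟨fun φ hφ => TraceThm.exists_mem_scaleSpace hA (by linarith) hφ,
    fun f hf ε hε => TraceThm.exists_smooth_near hA (by linarith) hf hε,
    TraceThm.existsUnique_trace hA hs⟩, fun γ hγ => ⟨fun φ hφ =>
    TraceThm.exists_graphSpace_val_eq hA hγ hφ, TraceThm.dense_smooth_graphSpace hA hγ,
    TraceThm.existsUnique_trace_Dmax hA hγ⟩⟩
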